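/- **Setting.** Let $a\in C^\infty[0,1]$ be real valued with $a\ge a_0>0$, put $\beta:=-\frac{1}{2a^{1/4}}\,(a^{-1/4})''$, $\beta_+:=\max(0,\beta)$, and let $0<\varepsilon_0<\min\{1,\min_{x\in[0,1]}a(x)^{1/4}\beta_+(x)^{-1/2}\}$, where $a(x)^{1/4}\beta_+(x)^{-1/2}:=+\infty$ if $\beta_+(x)=0$ (Hypothesis A). Let $\phi(x):=\int_0^x(\sqrt{a}-\varepsilon^2\beta)\,d\tau$. For $\psi$ solving $\varepsilon^2\psi''+a\psi=0$ on $(0,1)$, $\psi(0)=\psi_0\in\mathbb C$, $\varepsilon\psi'(0)=\psi_1\in\mathbb C$, let $U:=\big(a^{1/4}\psi,\ \varepsilon (a^{1/4}\psi)'/\sqrt a\big)^\top$. Let $\tilde\phi:=\tilde\phi_1-\varepsilon^2\tilde\phi_2$ with real valued $\tilde\phi_1,\tilde\phi_2\in C^\infty[0,1]$ and $\tilde\phi_1'\ge C_2>0$ (Hypothesis B). Put $\tilde\beta:=\tilde\phi_2'$, $\tilde\beta_0:=\tilde\beta/(2\tilde\phi')$, $\tilde\beta_k:=\tilde\beta_{k-1}'/(2\tilde\phi')$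 for $k=1,2,3$, $H_1(x):=e^{ix}-1$, $H_2(x):=e^{ix}-1-ix$, $P:=\frac1{\sqrt2}\begin{pmatrix} i&1\\1&i\end{pmatrix}$ and $\tilde\Phi:=\mathrm{diag}(\tilde\phi,-\tilde\phi)$. Let $0=x_1<\dots<x_N=1$ be a grid, $N\ge2$, $h:=\max_n(x_{n+1}-x_n)$. Write $\tilde\beta_{k,n}:=\tilde\beta_k(x_n)$, $\tilde\beta^n:=\tilde\beta(x_n)$, $e_n^{\pm}:=e^{\pm\frac{2i}{\varepsilon}\tilde\phi(x_n)}$, $\sigma_n:=\frac2\varepsilon(\tilde\phi(x_{n+1})-\tilde\phi(x_n))$ and $\mathrm{off}(u,v):=\begin{pmatrix}0&u\\v&0\end{pmatrix}$. Define $$\tilde A_n^1:=\varepsilon^3\tilde\beta_{1,n+1}\,\mathrm{off}\big(e_n^-H_1(-\sigma_n),\,e_n^+H_1(\sigma_n)\big)-i\varepsilon^2\,\mathrm{off}\big(\tilde\beta_{0,n}e_n^--\tilde\beta_{0,n+1}e_{n+1}^-,\ \tilde\beta_{0,n+1}e_{n+1}^+-\tilde\beta_{0,n}e_n^+\big),$$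 $$\begin{aligned}\tilde A_n^2:={}&-i\varepsilon^2\,\mathrm{off}\big(\tilde\beta_{0,n}e_n^--\tilde\beta_{0,n+1}e_{n+1}^-,\ \tilde\beta_{0,n+1}e_{n+1}^+-\tilde\beta_{0,n}e_n^+\big)+\varepsilon^3\,\mathrm{off}\big(\tilde\beta_{1,n+1}e_{n+1}^--\tilde\beta_{1,n}e_n^-,\ \tilde\beta_{1,n+1}e_{n+1}^+-\tilde\beta_{1,n}e_n^+\big)\\&+i\varepsilon^4\tilde\beta_{2,n+1}\,\mathrm{off}\big(-e_n^-H_1(-\sigma_n),\,e_n^+H_1(\sigma_n)\big)-\varepsilon^5\tilde\beta_{3,n+1}\,\mathrm{off}\big(e_n^-H_2(-\sigma_n),\,e_n^+H_2(\sigma_n)\big),\end{aligned}$$ $$\begin{aligned}\tilde A_n^3:={}&-i\varepsilon^3(x_{n+1}-x_n)\tfrac{\tilde\beta^{n+1}\tilde\beta_{0,n+1}+\tilde\beta^{n}\tilde\beta_{0,n}}2\,\mathrm{diag}(1,-1)-\varepsilon^4\tilde\beta_{0,n}\tilde\beta_{0,n+1}\,\mathrm{diag}\big(H_1(-\sigma_n),H_1(\sigma_n)\big)\\&+i\varepsilon^5\tilde\beta_{1,n+1}(\tilde\beta_{0,n}-\tilde\beta_{0,n+1})\,\mathrm{diag}\big(H_2(-\sigma_n),-H_2(\sigma_n)\big).\end{aligned}$$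 The first (second) order scheme is $\tilde Z_1:=PU(0)$, $\tilde Z_{n+1}:=(I+\tilde A^1_n)\tilde Z_n$ (respectively $\tilde Z_{n+1}:=(I+\tilde A^2_n+\tilde A^3_n)\tilde Z_n$) for $1\le n\le N-1$, and $\tilde U_n:=P^{-1}e^{\frac i\varepsilon\tilde\Phi(x_n)}\tilde Z_n$ for $1\le n\le N$. **Theorem.** Let $a,a_0,\varepsilon_0$ satisfy Hypothesis A, let $C_2>0$, $K,R\in\mathbb R$, and let $\|\cdot\|$ be a norm on $\mathbb C^2$. Consider all pairs $(\tilde\phi_1,\tilde\phi_2)$ that satisfy Hypothesis B with the constant $C_2$ and whose derivatives of orders $1,\dots,5$ are bounded by $K$ in absolute value on $[0,1]$. (i) There are $\tilde\varepsilon_0\in(0,\varepsilon_0]$ and $C_3>0$ such that for all these pairs $\tilde\phi'\ge C_3$ on $[0,1]$ for every $\varepsilon\in(0,\tilde\varepsilon_0]$. (ii) For every $\tilde\varepsilon_0\in(0,\varepsilon_0]$ and every $C_3>0$ there is a constant $C>0$, depending only on $a,a_0,\varepsilon_0,\tilde\varepsilon_0,C_2,C_3,K,R$ and the norm, such that the following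 holds for all these pairs that also satisfy $\tilde\phi'\ge C_3$ on $[0,1]$ for every $\varepsilon\in(0,\tilde\varepsilon_0]$. If $E,E',E''$ are numbers with $\|\phi-\tilde\phi\|_{L^\infty(0,1)}\le E$, $\|\phi'-\tilde\phi'\|_{L^\infty(0,1)}\le E'$ and $\|\phi''-\tilde\phi''\|_{L^\infty(0,1)}\le E''$ for all $\varepsilon\in(0,\tilde\varepsilon_0]$, then for all $\varepsilon\in(0,\tilde\varepsilon_0]$, all initial data with $|\psi_0|,|\psi_1|\le R$, all grids and all $1\le n\le N$, the first order scheme satisfies $$\|U(x_n)-\tilde U_n\|\le C\frac E\varepsilon+C\varepsilon^2\min(\varepsilon,h)+C\varepsilon\big[\min(\varepsilon,E)+\varepsilon(E'+E'')\big],$$ and the second order scheme satisfies $$\|U(x_n)-\tilde U_n\|\le C\frac E\varepsilon+C\varepsilon^3h^2+C\varepsilon\big[\min(\varepsilon,E)+\varepsilon(E'+E'')\big].$$ -/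

import Mathlib

namespace WKB

/-- Derivative of a function on the interval `[0,1]` (one-sided at the end points). -/
noncomputable def dx {F : Type*} [NormedAddCommGroup F] [NormedSpace ℝ F] (f : ℝ → F) : ℝ → F :=
  fun x => derivWithin f (Set.Icc (0 : ℝ) 1) x

/-- `β = - (1 / (2 a^{1/4})) (a^{-1/4})''`. -/
noncomputable def beta (a : ℝ → ℝ) (x : ℝ) : ℝ :=
  -(1 / (2 * a x ^ (1 / 4 : ℝ))) * dx (dx fun y => a y ^ (-(1 / 4) : ℝ)) x

/-- The exact phase `φ(x) = ∫₀ˣ (√a - ε² β) dτ`. -/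
noncomputable def phase (a : ℝ → ℝ) (ε x : ℝ) : ℝ :=
  ∫ τ in (0 : ℝ)..x, (√(a τ) - ε ^ 2 * beta a τ)

/-- The approximate phase `φ̃ = φ̃₁ - ε² φ̃₂`. -/
def approxPhase (p₁ p₂ : ℝ → ℝ) (ε x : ℝ) : ℝ := p₁ x - ε ^ 2 * p₂ x

/-- Hypothesis A: `a ∈ C^∞[0,1]`, `a ≥ a₀ > 0` and `0 < ε₀ < min {1, min_x a^{1/4} β₊^{-1/2}}`.
At points where `β ≤ 0` the quantity `a^{1/4} β₊^{-1/2}` is `+∞` and imposes no condition. -/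
structure HypothesisA (a : ℝ → ℝ) (a₀ ε₀ : ℝ) : Prop where
  smooth : ContDiffOn ℝ (⊤ : ℕ∞) a (Set.Icc 0 1)
  a₀_pos : 0 < a₀
  lower : ∀ x ∈ Set.Icc (0 : ℝ) 1, a₀ ≤ a x
  ε₀_pos : 0 < ε₀
  ε₀_lt_one : ε₀ < 1
  ε₀_lt : ∀ x ∈ Set.Icc (0 : ℝ) 1, 0 < beta a x →
    ε₀ < a x ^ (1 / 4 : ℝ) * beta a x ^ (-(1 / 2) : ℝ)

/-- Hypothesis B: `φ̃₁, φ̃₂ ∈ C^∞[0,1]` and `φ̃₁' ≥ C₂ > 0`. -/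
structure HypothesisB (p₁ p₂ : ℝ → ℝ) (C₂ : ℝ) : Prop where
  smooth₁ : ContDiffOn ℝ (⊤ : ℕ∞) p₁ (Set.Icc 0 1)
  smooth₂ : ContDiffOn ℝ (⊤ : ℕ∞) p₂ (Set.Icc 0 1)
  C₂_pos : 0 < C₂
  lower : ∀ x ∈ Set.Icc (0 : ℝ) 1, C₂ ≤ dx p₁ x

/-- The derivatives of `φ̃₁` and `φ̃₂` of orders one to five are bounded by `K` on `[0,1]`. -/
def DerivBound (p₁ p₂ : ℝ → ℝ) (K : ℝ) : Prop :=
  ∀ k ∈ Set.Icc 1 5, ∀ x ∈ Set.Icc (0 : ℝ) 1,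
    |iteratedDerivWithin k p₁ (Set.Icc 0 1) x| ≤ K ∧
    |iteratedDerivWithin k p₂ (Set.Icc 0 1) x| ≤ K

/-- `φ̃' ≥ C₃` on `[0,1]`, uniformly for `0 < ε ≤ ε̃₀`. -/
def PhaseDerivLower (p₁ p₂ : ℝ → ℝ) (ε' C₃ : ℝ) : Prop :=
  ∀ ε ∈ Set.Ioc 0 ε', ∀ x ∈ Set.Icc (0 : ℝ) 1, C₃ ≤ dx (approxPhase p₁ p₂ ε) x

/-- `E`, `E'`, `E''` bound `‖φ - φ̃‖_∞`, `‖φ' - φ̃'‖_∞`, `‖φ'' - φ̃''‖_∞`, uniformly for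
`0 < ε ≤ ε̃₀`. -/
def PhaseErrors (a p₁ p₂ : ℝ → ℝ) (ε' E E' E'' : ℝ) : Prop :=
  ∀ ε ∈ Set.Ioc 0 ε', ∀ x ∈ Set.Icc (0 : ℝ) 1,
    |phase a ε x - approxPhase p₁ p₂ ε x| ≤ E ∧
    |dx (phase a ε) x - dx (approxPhase p₁ p₂ ε) x| ≤ E' ∧
    |dx (dx (phase a ε)) x - dx (dx (approxPhase p₁ p₂ ε)) x| ≤ E''

/-- `ψ ∈ C²[0,1]` solves `ε² ψ'' + a ψ = 0` on `(0,1)`, `ψ(0) = ψ₀`, `ε ψ'(0) = ψ₁`. -/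
structure IsSolution (a : ℝ → ℝ) (ε : ℝ) (ψ₀ ψ₁ : ℂ) (ψ : ℝ → ℂ) : Prop where
  smooth : ContDiffOn ℝ 2 ψ (Set.Icc 0 1)
  ode : ∀ x ∈ Set.Ioo (0 : ℝ) 1, (ε : ℂ) ^ 2 * dx (dx ψ) x + (a x : ℂ) * ψ x = 0
  init₀ : ψ 0 = ψ₀
  init₁ : (ε : ℂ) * dx ψ 0 = ψ₁

/-- The vector `U = (a^{1/4} ψ, ε (a^{1/4} ψ)' / √a)`. -/
noncomputable def vecU (a : ℝ → ℝ) (ε : ℝ) (ψ : ℝ → ℂ) (x : ℝ) : Fin 2 → ℂ :=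
  ![((a x ^ (1 / 4 : ℝ) : ℝ) : ℂ) * ψ x,
    (ε : ℂ) * dx (fun y => ((a y ^ (1 / 4 : ℝ) : ℝ) : ℂ) * ψ y) x / ((√(a x) : ℝ) : ℂ)]

/-- A grid `0 = x_1 < ⋯ < x_N = 1` with maximal step size `h`. -/
structure IsGrid (N : ℕ) (x : ℕ → ℝ) (h : ℝ) : Prop where
  two_le : 2 ≤ N
  first : x 1 = 0
  last : x N = 1
  step : ∀ n ∈ Set.Ico 1 N, x n < x (n + 1)
  width : IsGreatest ((fun n => |x (n + 1) - x n|) '' Set.Ico 1 N) h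

/-- The unitary matrix `P`. -/
noncomputable def matP : Matrix (Fin 2) (Fin 2) ℂ :=
  ((1 / √2 : ℝ) : ℂ) • !![Complex.I, 1; 1, Complex.I]

/-- The inverse of `P`. -/
noncomputable def matPinv : Matrix (Fin 2) (Fin 2) ℂ :=
  ((1 / √2 : ℝ) : ℂ) • !![-Complex.I, 1; 1, -Complex.I]

theorem matP_mul_matPinv : matP * matPinv = 1 := by
  have h : ((√2 : ℝ) : ℂ) ^ 2 = 2 := by
    rw [← Complex.ofReal_pow, Real.sq_sqrt (by norm_num)]; norm_num
  have h0 : ((√2 : ℝ) : ℂ) ≠ 0 := by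
    intro h1; rw [h1] at h; norm_num at h
  ext i j
  fin_cases i <;> fin_cases j <;> simp [matP, matPinv, Matrix.mul_apply, Fin.sum_univ_two]
  · field_simp; rw [h]; norm_num
  · field_simp; rw [h]; norm_num
  · ring
  · field_simp; rw [h]; norm_num

/-- `e^{(i/ε) Φ}` for `Φ = diag (s, -s)`. -/
noncomputable def expPhase (ε s : ℝ) : Matrix (Fin 2) (Fin 2) ℂ :=
  !![Complex.exp (Complex.I * (s / ε : ℝ)), 0; 0, Complex.exp (-(Complex.I * (s / ε : ℝ)))]

/-- `H₁(x) = e^{ix} - 1`. -/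
noncomputable def H₁ (x : ℝ) : ℂ := Complex.exp (Complex.I * x) - 1

/-- `H₂(x) = e^{ix} - 1 - ix`. -/
noncomputable def H₂ (x : ℝ) : ℂ := Complex.exp (Complex.I * x) - 1 - Complex.I * x

/-- For a phase `p` and a function `b`: `β₀ = b / (2 p')`, `β_k = β_{k-1}' / (2 p')`. -/
noncomputable def betaK (p b : ℝ → ℝ) : ℕ → ℝ → ℝ
  | 0 => fun y => b y / (2 * dx p y)
  | k + 1 => fun y => 1 / (2 * dx p y) * dx (betaK p b k) y

/-- `e^{(2i/ε) s}`. -/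
noncomputable def osc (ε s : ℝ) : ℂ := Complex.exp (Complex.I * (2 / ε * s : ℝ))

/-- The matrix `A¹` of the first order scheme with phase `p` and coefficient `b`, for the step from
`s` to `t`. -/
noncomputable def matA1 (p b : ℝ → ℝ) (ε s t : ℝ) : Matrix (Fin 2) (Fin 2) ℂ :=
  ((ε ^ 3 * betaK p b 1 t : ℝ) : ℂ) •
      !![0, osc ε (-p s) * H₁ (-(2 / ε) * (p t - p s));
        osc ε (p s) * H₁ (2 / ε * (p t - p s)), 0]
    - (Complex.I * (ε : ℂ) ^ 2) •
      !![0, betaK p b 0 s * osc ε (-p s) - betaK p b 0 t * osc ε (-p t);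
        betaK p b 0 t * osc ε (p t) - betaK p b 0 s * osc ε (p s), 0]

/-- The matrix `A²` of the second order scheme. -/
noncomputable def matA2 (p b : ℝ → ℝ) (ε s t : ℝ) : Matrix (Fin 2) (Fin 2) ℂ :=
  -((Complex.I * (ε : ℂ) ^ 2) •
      !![0, betaK p b 0 s * osc ε (-p s) - betaK p b 0 t * osc ε (-p t);
        betaK p b 0 t * osc ε (p t) - betaK p b 0 s * osc ε (p s), 0])
    + ((ε : ℂ) ^ 3) •
      !![0, betaK p b 1 t * osc ε (-p t) - betaK p b 1 s * osc ε (-p s);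
        betaK p b 1 t * osc ε (p t) - betaK p b 1 s * osc ε (p s), 0]
    + (Complex.I * (ε : ℂ) ^ 4 * (betaK p b 2 t : ℂ)) •
      !![0, -(osc ε (-p s) * H₁ (-(2 / ε) * (p t - p s)));
        osc ε (p s) * H₁ (2 / ε * (p t - p s)), 0]
    - ((ε : ℂ) ^ 5 * (betaK p b 3 t : ℂ)) •
      !![0, osc ε (-p s) * H₂ (-(2 / ε) * (p t - p s));
        osc ε (p s) * H₂ (2 / ε * (p t - p s)), 0]

/-- The matrix `A³` of the second order scheme. -/
noncomputable def matA3 (p b : ℝ → ℝ) (ε s t : ℝ) : Matrix (Fin 2) (Fin 2) ℂ :=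
  -((Complex.I * (ε : ℂ) ^ 3 *
        (((t - s) * ((b t * betaK p b 0 t + b s * betaK p b 0 s) / 2) : ℝ) : ℂ)) •
      !![1, 0; 0, -1])
    - ((ε : ℂ) ^ 4 * ((betaK p b 0 s * betaK p b 0 t : ℝ) : ℂ)) •
      !![H₁ (-(2 / ε) * (p t - p s)), 0; 0, H₁ (2 / ε * (p t - p s))]
    + (Complex.I * (ε : ℂ) ^ 5 *
        ((betaK p b 1 t * (betaK p b 0 s - betaK p b 0 t) : ℝ) : ℂ)) •
      !![H₂ (-(2 / ε) * (p t - p s)), 0; 0, -H₂ (2 / ε * (p t - p s))]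

/-- The marching recursion `Z_1 = Z_I`, `Z_{n+1} = (I + A_n) Z_n` for `n ≥ 1`
(the index `0` is not used). -/
def march (A : ℕ → Matrix (Fin 2) (Fin 2) ℂ) (ZI : Fin 2 → ℂ) : ℕ → Fin 2 → ℂ
  | 0 => ZI
  | 1 => ZI
  | n + 2 => Matrix.mulVec (1 + A (n + 1)) (march A ZI (n + 1))

/-- First order scheme with approximate phase `φ̃ = φ̃₁ - ε² φ̃₂` and `β̃ = φ̃₂'`. -/
noncomputable def firstZ (p₁ p₂ : ℝ → ℝ) (ε : ℝ) (x : ℕ → ℝ) (UI : Fin 2 → ℂ) : ℕ → Fin 2 → ℂ :=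
  march (fun n => matA1 (approxPhase p₁ p₂ ε) (dx p₂) ε (x n) (x (n + 1))) (matP.mulVec UI)

/-- Second order scheme with approximate phase `φ̃ = φ̃₁ - ε² φ̃₂` and `β̃ = φ̃₂'`. -/
noncomputable def secondZ (p₁ p₂ : ℝ → ℝ) (ε : ℝ) (x : ℕ → ℝ) (UI : Fin 2 → ℂ) : ℕ → Fin 2 → ℂ :=
  march (fun n => matA2 (approxPhase p₁ p₂ ε) (dx p₂) ε (x n) (x (n + 1)) +
    matA3 (approxPhase p₁ p₂ ε) (dx p₂) ε (x n) (x (n + 1))) (matP.mulVec UI)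

/-- Back-transformation `Ũ_n = P⁻¹ e^{(i/ε) Φ̃(x_n)} Z̃_n`. -/
noncomputable def backU (p₁ p₂ : ℝ → ℝ) (ε : ℝ) (x : ℕ → ℝ) (Z : ℕ → Fin 2 → ℂ) (n : ℕ) :
    Fin 2 → ℂ :=
  matPinv.mulVec ((expPhase ε (approxPhase p₁ p₂ ε (x n))).mulVec (Z n))

end WKB

namespace WKB

open Set ComplexConjugate

/-! In the variable Z = e^{-iΦ/ε} P U the equation becomes z₁' = c̄ z₂, z₂' = c z₁ with c = ε β
e^{2iφ/ε} (`IsSolution.hasDeriv_amplitude`), so Z is bounded uniformly in ε. Both schemes discretise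
the same system with the pair (φ̃, β̃) in place of (φ, β).

Changing the pair. No solution of the modified system is constructed; the exact Z is corrected until
it almost solves that system. The difference of the coefficients is ε(β - β̃)e^{2iφ/ε} plus a term
of size E. The first summand oscillates and has, up to O(ε²(E' + E'')), the antiderivative q =
O(ε²E'). Then (z₁ - q̄ z₂, z₂ - q z₁) solves the modified system with a residual O(E/ε + ε²(E' +
E'')) (`exists_nearSolution`). That E' and E'' control β - β̃ and its derivative follows because φ'
- φ̃' is affine in ε² and E' bounds it for all small ε, hence at two values of ε
(`PhaseErrors.coef_bounds`).

Consistency. As functions of the right end point, the off-diagonal entries of the step matrices are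
approximate primitives of c, found by repeated integration by parts, which is where the β_k come
from. The diagonal of A³ is, up to a term of local error size, an approximate primitive of c̄ ∫c.
Two Picard iterations (`picard_step`) therefore bound the error of one step by the step length times
ε² min(ε, h) or ε³h², plus the residual.

Stability. The step matrices are bounded by a constant times the step length, so the discrete
Gronwall inequality sums the local errors. Transforming back with φ̃ in place of φ costs another
E/ε.

All constants depend on the pair only through C₃ and K. The estimate reached this way has no term ε
min(ε, E), as E ≤ E/ε absorbs it; this nonnegative term is added only at the end. -/

/-! ### Derivatives on the unit interval and jets with uniform bounds -/

theorem dx_congr {F : Type*} [NormedAddCommGroup F] [NormedSpace ℝ F] {f g : ℝ → F}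
    (h : EqOn f g (Icc 0 1)) : EqOn (dx f) (dx g) (Icc 0 1) :=
  fun _ hx => derivWithin_congr h (h hx)

theorem uniqueDiffWithinAt_unit {x : ℝ} (hx : x ∈ Icc (0 : ℝ) 1) :
    UniqueDiffWithinAt ℝ (Icc (0 : ℝ) 1) x :=
  uniqueDiffOn_Icc zero_lt_one x hx

theorem dx_eq {F : Type*} [NormedAddCommGroup F] [NormedSpace ℝ F] {f : ℝ → F} {f' : F} {x : ℝ}
    (hx : x ∈ Icc (0 : ℝ) 1) (h : HasDerivWithinAt f f' (Icc 0 1) x) : dx f x = f' :=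
  h.derivWithin (uniqueDiffWithinAt_unit hx)

theorem _root_.ContDiffOn.hasDerivWithinAt_dx {F : Type*} [NormedAddCommGroup F]
    [NormedSpace ℝ F] {f : ℝ → F} {n : WithTop ℕ∞}
    (hf : ContDiffOn ℝ n f (Icc 0 1)) (hn : n ≠ 0) {x : ℝ} (hx : x ∈ Icc (0 : ℝ) 1) :
    HasDerivWithinAt f (dx f x) (Icc 0 1) x :=
  ((hf.differentiableOn hn) x hx).hasDerivWithinAt

theorem _root_.ContDiffOn.dx {F : Type*} [NormedAddCommGroup F] [NormedSpace ℝ F] {f : ℝ → F}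
    (hf : ContDiffOn ℝ (⊤ : ℕ∞) f (Icc 0 1)) : ContDiffOn ℝ (⊤ : ℕ∞) (WKB.dx f) (Icc 0 1) :=
  hf.derivWithin (uniqueDiffOn_Icc zero_lt_one) (by simp)

theorem smooth_hasDeriv {f : ℝ → ℝ} (hf : ContDiffOn ℝ (⊤ : ℕ∞) f (Icc 0 1)) {x : ℝ}
    (hx : x ∈ Icc (0 : ℝ) 1) : HasDerivWithinAt f (dx f x) (Icc 0 1) x :=
  hf.hasDerivWithinAt_dx (by simp) hx

/-- `f` is smooth on `[0,1]` and its derivatives up to order `n` are bounded by `M` there. -/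
def BoundedJet (n : ℕ) (M : ℝ) (f : ℝ → ℝ) : Prop :=
  ContDiffOn ℝ (⊤ : ℕ∞) f (Icc 0 1) ∧ ∀ k ≤ n, ∀ x ∈ Icc (0 : ℝ) 1, |dx^[k] f x| ≤ M

namespace BoundedJet

variable {n : ℕ} {M M' : ℝ} {f g : ℝ → ℝ}

theorem smooth (h : BoundedJet n M f) : ContDiffOn ℝ (⊤ : ℕ∞) f (Icc 0 1) := h.1

theorem bound (h : BoundedJet n M f) {x : ℝ} (hx : x ∈ Icc (0 : ℝ) 1) : |f x| ≤ M :=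
  h.2 0 (Nat.zero_le _) x hx

theorem deriv (h : BoundedJet (n + 1) M f) : BoundedJet n M (dx f) :=
  ⟨h.1.dx, fun k hk x hx => by
    have := h.2 (k + 1) (by omega) x hx
    rwa [Function.iterate_succ_apply] at this⟩

theorem mono (h : BoundedJet n M f) (hM : M ≤ M') : BoundedJet n M' f :=
  ⟨h.1, fun k hk x hx => (h.2 k hk x hx).trans hM⟩

theorem of_le {m : ℕ} (h : BoundedJet n M f) (hm : m ≤ n) : BoundedJet m M f :=
  ⟨h.1, fun k hk => h.2 k (hk.trans hm)⟩

theorem zero_intro (hf : ContDiffOn ℝ (⊤ : ℕ∞) f (Icc 0 1))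
    (h : ∀ x ∈ Icc (0 : ℝ) 1, |f x| ≤ M) : BoundedJet 0 M f :=
  ⟨hf, fun k hk x hx => by
    obtain rfl : k = 0 := by omega
    exact h x hx⟩

theorem succ_intro (hf : ContDiffOn ℝ (⊤ : ℕ∞) f (Icc 0 1))
    (h : ∀ x ∈ Icc (0 : ℝ) 1, |f x| ≤ M) (h' : BoundedJet n M (dx f)) :
    BoundedJet (n + 1) M f :=
  ⟨hf, fun k hk x hx => by
    cases k with
    | zero => exact h x hx
    | succ k =>
      rw [Function.iterate_succ_apply]
      exact h'.2 k (by omega) x hx⟩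

theorem congr (h : BoundedJet n M f) (hfg : EqOn g f (Icc 0 1)) : BoundedJet n M g := by
  induction n generalizing f g with
  | zero => exact zero_intro (h.1.congr hfg) fun x hx => by rw [hfg hx]; exact h.bound hx
  | succ n ih =>
    exact succ_intro (h.1.congr hfg) (fun x hx => by rw [hfg hx]; exact h.bound hx)
      (ih h.deriv (dx_congr hfg))

/-- Used with c = ε² for the approximate phase; the bound does not involve c, which makes it uniform
in ε. The values c = ±1 also provide sums and negatives. -/
theorem sub_const_mul (hf : BoundedJet n M f) (hg : BoundedJet n M' g) {c : ℝ} (hc : |c| ≤ 1) :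
    BoundedJet n (M + M') (fun x => f x - c * g x) := by
  have key : ∀ u v : ℝ, |u| ≤ M → |v| ≤ M' → |u - c * v| ≤ M + M' := fun u v hu hv => by
    have h1 : |c * v| ≤ 1 * M' := by
      rw [abs_mul]; exact mul_le_mul hc hv (abs_nonneg _) zero_le_one
    calc |u - c * v| ≤ |u| + |c * v| := abs_sub _ _
      _ ≤ M + M' := by linarith
  induction n generalizing f g with
  | zero =>
    exact zero_intro (hf.1.sub (contDiffOn_const.mul hg.1))
      fun x hx => key _ _ (hf.bound hx) (hg.bound hx)
  | succ n ih =>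
    refine succ_intro (hf.1.sub (contDiffOn_const.mul hg.1))
      (fun x hx => key _ _ (hf.bound hx) (hg.bound hx)) ((ih hf.deriv hg.deriv).congr ?_)
    intro x hx
    exact dx_eq hx ((smooth_hasDeriv hf.1 hx).sub ((smooth_hasDeriv hg.1 hx).const_mul c))

theorem add (hf : BoundedJet n M f) (hg : BoundedJet n M' g) :
    BoundedJet n (M + M') (fun x => f x + g x) :=
  (hf.sub_const_mul hg (c := -1) (by simp)).congr fun x _ => by simp

theorem nonneg (hf : BoundedJet n M f) : 0 ≤ M :=
  (abs_nonneg _).trans (hf.bound (x := 0) (by simp))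

/-- The constant is chosen before the functions, which is what uniformity over all phase pairs
requires. -/
theorem exists_mul (n : ℕ) (M M' : ℝ) : ∃ C, ∀ f g, BoundedJet n M f → BoundedJet n M' g →
    BoundedJet n C (fun x => f x * g x) := by
  have key : ∀ u v : ℝ, 0 ≤ M → |u| ≤ M → |v| ≤ M' → |u * v| ≤ M * M' := fun u v h0 hu hv => by
    rw [abs_mul]; exact mul_le_mul hu hv (abs_nonneg _) h0
  induction n with
  | zero =>
    exact ⟨M * M', fun f g hf hg => zero_intro (hf.1.mul hg.1)
      fun x hx => key _ _ hf.nonneg (hf.bound hx) (hg.bound hx)⟩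
  | succ n ih =>
    obtain ⟨C, hC⟩ := ih
    refine ⟨max (M * M') (C + C), fun f g hf hg => succ_intro (hf.1.mul hg.1)
      (fun x hx => (key _ _ hf.nonneg (hf.bound hx) (hg.bound hx)).trans (le_max_left _ _)) ?_⟩
    refine (((hC _ _ hf.deriv (hg.of_le (Nat.le_succ n))).add
      (hC _ _ (hf.of_le (Nat.le_succ n)) hg.deriv)).congr ?_).mono (le_max_right _ _)
    intro x hx
    exact dx_eq hx ((smooth_hasDeriv hf.1 hx).mul (smooth_hasDeriv hg.1 hx))

theorem exists_inv (n : ℕ) (M : ℝ) {c : ℝ} (hc : 0 < c) : ∃ C, ∀ f, BoundedJet n M f →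
    (∀ x ∈ Icc (0 : ℝ) 1, c ≤ f x) → BoundedJet n C (fun x => (f x)⁻¹) := by
  have key : ∀ u : ℝ, c ≤ u → |u⁻¹| ≤ c⁻¹ := fun u hu => by
    rw [abs_of_pos (inv_pos.2 (hc.trans_le hu))]
    exact inv_anti₀ hc hu
  induction n with
  | zero =>
    exact ⟨c⁻¹, fun f hf h => zero_intro (hf.1.inv fun x hx => (hc.trans_le (h x hx)).ne')
      fun x hx => key _ (h x hx)⟩
  | succ n ih =>
    obtain ⟨C, hC⟩ := ih
    obtain ⟨C', hC'⟩ := exists_mul n C C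
    obtain ⟨C'', hC''⟩ := exists_mul n M C'
    refine ⟨max c⁻¹ (C'' + (C'' + C'')), fun f hf h => succ_intro
      (hf.1.inv fun x hx => (hc.trans_le (h x hx)).ne')
      (fun x hx => (key _ (h x hx)).trans (le_max_left _ _)) ?_⟩
    have hi := hC f (hf.of_le (Nat.le_succ n)) h
    have hd := hC'' _ _ hf.deriv (hC' _ _ hi hi)
    -- The derivative -f' f⁻² is written as u - (u + u) with u = f' f⁻².
    refine ((hd.sub_const_mul (hd.add hd) (c := 1) (by simp)).congr ?_).mono (le_max_right _ _)
    intro x hx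
    have hne := (hc.trans_le (h x hx)).ne'
    refine (dx_eq hx ((smooth_hasDeriv hf.1 hx).inv hne)).trans ?_
    field_simp
    ring

end BoundedJet

/-! ### Uniform regularity of the phase and of the functions β_k -/

/-- The regularity of a phase `p` and a coefficient `b` on `[0,1]` that the schemes need, with a
common bound `B` for all functions involved. -/
structure StepData (p b : ℝ → ℝ) (B : ℝ) : Prop where
  one_le : 1 ≤ B
  hp : ∀ x ∈ Icc (0 : ℝ) 1, HasDerivWithinAt p (dx p x) (Icc 0 1) x
  p_ne : ∀ x ∈ Icc (0 : ℝ) 1, dx p x ≠ 0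
  p_bd : ∀ x ∈ Icc (0 : ℝ) 1, |dx p x| ≤ B
  b_bd : ∀ x ∈ Icc (0 : ℝ) 1, |b x| ≤ B
  hβ : ∀ k ≤ 3, ∀ x ∈ Icc (0 : ℝ) 1,
    HasDerivWithinAt (betaK p b k) (dx (betaK p b k) x) (Icc 0 1) x
  β_bd : ∀ k ≤ 3, ∀ x ∈ Icc (0 : ℝ) 1, |betaK p b k x| ≤ B
  dβ_bd : ∀ k ≤ 3, ∀ x ∈ Icc (0 : ℝ) 1, |dx (betaK p b k) x| ≤ B
  hF : ∀ x ∈ Icc (0 : ℝ) 1, HasDerivWithinAt (fun y => b y * betaK p b 0 y)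
    (dx (fun y => b y * betaK p b 0 y) x) (Icc 0 1) x
  hF' : ∀ x ∈ Icc (0 : ℝ) 1, HasDerivWithinAt (dx fun y => b y * betaK p b 0 y)
    (dx (dx fun y => b y * betaK p b 0 y) x) (Icc 0 1) x
  F_bd : ∀ x ∈ Icc (0 : ℝ) 1, |dx (dx fun y => b y * betaK p b 0 y) x| ≤ B

theorem StepData.b_eq {p b : ℝ → ℝ} {B : ℝ} (H : StepData p b B) {x : ℝ}
    (hx : x ∈ Icc (0 : ℝ) 1) : b x = 2 * dx p x * betaK p b 0 x := by
  have := H.p_ne x hx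
  simp only [betaK]
  field_simp

theorem StepData.dβ_eq {p b : ℝ → ℝ} {B : ℝ} (H : StepData p b B) (k : ℕ) {x : ℝ}
    (hx : x ∈ Icc (0 : ℝ) 1) : dx (betaK p b k) x = 2 * dx p x * betaK p b (k + 1) x := by
  have := H.p_ne x hx
  simp only [betaK]
  field_simp

/-- Each β_k costs one derivative. The second order scheme needs β₃ and its derivative, hence four
derivatives of p' and b; this is why five derivatives of φ̃₁ and φ̃₂ are bounded. -/
theorem exists_betaK_jet (M c : ℝ) (hc : 0 < c) : ∀ k ≤ 4, ∃ C, ∀ p b : ℝ → ℝ,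
    BoundedJet 4 M (dx p) → BoundedJet 4 M b → (∀ x ∈ Icc (0 : ℝ) 1, c ≤ dx p x) →
    BoundedJet (4 - k) C (betaK p b k) := by
  intro k
  induction k with
  | zero =>
    intro _
    obtain ⟨C₁, h₁⟩ := BoundedJet.exists_inv 4 (M + M) (c := 2 * c) (by positivity)
    obtain ⟨C₂, h₂⟩ := BoundedJet.exists_mul 4 M C₁
    refine ⟨C₂, fun p b hp hb hl => (h₂ _ _ hb (h₁ _ (hp.add hp) fun x hx => ?_)).congr ?_⟩
    · linarith [hl x hx]
    · intro x hx
      simp only [betaK]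
      rw [div_eq_mul_inv, two_mul]
  | succ k ih =>
    intro hk
    obtain ⟨C, hC⟩ := ih (by omega)
    obtain ⟨C₁, h₁⟩ := BoundedJet.exists_inv (4 - (k + 1)) (M + M) (c := 2 * c) (by positivity)
    obtain ⟨C₂, h₂⟩ := BoundedJet.exists_mul (4 - (k + 1)) C₁ C
    refine ⟨C₂, fun p b hp hb hl => ?_⟩
    have h3 := hC p b hp hb hl
    rw [show 4 - k = 4 - (k + 1) + 1 by omega] at h3
    have hp' := hp.of_le (m := 4 - (k + 1)) (by omega)
    refine (h₂ _ _ (h₁ _ (hp'.add hp') fun x hx => ?_) h3.deriv).congr ?_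
    · linarith [hl x hx]
    · intro x hx
      simp only [betaK]
      rw [one_div, two_mul]

theorem exists_stepData (M c : ℝ) (hc : 0 < c) : ∃ B, ∀ p b : ℝ → ℝ,
    ContDiffOn ℝ (⊤ : ℕ∞) p (Icc 0 1) →
    BoundedJet 4 M (dx p) → BoundedJet 4 M b → (∀ x ∈ Icc (0 : ℝ) 1, c ≤ dx p x) →
    StepData p b B := by
  have h := exists_betaK_jet M c hc
  choose C hC using h
  obtain ⟨C', hC'⟩ := BoundedJet.exists_mul 4 M (C 0 (by norm_num))
  let B : ℝ := 1 + |M| + |C 0 (by norm_num)| + |C 1 (by norm_num)| + |C 2 (by norm_num)| +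
    |C 3 (by norm_num)| + |C'|
  have e1 := abs_nonneg M
  have e2 := abs_nonneg (C 0 (by norm_num))
  have e3 := abs_nonneg (C 1 (by norm_num))
  have e4 := abs_nonneg (C 2 (by norm_num))
  have e5 := abs_nonneg (C 3 (by norm_num))
  have e6 := abs_nonneg C'
  have l1 := le_abs_self M
  have l2 := le_abs_self (C 0 (by norm_num))
  have l3 := le_abs_self (C 1 (by norm_num))
  have l4 := le_abs_self (C 2 (by norm_num))
  have l5 := le_abs_self (C 3 (by norm_num))
  have l6 := le_abs_self C'
  refine ⟨B, fun p b hp hp' hb hl => ?_⟩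
  have hβ : ∀ k ≤ 3, BoundedJet 1 B (betaK p b k) := by
    intro k hk
    interval_cases k
    · exact ((hC 0 (by norm_num) p b hp' hb hl).of_le (by norm_num)).mono (by simp only [B]; linarith)
    · exact ((hC 1 (by norm_num) p b hp' hb hl).of_le (by norm_num)).mono (by simp only [B]; linarith)
    · exact ((hC 2 (by norm_num) p b hp' hb hl).of_le (by norm_num)).mono (by simp only [B]; linarith)
    · exact ((hC 3 (by norm_num) p b hp' hb hl).of_le (by norm_num)).mono (by simp only [B]; linarith)
  have hF := (hC' _ _ hb (hC 0 (by norm_num) p b hp' hb hl)).mono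
    (show C' ≤ B by simp only [B]; linarith)
  exact
    { one_le := by simp only [B]; linarith
      hp := fun x hx => smooth_hasDeriv hp hx
      p_ne := fun x hx => (hc.trans_le (hl x hx)).ne'
      p_bd := fun x hx => (hp'.bound hx).trans (by simp only [B]; linarith)
      b_bd := fun x hx => (hb.bound hx).trans (by simp only [B]; linarith)
      hβ := fun k hk x hx => smooth_hasDeriv (hβ k hk).smooth hx
      β_bd := fun k hk x hx => (hβ k hk).bound hx
      dβ_bd := fun k hk x hx => (hβ k hk).deriv.bound hx
      hF := fun x hx => smooth_hasDeriv hF.smooth hx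
      hF' := fun x hx => smooth_hasDeriv hF.deriv.smooth hx
      F_bd := fun x hx => hF.deriv.deriv.bound hx }

theorem HypothesisB.jets {p₁ p₂ : ℝ → ℝ} {C₂ K : ℝ} (h : HypothesisB p₁ p₂ C₂)
    (hK : DerivBound p₁ p₂ K) : BoundedJet 4 K (dx p₁) ∧ BoundedJet 4 K (dx p₂) := by
  refine ⟨⟨h.smooth₁.dx, fun k hk x hx => ?_⟩, ⟨h.smooth₂.dx, fun k hk x hx => ?_⟩⟩
  · have := (hK (k + 1) (by constructor <;> omega) x hx).1
    rwa [iteratedDerivWithin_eq_iterate, Function.iterate_succ_apply] at this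
  · have := (hK (k + 1) (by constructor <;> omega) x hx).2
    rwa [iteratedDerivWithin_eq_iterate, Function.iterate_succ_apply] at this

theorem HypothesisB.approxPhase_smooth {p₁ p₂ : ℝ → ℝ} {C₂ : ℝ} (h : HypothesisB p₁ p₂ C₂)
    (ε : ℝ) : ContDiffOn ℝ (⊤ : ℕ∞) (approxPhase p₁ p₂ ε) (Icc 0 1) :=
  h.smooth₁.sub (contDiffOn_const.mul h.smooth₂)

theorem HypothesisB.dx_approxPhase {p₁ p₂ : ℝ → ℝ} {C₂ : ℝ} (h : HypothesisB p₁ p₂ C₂)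
    (ε : ℝ) : EqOn (dx (approxPhase p₁ p₂ ε)) (fun x => dx p₁ x - ε ^ 2 * dx p₂ x) (Icc 0 1) :=
  fun _ hx => dx_eq hx
    ((smooth_hasDeriv h.smooth₁ hx).sub ((smooth_hasDeriv h.smooth₂ hx).const_mul _))

theorem HypothesisB.dx_dx_approxPhase {p₁ p₂ : ℝ → ℝ} {C₂ : ℝ} (h : HypothesisB p₁ p₂ C₂)
    (ε : ℝ) : EqOn (dx (dx (approxPhase p₁ p₂ ε)))
      (fun x => dx (dx p₁) x - ε ^ 2 * dx (dx p₂) x) (Icc 0 1) := by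
  intro x hx
  rw [dx_congr (h.dx_approxPhase ε) hx]
  exact dx_eq hx
    ((smooth_hasDeriv h.smooth₁.dx hx).sub ((smooth_hasDeriv h.smooth₂.dx hx).const_mul _))

theorem exists_uniform_stepData (C₂ K C₃ ε' : ℝ) (hε' : ε' ≤ 1) (hC₃ : 0 < C₃) :
    ∃ B, ∀ p₁ p₂ : ℝ → ℝ, HypothesisB p₁ p₂ C₂ → DerivBound p₁ p₂ K →
      PhaseDerivLower p₁ p₂ ε' C₃ → ∀ ε ∈ Ioc 0 ε', StepData (approxPhase p₁ p₂ ε) (dx p₂) B := by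
  obtain ⟨B, hB⟩ := exists_stepData (K + K) C₃ hC₃
  refine ⟨B, fun p₁ p₂ h hK hl ε hε => ?_⟩
  obtain ⟨j₁, j₂⟩ := h.jets hK
  refine hB _ _ (h.approxPhase_smooth ε) ?_ (j₂.mono (by linarith [j₂.nonneg])) (hl ε hε)
  refine (j₁.sub_const_mul j₂ ?_).congr (h.dx_approxPhase ε)
  have h1 : ε ≤ 1 := hε.2.trans hε'
  rw [abs_of_nonneg (by positivity)]
  exact pow_le_one₀ hε.1.le h1

theorem exists_phaseDerivLower (C₂ K ε₀ : ℝ) (hC₂ : 0 < C₂) (hε₀ : 0 < ε₀) (hε₁ : ε₀ < 1) :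
    ∃ ε' ∈ Ioc 0 ε₀, ∃ C₃ > 0, ∀ p₁ p₂ : ℝ → ℝ,
      HypothesisB p₁ p₂ C₂ → DerivBound p₁ p₂ K → PhaseDerivLower p₁ p₂ ε' C₃ := by
  have hK1 : 0 < 2 * (|K| + 1) := by positivity
  -- With this bound on ε ≤ 1 the perturbation satisfies ε² φ̃₂' ≤ ε(|K| + 1) ≤ C₂/2, which leaves
  -- half of C₂.
  refine ⟨min ε₀ (C₂ / (2 * (|K| + 1))), ⟨lt_min hε₀ (by positivity), min_le_left _ _⟩, C₂ / 2,
    by positivity, fun p₁ p₂ h hK ε hε x hx => ?_⟩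
  rw [h.dx_approxPhase ε hx]
  have h1 : ε ≤ 1 := (hε.2.trans (min_le_left _ _)).trans hε₁.le
  have h2 : ε * (2 * (|K| + 1)) ≤ C₂ := (le_div_iff₀ hK1).1 (hε.2.trans (min_le_right _ _))
  have h3 := h.lower x hx
  have h4 : dx p₂ x ≤ |K| := ((le_abs_self _).trans ((h.jets hK).2.bound hx)).trans (le_abs_self K)
  have h5 : ε ^ 2 * dx p₂ x ≤ ε * (|K| + 1) := by
    have h0 := hε.1
    calc ε ^ 2 * dx p₂ x ≤ ε ^ 2 * (|K| + 1) := by gcongr; linarith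
      _ ≤ ε * (|K| + 1) := by
        gcongr
        nlinarith
  simp only
  linarith

/-! ### Oscillatory exponentials and their Taylor remainders -/

theorem norm_exp_I_mul (x : ℝ) : ‖Complex.exp (Complex.I * x)‖ = 1 := by
  rw [mul_comm]; exact Complex.norm_exp_ofReal_mul_I x

theorem norm_osc (ε s : ℝ) : ‖osc ε s‖ = 1 := norm_exp_I_mul _

theorem conj_exp_I_mul (x : ℝ) :
    conj (Complex.exp (Complex.I * x)) = Complex.exp (Complex.I * (-x : ℝ)) := by
  rw [← Complex.exp_conj]; simp

theorem conj_osc (ε s : ℝ) : conj (osc ε s) = osc ε (-s) := by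
  rw [osc, conj_exp_I_mul, osc]; congr 2; push_cast; ring

theorem conj_H₁ (x : ℝ) : conj (H₁ x) = H₁ (-x) := by
  rw [H₁, H₁, map_sub, conj_exp_I_mul, map_one]

theorem conj_H₂ (x : ℝ) : conj (H₂ x) = H₂ (-x) := by
  rw [H₂, H₂, map_sub, map_sub, conj_exp_I_mul, map_one]; simp

theorem osc_mul_conj (ε s : ℝ) : osc ε s * conj (osc ε s) = 1 := by
  rw [Complex.mul_conj, Complex.normSq_eq_norm_sq, norm_osc]; simp

theorem osc_mul_exp (ε s t : ℝ) :
    osc ε s * Complex.exp (Complex.I * (2 / ε * (t - s) : ℝ)) = osc ε t := by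
  rw [osc, osc, ← Complex.exp_add]; congr 1; push_cast; ring

theorem osc_mul_H₁ (ε s t : ℝ) : osc ε s * H₁ (2 / ε * (t - s)) = osc ε t - osc ε s := by
  rw [H₁, mul_sub, osc_mul_exp, mul_one]

theorem osc_mul_H₂ (ε s t : ℝ) : osc ε s * H₂ (2 / ε * (t - s)) =
    osc ε t - osc ε s - Complex.I * (2 / ε * (t - s) : ℝ) * osc ε s := by
  rw [H₂, mul_sub, mul_sub, osc_mul_exp, mul_one]; ring

theorem hasDerivAt_exp_I (x : ℝ) : HasDerivAt (fun y : ℝ => Complex.exp (Complex.I * y))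
    (Complex.I * Complex.exp (Complex.I * x)) x := by
  have h : HasDerivAt (fun y : ℝ => Complex.I * (y : ℂ)) (Complex.I * 1) x :=
    (Complex.ofRealCLM.hasDerivAt (x := x)).const_mul Complex.I
  convert h.cexp using 1
  ring

theorem norm_H₁_le (x : ℝ) : ‖H₁ x‖ ≤ |x| := by
  have := Convex.norm_image_sub_le_of_norm_hasDerivWithin_le (s := univ) (C := 1) (x := (0 : ℝ))
    (y := x) (fun y _ => (hasDerivAt_exp_I y).hasDerivWithinAt)
    (fun y _ => by rw [norm_mul, norm_exp_I_mul]; simp) convex_univ trivial trivial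
  simpa [H₁] using this

theorem norm_H₁_le_two (x : ℝ) : ‖H₁ x‖ ≤ 2 := by
  refine (norm_sub_le _ _).trans ?_
  rw [norm_exp_I_mul]; norm_num

theorem norm_H₂_le_two_mul (x : ℝ) : ‖H₂ x‖ ≤ 2 * |x| := by
  refine (norm_sub_le _ _).trans ?_
  have := norm_H₁_le x
  rw [H₁] at this
  simp only [norm_mul, Complex.norm_I, Complex.norm_real, Real.norm_eq_abs]
  linarith

theorem norm_H₂_le (x : ℝ) : ‖H₂ x‖ ≤ x ^ 2 := by
  have hd : ∀ y : ℝ, HasDerivAt H₂ (Complex.I * H₁ y) y := fun y => by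
    have h : HasDerivAt (fun y : ℝ => Complex.I * (y : ℂ)) (Complex.I * 1) y :=
      (Complex.ofRealCLM.hasDerivAt (x := y)).const_mul Complex.I
    refine (((hasDerivAt_exp_I y).sub_const 1).sub h).congr_deriv ?_
    simp only [H₁]; ring
  have := Convex.norm_image_sub_le_of_norm_hasDerivWithin_le (s := uIcc 0 x) (C := |x|)
    (x := (0 : ℝ)) (y := x) (fun y _ => (hd y).hasDerivWithinAt)
    (fun y hy => by
      rw [norm_mul, Complex.norm_I, one_mul]
      refine (norm_H₁_le y).trans ?_
      have := abs_sub_left_of_mem_uIcc hy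
      simpa using this)
    (convex_uIcc _ _) left_mem_uIcc right_mem_uIcc
  have h0 : H₂ 0 = 0 := by simp [H₂]
  rw [h0, sub_zero, sub_zero, Real.norm_eq_abs] at this
  rwa [← sq_abs, sq]

theorem hasDerivWithinAt_osc {p : ℝ → ℝ} {p' ε x : ℝ} {s : Set ℝ}
    (hp : HasDerivWithinAt p p' s x) : HasDerivWithinAt (fun y => osc ε (p y))
      (2 * Complex.I * p' / ε * osc ε (p x)) s x := by
  have h : HasDerivWithinAt (fun y => 2 / ε * p y) (2 / ε * p') s x := hp.const_mul _
  refine ((hasDerivAt_exp_I (2 / ε * p x)).scomp_hasDerivWithinAt x h).congr_deriv ?_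
  rw [Complex.real_smul, osc]
  push_cast
  ring

/-! ### Entries of the step matrices -/

/-- The off-diagonal coefficient `ε b e^{2ip/ε}` of the transformed equation. -/
noncomputable def coef (p b : ℝ → ℝ) (ε x : ℝ) : ℂ := ((ε * b x : ℝ) : ℂ) * osc ε (p x)

theorem norm_coef (p b : ℝ → ℝ) {ε : ℝ} (hε : 0 < ε) (x : ℝ) : ‖coef p b ε x‖ = ε * |b x| := by
  rw [coef, norm_mul, norm_osc, Complex.norm_real, Real.norm_eq_abs, abs_mul, abs_of_pos hε,
    mul_one]

/-- The part of the diagonal of `matA3` that is not of the size of the local error. -/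
noncomputable def diagMain (p b : ℝ → ℝ) (ε s t : ℝ) : ℂ :=
  -(Complex.I * (ε : ℂ) ^ 3 *
        (((t - s) * ((b t * betaK p b 0 t + b s * betaK p b 0 s) / 2) : ℝ) : ℂ))
    - (ε : ℂ) ^ 4 * ((betaK p b 0 s * betaK p b 0 t : ℝ) : ℂ) * H₁ (-(2 / ε) * (p t - p s))

theorem matA1_10 (p b : ℝ → ℝ) (ε s t : ℝ) : matA1 p b ε s t 1 0 =
    (ε : ℂ) ^ 3 * betaK p b 1 t * (osc ε (p t) - osc ε (p s)) -
      Complex.I * (ε : ℂ) ^ 2 *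
        (betaK p b 0 t * osc ε (p t) - betaK p b 0 s * osc ε (p s)) := by
  simp [matA1, osc_mul_H₁]

theorem matA2_10 (p b : ℝ → ℝ) (ε s t : ℝ) : matA2 p b ε s t 1 0 =
    -(Complex.I * (ε : ℂ) ^ 2 *
        (betaK p b 0 t * osc ε (p t) - betaK p b 0 s * osc ε (p s))) +
    (ε : ℂ) ^ 3 * (betaK p b 1 t * osc ε (p t) - betaK p b 1 s * osc ε (p s)) +
    Complex.I * (ε : ℂ) ^ 4 * betaK p b 2 t * (osc ε (p t) - osc ε (p s)) -
    (ε : ℂ) ^ 5 * betaK p b 3 t * (osc ε (p t) - osc ε (p s) -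
      Complex.I * (2 / ε * (p t - p s) : ℝ) * osc ε (p s)) := by
  rw [← osc_mul_H₂]
  simp [matA2, osc_mul_H₁]

theorem neg_two_div_mul (ε u : ℝ) : -(2 / ε) * u = -(2 / ε * u) := by ring

/-- The step matrices inherit the conjugation symmetry of the system, so only the entries (1,0) and
(0,0) have to be estimated. -/
theorem matA1_01 (p b : ℝ → ℝ) (ε s t : ℝ) :
    matA1 p b ε s t 0 1 = conj (matA1 p b ε s t 1 0) := by
  simp only [matA1, neg_two_div_mul, ← conj_osc, ← conj_H₁]
  simp
  ring

theorem matA2_01 (p b : ℝ → ℝ) (ε s t : ℝ) :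
    matA2 p b ε s t 0 1 = conj (matA2 p b ε s t 1 0) := by
  simp only [matA2, neg_two_div_mul, ← conj_osc, ← conj_H₁, ← conj_H₂]
  simp
  ring

theorem matA3_00 (p b : ℝ → ℝ) (ε s t : ℝ) : matA3 p b ε s t 0 0 = diagMain p b ε s t +
    Complex.I * (ε : ℂ) ^ 5 *
      ((betaK p b 1 t * (betaK p b 0 s - betaK p b 0 t) : ℝ) : ℂ) *
        H₂ (-(2 / ε) * (p t - p s)) := by
  simp [matA3, diagMain]

theorem matA3_11 (p b : ℝ → ℝ) (ε s t : ℝ) :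
    matA3 p b ε s t 1 1 = conj (matA3 p b ε s t 0 0) := by
  simp only [matA3, neg_two_div_mul, ← conj_H₁, ← conj_H₂]
  simp [Complex.conj_ofNat]

theorem matA1_diag (p b : ℝ → ℝ) (ε s t : ℝ) :
    matA1 p b ε s t 0 0 = 0 ∧ matA1 p b ε s t 1 1 = 0 := by
  simp [matA1]

theorem matA2_diag (p b : ℝ → ℝ) (ε s t : ℝ) :
    matA2 p b ε s t 0 0 = 0 ∧ matA2 p b ε s t 1 1 = 0 := by
  simp [matA2]

theorem matA3_offDiag (p b : ℝ → ℝ) (ε s t : ℝ) :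
    matA3 p b ε s t 0 1 = 0 ∧ matA3 p b ε s t 1 0 = 0 := by
  simp [matA3]

/-! ### Mean value inequalities and one perturbed Picard step -/

/-- Mean value inequality on an interval, with the derivative given pointwise. -/
theorem norm_sub_le_of_exists_deriv {f : ℝ → ℂ} {s t C : ℝ}
    (hf : ∀ τ ∈ Icc s t, ∃ f', HasDerivWithinAt f f' (Icc s t) τ ∧ ‖f'‖ ≤ C)
    {τ : ℝ} (hτ : τ ∈ Icc s t) : ‖f τ - f s‖ ≤ C * (τ - s) := by
  choose! f' h using hf
  have := Convex.norm_image_sub_le_of_norm_hasDerivWithin_le (fun x hx => (h x hx).1)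
    (fun x hx => (h x hx).2) (convex_Icc s t) ⟨le_rfl, hτ.1.trans hτ.2⟩ hτ
  rwa [Real.norm_eq_abs, abs_of_nonneg (sub_nonneg.2 hτ.1)] at this

theorem abs_sub_le_of_deriv {f : ℝ → ℝ} {f' : ℝ → ℝ} {s t C : ℝ}
    (hs : 0 ≤ s) (ht : t ≤ 1) (hst : s ≤ t)
    (hf : ∀ x ∈ Icc (0 : ℝ) 1, HasDerivWithinAt f (f' x) (Icc 0 1) x)
    (hC : ∀ x ∈ Icc s t, |f' x| ≤ C) : |f t - f s| ≤ C * (t - s) := by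
  have hsub : Icc s t ⊆ Icc 0 1 := Icc_subset_Icc hs ht
  have := Convex.norm_image_sub_le_of_norm_hasDerivWithin_le
    (fun x hx => (hf x (hsub hx)).mono hsub) hC (convex_Icc s t) ⟨le_rfl, hst⟩ ⟨hst, le_rfl⟩
  rwa [Real.norm_eq_abs, Real.norm_eq_abs, abs_of_nonneg (sub_nonneg.2 hst)] at this

/-- One step of a perturbed linear system `w₁' = f w₂ + r₁`, `w₂' = k w₁ + r₂`: approximate
primitives `S` of `k`, `T` of `f` and `D` of `f S` reproduce `w₁ t` up to third order. -/
theorem picard_step {f k S T D w₁ w₂ r₁ r₂ : ℝ → ℂ} {s t γ η ρ W : ℝ} (hst : s ≤ t)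
    (h1 : t - s ≤ 1) (hγ : 0 ≤ γ) (hη : 0 ≤ η) (hρ : 0 ≤ ρ) (hW : 0 ≤ W)
    (hS0 : S s = 0) (hT0 : T s = 0) (hD0 : D s = 0)
    (hw₁ : ∀ τ ∈ Icc s t, HasDerivWithinAt w₁ (f τ * w₂ τ + r₁ τ) (Icc s t) τ)
    (hw₂ : ∀ τ ∈ Icc s t, HasDerivWithinAt w₂ (k τ * w₁ τ + r₂ τ) (Icc s t) τ)
    (hf : ∀ τ ∈ Icc s t, ‖f τ‖ ≤ γ) (hk : ∀ τ ∈ Icc s t, ‖k τ‖ ≤ γ)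
    (hr₁ : ∀ τ ∈ Icc s t, ‖r₁ τ‖ ≤ ρ) (hr₂ : ∀ τ ∈ Icc s t, ‖r₂ τ‖ ≤ ρ)
    (hW₁ : ∀ τ ∈ Icc s t, ‖w₁ τ‖ ≤ W) (hW₂ : ∀ τ ∈ Icc s t, ‖w₂ τ‖ ≤ W)
    (hS : ∀ τ ∈ Icc s t, ∃ d, HasDerivWithinAt S d (Icc s t) τ ∧ ‖k τ - d‖ ≤ η)
    (hT : ∀ τ ∈ Icc s t, ∃ d, HasDerivWithinAt T d (Icc s t) τ ∧ ‖f τ - d‖ ≤ η)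
    (hD : ∀ τ ∈ Icc s t, ∃ d, HasDerivWithinAt D d (Icc s t) τ ∧ ‖f τ * S τ - d‖ ≤ η) :
    ‖w₁ t - (w₁ s + (D t * w₁ s + T t * w₂ s))‖ ≤
      ((γ ^ 3 * (t - s) ^ 2 + (γ + 2) * η) * W + (1 + γ + γ ^ 2) * ρ) * (t - s) := by
  have hs : s ∈ Icc s t := ⟨le_rfl, hst⟩
  have hh : 0 ≤ t - s := sub_nonneg.2 hst
  set h := t - s with hdef
  have mono : ∀ τ ∈ Icc s t, τ - s ≤ h := fun τ hτ => by linarith [hτ.2]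
  -- Three nested mean value estimates: w₁ is constant to first order; hence w₂ is w₂(s) + S w₁(s)
  -- to second order; inserting this in the equation of w₁ gives the third. Since S, T and D vanish
  -- at s, only the defects of their derivatives enter.
  have a₁ : ∀ τ ∈ Icc s t, ‖w₁ τ - w₁ s‖ ≤ (γ * W + ρ) * h := fun τ hτ => by
    refine (norm_sub_le_of_exists_deriv (C := γ * W + ρ) (fun x hx => ⟨_, hw₁ x hx, ?_⟩) hτ).trans ?_
    · refine (norm_add_le _ _).trans (add_le_add ?_ (hr₁ x hx))
      rw [norm_mul]
      exact mul_le_mul (hf x hx) (hW₂ x hx) (norm_nonneg _) hγ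
    · exact mul_le_mul_of_nonneg_left (mono τ hτ) (by positivity)
  set Q := γ * ((γ * W + ρ) * h) + η * W + ρ with hQ
  have hQ0 : 0 ≤ Q := by positivity
  have a₂ : ∀ τ ∈ Icc s t, ‖w₂ τ - w₂ s - S τ * w₁ s‖ ≤ Q * h := fun τ hτ => by
    have := norm_sub_le_of_exists_deriv (f := fun τ => w₂ τ - S τ * w₁ s) (C := Q)
      (fun x hx => ?_) hτ
    · simp only [hS0, zero_mul, sub_zero] at this
      rw [sub_right_comm]
      exact this.trans (mul_le_mul_of_nonneg_left (mono τ hτ) hQ0)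
    · obtain ⟨d, hd, hd'⟩ := hS x hx
      refine ⟨_, (hw₂ x hx).sub (hd.mul_const (w₁ s)), ?_⟩
      have : k x * w₁ x + r₂ x - d * w₁ s = k x * (w₁ x - w₁ s) + (k x - d) * w₁ s + r₂ x := by
        ring
      rw [this]
      refine (norm_add₃_le).trans (add_le_add (add_le_add ?_ ?_) (hr₂ x hx))
      · rw [norm_mul]
        exact mul_le_mul (hk x hx) (a₁ x hx) (norm_nonneg _) hγ
      · rw [norm_mul]
        exact mul_le_mul hd' (hW₁ s hs) (norm_nonneg _) hη
  have a₃ := norm_sub_le_of_exists_deriv (f := fun τ => w₁ τ - (D τ * w₁ s + T τ * w₂ s))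
    (C := γ * (Q * h) + η * W + η * W + ρ) (fun x hx => ?_) (τ := t) ⟨hst, le_rfl⟩
  · simp only [hD0, hT0, zero_mul, add_zero, sub_zero] at a₃
    have e : w₁ t - (D t * w₁ s + T t * w₂ s) - w₁ s =
      w₁ t - (w₁ s + (D t * w₁ s + T t * w₂ s)) := by ring
    rw [e] at a₃
    refine a₃.trans (mul_le_mul_of_nonneg_right ?_ hh)
    -- Powers of h ≤ 1 are discarded in the terms with η or ρ; only the term γ³h² has to keep them.
    have b1 : γ * ρ * h ≤ γ * ρ := mul_le_of_le_one_right (by positivity) h1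
    have b2 : γ * η * W * h ≤ γ * η * W := mul_le_of_le_one_right (by positivity) h1
    have b3 : γ ^ 2 * ρ * h ^ 2 ≤ γ ^ 2 * ρ :=
      mul_le_of_le_one_right (by positivity) (pow_le_one₀ hh h1)
    rw [hQ]
    linarith
  · obtain ⟨d, hd, hd'⟩ := hD x hx
    obtain ⟨d₂, hd₂, hd₂'⟩ := hT x hx
    refine ⟨_, (hw₁ x hx).sub ((hd.mul_const (w₁ s)).add (hd₂.mul_const (w₂ s))), ?_⟩
    have : f x * w₂ x + r₁ x - (d * w₁ s + d₂ * w₂ s) = f x * (w₂ x - w₂ s - S x * w₁ s) +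
        (f x * S x - d) * w₁ s + (f x - d₂) * w₂ s + r₁ x := by
      ring
    rw [this]
    refine (norm_add_le _ _).trans (add_le_add ((norm_add₃_le).trans
      (add_le_add (add_le_add ?_ ?_) ?_)) (hr₁ x hx))
    · rw [norm_mul]
      exact mul_le_mul (hf x hx) (a₂ x hx) (norm_nonneg _) hγ
    · rw [norm_mul]
      exact mul_le_mul hd' (hW₁ s hs) (norm_nonneg _) hη
    · rw [norm_mul]
      exact mul_le_mul hd₂' (hW₂ s hs) (norm_nonneg _) hη

/-! ### Matrix entries as approximate primitives of the coefficient -/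

namespace StepData

variable {p b : ℝ → ℝ} {B ε s x : ℝ}

/-- Integration by parts read backwards. Differentiating the exponential in the ε² term gives the
coefficient; the term with β₀' = 2p'β₁ cancels against the derivative of the exponential in the ε³
term, and only β₁' is left, multiplied by a difference of exponentials that is small for short
steps. -/
theorem hasDeriv_matA1 (H : StepData p b B) (hε : 0 < ε) (s : ℝ) (hx : x ∈ Icc (0 : ℝ) 1) :
    HasDerivWithinAt (fun t => matA1 p b ε s t 1 0)
      (coef p b ε x + (ε : ℂ) ^ 3 * dx (betaK p b 1) x * (osc ε (p x) - osc ε (p s)))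
      (Icc 0 1) x := by
  have he := hasDerivWithinAt_osc (ε := ε) (H.hp x hx)
  have h0 := (H.hβ 0 (by norm_num) x hx).ofReal_comp
  have h1 := (H.hβ 1 (by norm_num) x hx).ofReal_comp
  have hc : (ε : ℂ) * (2 * Complex.I * (dx p x : ℝ) / ε) = 2 * Complex.I * (dx p x : ℝ) := by
    have : (ε : ℂ) ≠ 0 := by exact_mod_cast hε.ne'
    field_simp
  have hI := Complex.I_sq
  simp_rw [matA1_10]
  refine (((h1.const_mul ((ε : ℂ) ^ 3)).mul (he.sub_const (osc ε (p s)))).sub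
    (((h0.mul he).sub_const (betaK p b 0 s * osc ε (p s))).const_mul
      (Complex.I * (ε : ℂ) ^ 2))).congr_deriv ?_
  rw [coef, H.b_eq hx, H.dβ_eq 0 hx]
  push_cast
  generalize 2 * Complex.I * ((dx p x : ℝ) : ℂ) / ε = c at *
  linear_combination ((ε : ℂ) ^ 2 * betaK p b 1 x * osc ε (p x) -
    Complex.I * ε * betaK p b 0 x * osc ε (p x)) * hc -
    2 * ε * (dx p x : ℝ) * betaK p b 0 x * osc ε (p x) * hI

/-- The same cancellation, carried on to β₃. Since H₂' = i H₁, the H₂ term cancels the β₂'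
contribution, and the remaining defect contains H₂, which is quadratically small in (x - s)/ε. -/
theorem hasDeriv_matA2 (H : StepData p b B) (hε : 0 < ε) (s : ℝ) (hx : x ∈ Icc (0 : ℝ) 1) :
    HasDerivWithinAt (fun t => matA2 p b ε s t 1 0)
      (coef p b ε x - (ε : ℂ) ^ 5 * dx (betaK p b 3) x *
        (osc ε (p s) * H₂ (2 / ε * (p x - p s)))) (Icc 0 1) x := by
  have he := hasDerivWithinAt_osc (ε := ε) (H.hp x hx)
  have h0 := (H.hβ 0 (by norm_num) x hx).ofReal_comp
  have h1 := (H.hβ 1 (by norm_num) x hx).ofReal_comp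
  have h2 := (H.hβ 2 (by norm_num) x hx).ofReal_comp
  have h3 := (H.hβ 3 (by norm_num) x hx).ofReal_comp
  have hε' : (ε : ℂ) ≠ 0 := by exact_mod_cast hε.ne'
  have hc : (ε : ℂ) * (2 * Complex.I * (dx p x : ℝ) / ε) = 2 * Complex.I * (dx p x : ℝ) := by
    field_simp
  have hl := (((((H.hp x hx).sub_const (p s)).const_mul (2 / ε)).ofReal_comp.const_mul
    Complex.I).mul_const (osc ε (p s))).congr_deriv
    (show _ = 2 * Complex.I * (dx p x : ℝ) / ε * osc ε (p s) by push_cast; field_simp)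
  have hI := Complex.I_sq
  rw [osc_mul_H₂]
  simp_rw [matA2_10]
  refine ((((((h0.mul he).sub_const (betaK p b 0 s * osc ε (p s))).const_mul
      (Complex.I * (ε : ℂ) ^ 2)).neg.add
    (((h1.mul he).sub_const (betaK p b 1 s * osc ε (p s))).const_mul ((ε : ℂ) ^ 3))).add
    ((h2.const_mul (Complex.I * (ε : ℂ) ^ 4)).mul (he.sub_const (osc ε (p s))))).sub
    ((h3.const_mul ((ε : ℂ) ^ 5)).mul ((he.sub_const (osc ε (p s))).sub hl))).congr_deriv ?_
  simp only [Pi.sub_apply]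
  rw [coef, H.b_eq hx, H.dβ_eq 0 hx, H.dβ_eq 1 hx, H.dβ_eq 2 hx]
  push_cast
  generalize 2 * Complex.I * ((dx p x : ℝ) : ℂ) / ε = c at *
  linear_combination ((ε : ℂ) ^ 2 * betaK p b 1 x * osc ε (p x) -
    Complex.I * ε * betaK p b 0 x * osc ε (p x) +
    Complex.I * ε ^ 3 * betaK p b 2 x * osc ε (p x) -
    ε ^ 4 * betaK p b 3 x * (osc ε (p x) - osc ε (p s))) * hc +
    (2 * ε ^ 3 * (dx p x : ℝ) * betaK p b 2 x * osc ε (p x) -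
    2 * ε * (dx p x : ℝ) * betaK p b 0 x * osc ε (p x)) * hI

end StepData

/-! ### Bounds for the entries and for the defects of the primitives -/

namespace StepData

variable {p b : ℝ → ℝ} {B ε s x : ℝ}

theorem norm_coef_le (H : StepData p b B) (hε : 0 < ε) (hx : x ∈ Icc (0 : ℝ) 1) :
    ‖coef p b ε x‖ ≤ B * ε := by
  rw [norm_coef p b hε, mul_comm]
  exact mul_le_mul_of_nonneg_right (H.b_bd x hx) hε.le

theorem abs_phase_sub_le (H : StepData p b B) (hs : 0 ≤ s) (hsx : s ≤ x) (hx : x ≤ 1) :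
    |p x - p s| ≤ B * (x - s) :=
  abs_sub_le_of_deriv hs hx hsx H.hp fun y hy => H.p_bd y ⟨hs.trans hy.1, hy.2.trans hx⟩

theorem abs_betaK_sub_le (H : StepData p b B) {k : ℕ} (hk : k ≤ 3) (hs : 0 ≤ s) (hsx : s ≤ x)
    (hx : x ≤ 1) : |betaK p b k x - betaK p b k s| ≤ B * (x - s) :=
  abs_sub_le_of_deriv hs hx hsx (H.hβ k hk)
    fun y hy => H.dβ_bd k hk y ⟨hs.trans hy.1, hy.2.trans hx⟩

theorem abs_angle_le (H : StepData p b B) (hε : 0 < ε) (hs : 0 ≤ s) (hsx : s ≤ x) (hx : x ≤ 1) :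
    |2 / ε * (p x - p s)| ≤ 2 * B * (x - s) / ε := by
  rw [abs_mul, abs_of_pos (by positivity : 0 < 2 / ε)]
  calc 2 / ε * |p x - p s| ≤ 2 / ε * (B * (x - s)) := by
        gcongr; exact H.abs_phase_sub_le hs hsx hx
    _ = _ := by ring

theorem norm_osc_sub_le (H : StepData p b B) (hε : 0 < ε) (hs : 0 ≤ s) (hsx : s ≤ x)
    (hx : x ≤ 1) : ‖osc ε (p x) - osc ε (p s)‖ ≤ 2 * B * (x - s) / ε := by
  rw [← osc_mul_H₁, norm_mul, norm_osc, one_mul]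
  exact (norm_H₁_le _).trans (H.abs_angle_le hε hs hsx hx)

/-- The source of min(ε, h) in the first order estimate: a difference of unit exponentials is at
most 2, and at most its phase difference, which is of size (x - s)/ε. -/
theorem mul_norm_osc_sub_le (H : StepData p b B) (hε : 0 < ε) (hs : 0 ≤ s) (hsx : s ≤ x)
    (hx : x ≤ 1) : ε * ‖osc ε (p x) - osc ε (p s)‖ ≤ 2 * B * min ε (x - s) := by
  have hB := H.one_le
  rw [mul_min_of_nonneg _ _ (by positivity)]
  refine le_min ?_ ?_
  · have : ‖osc ε (p x) - osc ε (p s)‖ ≤ 2 := by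
      rw [← osc_mul_H₁, norm_mul, norm_osc, one_mul]
      exact norm_H₁_le_two _
    nlinarith
  · have := H.norm_osc_sub_le hε hs hsx hx
    rw [le_div_iff₀ hε] at this
    linarith

theorem coef_sub_deriv_matA1 (H : StepData p b B) (hε : 0 < ε) (hs : 0 ≤ s) (hsx : s ≤ x)
    (hx : x ≤ 1) : ‖(ε : ℂ) ^ 3 * ((dx (betaK p b 1) x : ℝ) : ℂ) * (osc ε (p x) - osc ε (p s))‖ ≤
      2 * B ^ 2 * ε ^ 2 * min ε (x - s) := by
  have hB := H.one_le
  have hx' : x ∈ Icc (0 : ℝ) 1 := ⟨hs.trans hsx, hx⟩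
  rw [norm_mul, norm_mul, norm_pow, Complex.norm_real, Complex.norm_real, Real.norm_eq_abs,
    Real.norm_eq_abs, abs_of_pos hε]
  calc ε ^ 3 * |dx (betaK p b 1) x| * ‖osc ε (p x) - osc ε (p s)‖
      = ε ^ 2 * |dx (betaK p b 1) x| * (ε * ‖osc ε (p x) - osc ε (p s)‖) := by ring
    _ ≤ ε ^ 2 * B * (2 * B * min ε (x - s)) := by
        exact mul_le_mul (mul_le_mul_of_nonneg_left (H.dβ_bd 1 (by norm_num) x hx') (by positivity))
          (H.mul_norm_osc_sub_le hε hs hsx hx) (by positivity) (by positivity)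
    _ = _ := by ring

theorem matA1_self : matA1 p b ε s s 1 0 = 0 := by simp [matA1_10]

theorem matA2_self : matA2 p b ε s s 1 0 = 0 := by simp [matA2_10]

theorem diagMain_self : diagMain p b ε s s = 0 := by simp [diagMain, H₁]

/-- The bound ε² can be read off the explicit powers of ε; the bound ε(x - s) comes from integrating
the derivative, which is of size ε. -/
theorem norm_matA1_le (H : StepData p b B) (hε : 0 < ε) (hε1 : ε ≤ 1) (hs : 0 ≤ s) (hsx : s ≤ x)
    (hx : x ≤ 1) : ‖matA1 p b ε s x 1 0‖ ≤ 4 * B ^ 2 * ε * min ε (x - s) := by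
  have hB := H.one_le
  have hx' : x ∈ Icc (0 : ℝ) 1 := ⟨hs.trans hsx, hx⟩
  have hs' : s ∈ Icc (0 : ℝ) 1 := ⟨hs, hsx.trans hx⟩
  rw [mul_min_of_nonneg _ _ (by positivity)]
  refine le_min ?_ ?_
  · rw [matA1_10]
    refine (norm_sub_le _ _).trans ?_
    have o2 : ‖osc ε (p x) - osc ε (p s)‖ ≤ 2 := by
      rw [← osc_mul_H₁, norm_mul, norm_osc, one_mul]
      exact norm_H₁_le_two _
    have o1 : ‖(betaK p b 0 x : ℂ) * osc ε (p x) - betaK p b 0 s * osc ε (p s)‖ ≤ B + B := by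
      refine (norm_sub_le _ _).trans (add_le_add ?_ ?_) <;>
      rw [norm_mul, norm_osc, mul_one, Complex.norm_real]
      · exact H.β_bd 0 (by norm_num) x hx'
      · exact H.β_bd 0 (by norm_num) s hs'
    simp only [norm_mul, norm_pow, Complex.norm_real, Real.norm_eq_abs, abs_of_pos hε,
      Complex.norm_I, one_mul]
    have o3 := H.β_bd 1 (by norm_num) x hx'
    calc ε ^ 3 * |betaK p b 1 x| * ‖osc ε (p x) - osc ε (p s)‖ +
          ε ^ 2 * ‖(betaK p b 0 x : ℂ) * osc ε (p x) - betaK p b 0 s * osc ε (p s)‖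
        ≤ ε ^ 3 * B * 2 + ε ^ 2 * (B + B) := by gcongr
      _ ≤ ε ^ 2 * B * 2 + ε ^ 2 * (B + B) := by
          gcongr ?_ * _ * _ + _
          exact pow_le_pow_of_le_one hε.le hε1 (by norm_num)
      _ = 4 * B * ε * ε := by ring
      _ ≤ 4 * B ^ 2 * ε * ε := by gcongr; nlinarith
  · have hsub : Icc s x ⊆ Icc 0 1 := Icc_subset_Icc hs hx
    have := norm_sub_le_of_exists_deriv (f := fun t => matA1 p b ε s t 1 0)
      (C := 4 * B ^ 2 * ε) (s := s) (t := x) (fun y hy => ⟨_,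
        (H.hasDeriv_matA1 hε s (hsub hy)).mono hsub, ?_⟩) (τ := x) ⟨hsx, le_rfl⟩
    · simpa [matA1_self] using this
    · refine (norm_add_le _ _).trans ?_
      have h1 := H.norm_coef_le hε (hsub hy)
      have h2 := H.coef_sub_deriv_matA1 hε hs hy.1 (hy.2.trans hx)
      have h3 : 2 * B ^ 2 * ε ^ 2 * min ε (y - s) ≤ 2 * B ^ 2 * ε := by
        calc 2 * B ^ 2 * ε ^ 2 * min ε (y - s) ≤ 2 * B ^ 2 * ε ^ 2 * ε := by
              gcongr; exact min_le_left _ _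
          _ = 2 * B ^ 2 * ε * ε ^ 2 := by ring
          _ ≤ 2 * B ^ 2 * ε := mul_le_of_le_one_right (by positivity) (pow_le_one₀ hε.le hε1)
      have h4 : B * ε ≤ 2 * B ^ 2 * ε := by gcongr; nlinarith
      linarith

theorem norm_conj_coef_mul_matA1_le (H : StepData p b B) (hε : 0 < ε) (hε1 : ε ≤ 1) (hs : 0 ≤ s)
    (hsx : s ≤ x) (hx : x ≤ 1) :
    ‖conj (coef p b ε x) * matA1 p b ε s x 1 0‖ ≤ 4 * B ^ 3 * ε ^ 2 * min ε (x - s) := by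
  have hB := H.one_le
  rw [norm_mul, RCLike.norm_conj]
  calc ‖coef p b ε x‖ * ‖matA1 p b ε s x 1 0‖ ≤ (B * ε) * (4 * B ^ 2 * ε * min ε (x - s)) := by
        gcongr
        · exact H.norm_coef_le hε ⟨hs.trans hsx, hx⟩
        · exact H.norm_matA1_le hε hε1 hs hsx hx
    _ = _ := by ring

theorem coef_sub_deriv_matA2 (H : StepData p b B) (hε : 0 < ε) (hs : 0 ≤ s) (hsx : s ≤ x)
    (hx : x ≤ 1) : ‖(ε : ℂ) ^ 5 * ((dx (betaK p b 3) x : ℝ) : ℂ) *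
      (osc ε (p s) * H₂ (2 / ε * (p x - p s)))‖ ≤ 4 * B ^ 3 * ε ^ 3 * (x - s) ^ 2 := by
  have hB := H.one_le
  have hx' : x ∈ Icc (0 : ℝ) 1 := ⟨hs.trans hsx, hx⟩
  simp only [norm_mul, norm_pow, Complex.norm_real, Real.norm_eq_abs, abs_of_pos hε, norm_osc,
    one_mul]
  have h2 : ‖H₂ (2 / ε * (p x - p s))‖ ≤ (2 * B * (x - s) / ε) ^ 2 := by
    refine (norm_H₂_le _).trans ?_
    rw [← sq_abs]
    gcongr
    exact H.abs_angle_le hε hs hsx hx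
  calc ε ^ 5 * |dx (betaK p b 3) x| * ‖H₂ (2 / ε * (p x - p s))‖
      ≤ ε ^ 5 * B * (2 * B * (x - s) / ε) ^ 2 := by
        gcongr
        exact H.dβ_bd 3 (by norm_num) x hx'
    _ = _ := by field_simp; ring

/-- Here the linear bound for H₂ replaces the quadratic one: one power of x - s is given up for one
power of ε, as the comparison with the first order entry requires. -/
theorem coef_sub_deriv_matA2' (H : StepData p b B) (hε : 0 < ε) (hs : 0 ≤ s) (hsx : s ≤ x)
    (hx : x ≤ 1) : ‖(ε : ℂ) ^ 5 * ((dx (betaK p b 3) x : ℝ) : ℂ) *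
      (osc ε (p s) * H₂ (2 / ε * (p x - p s)))‖ ≤ 4 * B ^ 2 * ε ^ 4 * (x - s) := by
  have hB := H.one_le
  have hx' : x ∈ Icc (0 : ℝ) 1 := ⟨hs.trans hsx, hx⟩
  simp only [norm_mul, norm_pow, Complex.norm_real, Real.norm_eq_abs, abs_of_pos hε, norm_osc,
    one_mul]
  have h2 : ‖H₂ (2 / ε * (p x - p s))‖ ≤ 2 * (2 * B * (x - s) / ε) := by
    refine (norm_H₂_le_two_mul _).trans ?_
    gcongr
    exact H.abs_angle_le hε hs hsx hx
  calc ε ^ 5 * |dx (betaK p b 3) x| * ‖H₂ (2 / ε * (p x - p s))‖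
      ≤ ε ^ 5 * B * (2 * (2 * B * (x - s) / ε)) := by
        gcongr
        exact H.dβ_bd 3 (by norm_num) x hx'
    _ = _ := by field_simp; ring

/-- Both entries vanish at s and are primitives of the same coefficient, so their difference is the
integral of the two defects. -/
theorem norm_matA2_sub_matA1_le (H : StepData p b B) (hε : 0 < ε) (hε1 : ε ≤ 1) (hs : 0 ≤ s)
    (hsx : s ≤ x) (hx : x ≤ 1) :
    ‖matA2 p b ε s x 1 0 - matA1 p b ε s x 1 0‖ ≤ 6 * B ^ 2 * ε ^ 2 * (x - s) ^ 2 := by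
  have hB := H.one_le
  have hxs : 0 ≤ x - s := sub_nonneg.2 hsx
  have hsub : Icc s x ⊆ Icc 0 1 := Icc_subset_Icc hs hx
  have := norm_sub_le_of_exists_deriv (f := fun t => matA2 p b ε s t 1 0 - matA1 p b ε s t 1 0)
    (C := 6 * B ^ 2 * ε ^ 2 * (x - s)) (s := s) (t := x) (fun y hy => ⟨_,
      ((H.hasDeriv_matA2 hε s (hsub hy)).sub (H.hasDeriv_matA1 hε s (hsub hy))).mono hsub, ?_⟩)
      (τ := x) ⟨hsx, le_rfl⟩
  · simp only [matA1_self, matA2_self, sub_zero] at this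
    linarith
  · rw [show ∀ u v w : ℂ, u - v - (u + w) = -(v + w) from fun u v w => by ring, norm_neg]
    refine (norm_add_le _ _).trans ?_
    have h1 := H.coef_sub_deriv_matA1 hε hs hy.1 (hy.2.trans hx)
    have h2 := H.coef_sub_deriv_matA2' hε hs hy.1 (hy.2.trans hx)
    have hys : 0 ≤ y - s := sub_nonneg.2 hy.1
    have hyx : y - s ≤ x - s := by linarith [hy.2]
    have h3 : 2 * B ^ 2 * ε ^ 2 * min ε (y - s) ≤ 2 * B ^ 2 * ε ^ 2 * (x - s) := by
      gcongr; exact (min_le_right _ _).trans hyx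
    have h4 : 4 * B ^ 2 * ε ^ 4 * (y - s) ≤ 4 * B ^ 2 * ε ^ 2 * (x - s) := by
      have : ε ^ 4 ≤ ε ^ 2 := pow_le_pow_of_le_one hε.le hε1 (by norm_num)
      gcongr
    linarith

/-- With F = b β₀, the function y ↦ (y - s)F'(y) - F(y) has derivative (y - s)F''(y). Up to a factor
1/2 the left side is the defect between F and the derivative of its trapezoidal rule. -/
theorem abs_trapezoid_le (H : StepData p b B) (hs : 0 ≤ s) (hsx : s ≤ x) (hx : x ≤ 1) :
    |b s * betaK p b 0 s - b x * betaK p b 0 x +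
      (x - s) * dx (fun y => b y * betaK p b 0 y) x| ≤ B * (x - s) ^ 2 := by
  set F : ℝ → ℝ := fun y => b y * betaK p b 0 y
  have hB := H.one_le
  have hxs : 0 ≤ x - s := sub_nonneg.2 hsx
  have := abs_sub_le_of_deriv (f := fun y => (y - s) * dx F y - F y) hs hx hsx
    (C := B * (x - s)) (fun y hy => (((hasDerivWithinAt_id y _).sub_const s).mul (H.hF' y hy)).sub
      (H.hF y hy)) (fun y hy => ?_)
  · have e : b s * betaK p b 0 s - b x * betaK p b 0 x + (x - s) * dx F x =
      (x - s) * dx F x - F x - ((s - s) * dx F s - F s) := by simp only [F]; ring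
    rw [e]
    linarith
  · have hys : 0 ≤ y - s := sub_nonneg.2 hy.1
    have e : 1 * dx F y + (id y - s) * dx (dx F) y - dx F y = dx (dx F) y * (y - s) := by
      simp only [id]; ring
    rw [e, abs_mul, abs_of_nonneg hys]
    exact mul_le_mul (H.F_bd y ⟨hs.trans hy.1, hy.2.trans hx⟩) (by linarith [hy.2]) hys
      (by positivity)

/-- The product c̄ A¹₁₀ has the non-oscillating part -iε³ b β₀, whose primitive the trapezoidal rule
replaces, and a part carrying the factor H₁, integrated by parts with β₀(s) frozen. The errors are
the trapezoidal defect and ε⁴(β₀(s) - β₀(x))H₁, where each of the last two factors supplies one x -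
s. -/
theorem exists_deriv_diagMain (H : StepData p b B) (hε : 0 < ε) (hs : 0 ≤ s)
    (hsx : s ≤ x) (hx : x ≤ 1) :
    ∃ d, HasDerivWithinAt (diagMain p b ε s) d (Icc 0 1) x ∧
      ‖conj (coef p b ε x) * matA1 p b ε s x 1 0 - d‖ ≤ 5 * B ^ 4 * ε ^ 3 * (x - s) ^ 2 := by
  have hB := H.one_le
  have hxs : 0 ≤ x - s := sub_nonneg.2 hsx
  have hx' : x ∈ Icc (0 : ℝ) 1 := ⟨hs.trans hsx, hx⟩
  have hs' : s ∈ Icc (0 : ℝ) 1 := ⟨hs, hsx.trans hx⟩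
  have h0 := (H.hβ 0 (by norm_num) x hx')
  have hε' : (ε : ℂ) ≠ 0 := by exact_mod_cast hε.ne'
  have hH : HasDerivWithinAt (fun t => H₁ (-(2 / ε) * (p t - p s)))
      (-(2 * Complex.I * (dx p x : ℝ) / ε) * (1 + H₁ (-(2 / ε) * (p x - p s)))) (Icc 0 1) x := by
    have h : HasDerivWithinAt (fun y => -(2 / ε) * (p y - p s)) (-(2 / ε) * dx p x)
      (Icc 0 1) x := ((H.hp x hx').sub_const _).const_mul _
    refine (((hasDerivAt_exp_I _).scomp_hasDerivWithinAt x h).sub_const 1).congr_deriv ?_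
    rw [Complex.real_smul, H₁]
    push_cast
    ring
  refine ⟨_, ((((((hasDerivWithinAt_id x _).sub_const s).mul
    (((H.hF x hx').add_const (b s * betaK p b 0 s)).div_const 2)).ofReal_comp.const_mul
      (Complex.I * (ε : ℂ) ^ 3)).neg).sub
    (((h0.const_mul (betaK p b 0 s)).ofReal_comp.const_mul ((ε : ℂ) ^ 4)).mul hH)), ?_⟩
  have k1 : conj (osc ε (p x)) * osc ε (p x) = 1 := by rw [mul_comm, osc_mul_conj]
  have k2 : conj (osc ε (p x)) * osc ε (p s) = 1 + H₁ (-(2 / ε) * (p x - p s)) := by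
    have := osc_mul_H₁ ε (p x) (p s)
    have e : -(2 / ε) * (p x - p s) = 2 / ε * (p s - p x) := by ring
    rw [e]
    linear_combination (-conj (osc ε (p x))) * this + (H₁ (2 / ε * (p s - p x)) + 1) * k1
  set F' := dx (fun y => b y * betaK p b 0 y) x
  set h := H₁ (-(2 / ε) * (p x - p s)) with hh
  have hc : (ε : ℂ) * (2 * Complex.I * (dx p x : ℝ) / ε) = 2 * Complex.I * (dx p x : ℝ) := by
    field_simp
  have hI := Complex.I_sq
  have hb := H.b_eq hx'
  have key : conj (coef p b ε x) * matA1 p b ε s x 1 0 - (-(Complex.I * (ε : ℂ) ^ 3 *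
      ((1 * ((b x * betaK p b 0 x + b s * betaK p b 0 s) / 2) + (id x - s) * (F' / 2) : ℝ) : ℂ)) -
      ((ε : ℂ) ^ 4 * ((betaK p b 0 s * dx (betaK p b 0) x : ℝ) : ℂ) * h +
        (ε : ℂ) ^ 4 * ((betaK p b 0 s * betaK p b 0 x : ℝ) : ℂ) *
          (-(2 * Complex.I * (dx p x : ℝ) / ε) * (1 + h)))) =
      Complex.I * (ε : ℂ) ^ 3 / 2 * ((b s * betaK p b 0 s - b x * betaK p b 0 x +
        (x - s) * F' : ℝ) : ℂ) + (ε : ℂ) ^ 4 * ((2 * dx p x * betaK p b 1 x *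
          (betaK p b 0 s - betaK p b 0 x) : ℝ) : ℂ) * h := by
    rw [matA1_10, coef, map_mul, Complex.conj_ofReal, H.dβ_eq 0 hx', H.b_eq hx']
    simp only [id]
    push_cast
    generalize 2 * Complex.I * ((dx p x : ℝ) : ℂ) / ε = c at *
    generalize conj (osc ε (p x)) = o at *
    linear_combination (2 * ε * (dx p x : ℝ) * betaK p b 0 x *
        (ε ^ 3 * betaK p b 1 x - Complex.I * ε ^ 2 * betaK p b 0 x)) * k1 +
      (2 * ε * (dx p x : ℝ) * betaK p b 0 x *
        (Complex.I * ε ^ 2 * betaK p b 0 s - ε ^ 3 * betaK p b 1 x)) * k2 -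
      (ε ^ 3 * betaK p b 0 s * betaK p b 0 x * (1 + h)) * hc
  have t1 := H.abs_trapezoid_le hs hsx hx
  have t2 : ‖h‖ ≤ 2 * B * (x - s) / ε := by
    refine (norm_H₁_le _).trans ?_
    rw [neg_mul, abs_neg]
    exact H.abs_angle_le hε hs hsx hx
  have t3 : |2 * dx p x * betaK p b 1 x * (betaK p b 0 s - betaK p b 0 x)| ≤
      2 * B * B * (B * (x - s)) := by
    rw [abs_mul, abs_mul, abs_mul, abs_two, abs_sub_comm (betaK p b 0 s)]
    gcongr
    · exact H.p_bd x hx'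
    · exact H.β_bd 1 (by norm_num) x hx'
    · exact H.abs_betaK_sub_le (by norm_num) hs hsx hx
  have n0 : ∀ n : ℕ, ‖(ε : ℂ) ^ n‖ = ε ^ n := fun n => by
    rw [norm_pow, Complex.norm_real, Real.norm_of_nonneg hε.le]
  calc _ ≤ ε ^ 3 / 2 * (B * (x - s) ^ 2) +
        ε ^ 4 * (2 * B * B * (B * (x - s))) * (2 * B * (x - s) / ε) := by
        refine (congrArg norm key).le.trans (norm_add_le_of_le
          (norm_mul_le_of_le ?_ ((Complex.norm_real _).trans_le t1))
          (norm_mul_le_of_le (norm_mul_le_of_le (n0 4).le ((Complex.norm_real _).trans_le t3)) t2))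
        rw [norm_div, norm_mul, n0]
        simp
    _ = (B / 2 + 4 * B ^ 4) * ε ^ 3 * (x - s) ^ 2 := by field_simp; ring
    _ ≤ 5 * B ^ 4 * ε ^ 3 * (x - s) ^ 2 := by
        gcongr
        have : B ≤ B ^ 4 := le_self_pow₀ hB (by norm_num)
        linarith

end StepData

/-! ### Discrete Gronwall inequality for the marching recursion -/

theorem march_succ (A : ℕ → Matrix (Fin 2) (Fin 2) ℂ) (ZI : Fin 2 → ℂ) {n : ℕ} (hn : 1 ≤ n) :
    march A ZI (n + 1) = (1 + A n).mulVec (march A ZI n) := by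
  obtain ⟨m, rfl⟩ := Nat.exists_eq_add_of_le' hn
  rfl

/-- Discrete Gronwall estimate for the marching recursion. -/
theorem norm_sub_march_le {A : ℕ → Matrix (Fin 2) (Fin 2) ℂ} {ZI : Fin 2 → ℂ}
    {w : ℕ → Fin 2 → ℂ} {x : ℕ → ℝ} {N : ℕ} {L κ e₀ : ℝ} (hL : 0 ≤ L) (hκ : 0 ≤ κ)
    (hx : ∀ n ∈ Ico 1 N, x n ≤ x (n + 1))
    (hA : ∀ n ∈ Ico 1 N, ∀ v, ‖(A n).mulVec v‖ ≤ L * (x (n + 1) - x n) * ‖v‖)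
    (hw : ∀ n ∈ Ico 1 N, ‖w (n + 1) - (1 + A n).mulVec (w n)‖ ≤ κ * (x (n + 1) - x n))
    (h1 : ‖w 1 - ZI‖ ≤ e₀) :
    ∀ n ∈ Icc 1 N, ‖w n - march A ZI n‖ ≤
      Real.exp (L * (x n - x 1)) * (e₀ + κ * (x n - x 1)) := by
  have he₀ : 0 ≤ e₀ := (norm_nonneg _).trans h1
  have mono : ∀ n, 1 ≤ n → n ≤ N → x 1 ≤ x n := by
    intro n hn
    induction n, hn using Nat.le_induction with
    | base => intro _; exact le_rfl
    | succ n hn ih => intro h; exact (ih (by omega)).trans (hx n ⟨hn, by omega⟩)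
  rintro n ⟨hn, hnN⟩
  induction n, hn using Nat.le_induction with
  | base => simpa [march] using h1
  | succ n hn ih =>
    have ih := ih (by omega)
    have hmem : n ∈ Ico 1 N := ⟨hn, by omega⟩
    have hstep := sub_nonneg.2 (hx n hmem)
    have h0 := sub_nonneg.2 (mono n hn (by omega))
    rw [march_succ A ZI hn]
    have e : w (n + 1) - (1 + A n).mulVec (march A ZI n) =
        (w (n + 1) - (1 + A n).mulVec (w n)) +
          ((w n - march A ZI n) + (A n).mulVec (w n - march A ZI n)) := by
      simp only [Matrix.add_mulVec, Matrix.one_mulVec, Matrix.mulVec_sub]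
      abel
    rw [e]
    set δ := x (n + 1) - x n with hδ
    set E := Real.exp (L * (x n - x 1)) * (e₀ + κ * (x n - x 1))
    have hE : 0 ≤ E := by positivity
    have h2 : 1 + L * δ ≤ Real.exp (L * δ) := by linarith [Real.add_one_le_exp (L * δ)]
    -- The new local error is multiplied by the full exponential as well, so that both terms add up
    -- to the claimed form at n + 1.
    have h3 : 1 ≤ Real.exp (L * (x n - x 1)) * Real.exp (L * δ) := by
      rw [← Real.exp_add]; exact Real.one_le_exp (by positivity)
    have h4 : x (n + 1) - x 1 = (x n - x 1) + δ := by rw [hδ]; ring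
    calc _ ≤ κ * δ + (‖w n - march A ZI n‖ + L * δ * ‖w n - march A ZI n‖) :=
          norm_add_le_of_le (hw n hmem) (norm_add_le_of_le le_rfl (hA n hmem _))
      _ = κ * δ + (1 + L * δ) * ‖w n - march A ZI n‖ := by ring
      _ ≤ κ * δ * (Real.exp (L * (x n - x 1)) * Real.exp (L * δ)) + Real.exp (L * δ) * E := by
          exact add_le_add (le_mul_of_one_le_right (by positivity) h3)
            (mul_le_mul h2 ih (norm_nonneg _) (Real.exp_nonneg _))
      _ = _ := by
          rw [h4, mul_add L, Real.exp_add]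
          simp only [E]
          ring

/-! ### Consistency: one step applied to a near solution -/

/-- `(w₁, w₂)` solves the transformed equation with phase `p` and coefficient `b` up to a residual
of size `ρ`, and is bounded by `W`. -/
structure NearSolution (p b : ℝ → ℝ) (ε ρ W : ℝ) (w₁ w₂ r₁ r₂ : ℝ → ℂ) : Prop where
  ρ_nonneg : 0 ≤ ρ
  deriv₁ : ∀ x ∈ Icc (0 : ℝ) 1,
    HasDerivWithinAt w₁ (conj (coef p b ε x) * w₂ x + r₁ x) (Icc 0 1) x
  deriv₂ : ∀ x ∈ Icc (0 : ℝ) 1,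
    HasDerivWithinAt w₂ (coef p b ε x * w₁ x + r₂ x) (Icc 0 1) x
  res₁ : ∀ x ∈ Icc (0 : ℝ) 1, ‖r₁ x‖ ≤ ρ
  res₂ : ∀ x ∈ Icc (0 : ℝ) 1, ‖r₂ x‖ ≤ ρ
  bound₁ : ∀ x ∈ Icc (0 : ℝ) 1, ‖w₁ x‖ ≤ W
  bound₂ : ∀ x ∈ Icc (0 : ℝ) 1, ‖w₂ x‖ ≤ W

theorem NearSolution.W_nonneg {p b : ℝ → ℝ} {ε ρ W : ℝ} {w₁ w₂ r₁ r₂ : ℝ → ℂ}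
    (Hw : NearSolution p b ε ρ W w₁ w₂ r₁ r₂) : 0 ≤ W :=
  (norm_nonneg _).trans (Hw.bound₁ 0 (by simp))

theorem hasDerivWithinAt_conj {f : ℝ → ℂ} {f' : ℂ} {s : Set ℝ} {x : ℝ}
    (h : HasDerivWithinAt f f' s x) :
    HasDerivWithinAt (fun y => conj (f y)) (conj f') s x :=
  (Complex.conjCLE.toContinuousLinearMap.hasFDerivAt (x := f x)).comp_hasDerivWithinAt x h

theorem norm_conj_sub (a b : ℂ) : ‖conj a - conj b‖ = ‖a - b‖ := by
  rw [← map_sub, RCLike.norm_conj]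

/-- The system is invariant under exchanging the components and conjugating the coefficients, so
`picard_step` serves both components, with S and D conjugated for the second one. -/
theorem NearSolution.step {p b : ℝ → ℝ} {ε ρ W B : ℝ} {w₁ w₂ r₁ r₂ S D : ℝ → ℂ} {s t η : ℝ}
    (Hw : NearSolution p b ε ρ W w₁ w₂ r₁ r₂) (H : StepData p b B) (hε : 0 < ε) (hε1 : ε ≤ 1)
    (hs : 0 ≤ s) (hst : s ≤ t) (ht : t ≤ 1) (hη : 0 ≤ η) (hS0 : S s = 0) (hD0 : D s = 0)
    (hS : ∀ τ ∈ Icc s t, ∃ d, HasDerivWithinAt S d (Icc 0 1) τ ∧ ‖coef p b ε τ - d‖ ≤ η)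
    (hD : ∀ τ ∈ Icc s t, ∃ d, HasDerivWithinAt D d (Icc 0 1) τ ∧
      ‖conj (coef p b ε τ) * S τ - d‖ ≤ η) :
    ‖w₁ t - (w₁ s + (D t * w₁ s + conj (S t) * w₂ s))‖ ≤
      ((B ^ 3 * ε ^ 3 * (t - s) ^ 2 + 3 * B * η) * W + 3 * B ^ 2 * ρ) * (t - s) ∧
    ‖w₂ t - (w₂ s + (conj (D t) * w₂ s + S t * w₁ s))‖ ≤
      ((B ^ 3 * ε ^ 3 * (t - s) ^ 2 + 3 * B * η) * W + 3 * B ^ 2 * ρ) * (t - s) := by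
  have hB := H.one_le
  have hW := Hw.W_nonneg
  have hρ := Hw.ρ_nonneg
  have hsub : Icc s t ⊆ Icc 0 1 := Icc_subset_Icc hs ht
  have hh : 0 ≤ t - s := sub_nonneg.2 hst
  have h1 : t - s ≤ 1 := by linarith
  have hc : ∀ τ ∈ Icc s t, ‖coef p b ε τ‖ ≤ B * ε := fun τ hτ => H.norm_coef_le hε (hsub hτ)
  have hc' : ∀ τ ∈ Icc s t, ‖conj (coef p b ε τ)‖ ≤ B * ε := fun τ hτ => by
    rw [RCLike.norm_conj]; exact hc τ hτ
  have hSc : ∀ τ ∈ Icc s t, ∃ d, HasDerivWithinAt (fun τ => conj (S τ)) d (Icc s t) τ ∧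
      ‖conj (coef p b ε τ) - d‖ ≤ η := fun τ hτ => by
    obtain ⟨d, hd, hd'⟩ := hS τ hτ
    exact ⟨_, hasDerivWithinAt_conj (hd.mono hsub), by rwa [norm_conj_sub]⟩
  have hDc : ∀ τ ∈ Icc s t, ∃ d, HasDerivWithinAt (fun τ => conj (D τ)) d (Icc s t) τ ∧
      ‖coef p b ε τ * conj (S τ) - d‖ ≤ η := fun τ hτ => by
    obtain ⟨d, hd, hd'⟩ := hD τ hτ
    refine ⟨_, hasDerivWithinAt_conj (hd.mono hsub), ?_⟩
    rwa [← norm_conj_sub, map_mul, Complex.conj_conj] at hd'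
  have hS' : ∀ τ ∈ Icc s t, ∃ d, HasDerivWithinAt S d (Icc s t) τ ∧ ‖coef p b ε τ - d‖ ≤ η :=
    fun τ hτ => (hS τ hτ).imp fun d hd => ⟨hd.1.mono hsub, hd.2⟩
  have hD' : ∀ τ ∈ Icc s t, ∃ d, HasDerivWithinAt D d (Icc s t) τ ∧
      ‖conj (coef p b ε τ) * S τ - d‖ ≤ η :=
    fun τ hτ => (hD τ hτ).imp fun d hd => ⟨hd.1.mono hsub, hd.2⟩
  have hd₁ := fun τ hτ => (Hw.deriv₁ τ (hsub hτ)).mono hsub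
  have hd₂ := fun τ hτ => (Hw.deriv₂ τ (hsub hτ)).mono hsub
  have hγ : B * ε ≤ B := mul_le_of_le_one_right (by linarith) hε1
  have fin : (((B * ε) ^ 3 * (t - s) ^ 2 + (B * ε + 2) * η) * W +
      (1 + B * ε + (B * ε) ^ 2) * ρ) * (t - s) ≤
      ((B ^ 3 * ε ^ 3 * (t - s) ^ 2 + 3 * B * η) * W + 3 * B ^ 2 * ρ) * (t - s) := by
    have e2 : 1 + B * ε + (B * ε) ^ 2 ≤ 3 * B ^ 2 := by
      have : (B * ε) ^ 2 ≤ B ^ 2 := by gcongr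
      nlinarith
    rw [mul_pow]
    gcongr
    linarith
  exact ⟨(picard_step hst h1 (by positivity) hη hρ hW hS0 (by simp [hS0]) hD0 hd₁ hd₂ hc' hc
      (fun τ hτ => Hw.res₁ τ (hsub hτ)) (fun τ hτ => Hw.res₂ τ (hsub hτ))
      (fun τ hτ => Hw.bound₁ τ (hsub hτ)) (fun τ hτ => Hw.bound₂ τ (hsub hτ)) hS' hSc hD').trans fin,
    (picard_step hst h1 (by positivity) hη hρ hW (by simp [hS0]) hS0 (by simp [hD0]) hd₂ hd₁ hc hc'
      (fun τ hτ => Hw.res₂ τ (hsub hτ)) (fun τ hτ => Hw.res₁ τ (hsub hτ))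
      (fun τ hτ => Hw.bound₂ τ (hsub hτ)) (fun τ hτ => Hw.bound₁ τ (hsub hτ)) hSc hS' hDc).trans fin⟩

theorem norm_fin_two_le {v : Fin 2 → ℂ} {C : ℝ} (h0 : ‖v 0‖ ≤ C) (h1 : ‖v 1‖ ≤ C) : ‖v‖ ≤ C :=
  (pi_norm_le_iff_of_nonneg ((norm_nonneg _).trans h0)).2 (Fin.forall_fin_two.2 ⟨h0, h1⟩)

theorem norm_mulVec_le {M : Matrix (Fin 2) (Fin 2) ℂ} {c d : ℝ} (h00 : ‖M 0 0‖ ≤ c)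
    (h01 : ‖M 0 1‖ ≤ d) (h10 : ‖M 1 0‖ ≤ d) (h11 : ‖M 1 1‖ ≤ c) (v : Fin 2 → ℂ) :
    ‖M.mulVec v‖ ≤ (c + d) * ‖v‖ := by
  have hc := (norm_nonneg _).trans h00
  have hd := (norm_nonneg _).trans h01
  have v0 := norm_le_pi_norm v 0
  have v1 := norm_le_pi_norm v 1
  have aux : ∀ a b : ℂ, ‖a‖ ≤ c → ‖b‖ ≤ d → ‖a * v 0 + b * v 1‖ ≤ (c + d) * ‖v‖ ∧
      ‖b * v 0 + a * v 1‖ ≤ (c + d) * ‖v‖ := fun a b ha hb => by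
    constructor
    · rw [add_mul]
      exact norm_add_le_of_le (norm_mul_le_of_le ha v0) (norm_mul_le_of_le hb v1)
    · rw [add_mul, add_comm]
      exact norm_add_le_of_le (norm_mul_le_of_le ha v1) (norm_mul_le_of_le hb v0)
  refine norm_fin_two_le ?_ ?_
  · simpa [Matrix.mulVec, dotProduct, Fin.sum_univ_two] using (aux _ _ h00 h01).1
  · simpa [Matrix.mulVec, dotProduct, Fin.sum_univ_two] using (aux _ _ h11 h10).2

theorem one_add_mulVec_zero (M : Matrix (Fin 2) (Fin 2) ℂ) (v : Fin 2 → ℂ) :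
    (1 + M).mulVec v 0 = v 0 + (M 0 0 * v 0 + M 0 1 * v 1) := by
  simp [Matrix.mulVec, dotProduct, Fin.sum_univ_two]
  ring

theorem one_add_mulVec_one (M : Matrix (Fin 2) (Fin 2) ℂ) (v : Fin 2 → ℂ) :
    (1 + M).mulVec v 1 = v 1 + (M 1 0 * v 0 + M 1 1 * v 1) := by
  simp [Matrix.mulVec, dotProduct, Fin.sum_univ_two]
  ring

theorem NearSolution.step_first {p b : ℝ → ℝ} {ε ρ W B : ℝ} {w₁ w₂ r₁ r₂ : ℝ → ℂ} {s t : ℝ}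
    (Hw : NearSolution p b ε ρ W w₁ w₂ r₁ r₂) (H : StepData p b B) (hε : 0 < ε) (hε1 : ε ≤ 1)
    (hs : 0 ≤ s) (hst : s ≤ t) (ht : t ≤ 1) :
    ‖![w₁ t, w₂ t] - (1 + matA1 p b ε s t).mulVec ![w₁ s, w₂ s]‖ ≤
      (13 * B ^ 4 * ε ^ 2 * min ε (t - s) * W + 3 * B ^ 2 * ρ) * (t - s) := by
  have hB := H.one_le
  have hW := Hw.W_nonneg
  have hh : 0 ≤ t - s := sub_nonneg.2 hst
  have hm : 0 ≤ min ε (t - s) := le_min hε.le hh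
  have mono : ∀ τ ∈ Icc s t, min ε (τ - s) ≤ min ε (t - s) := fun τ hτ =>
    min_le_min_left _ (by linarith [hτ.2])
  -- The first order matrix has no diagonal, so all of c̄ S counts as defect; it has the size ε²
  -- min(ε, h), like the defect of S.
  have key := Hw.step H hε hε1 hs hst ht (S := fun τ => matA1 p b ε s τ 1 0) (D := fun _ => 0)
    (η := 4 * B ^ 3 * ε ^ 2 * min ε (t - s)) (by positivity) StepData.matA1_self rfl
    (fun τ hτ => ⟨_, H.hasDeriv_matA1 hε s ⟨hs.trans hτ.1, hτ.2.trans ht⟩, ?_⟩)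
    (fun τ hτ => ⟨0, hasDerivWithinAt_const _ _ _, ?_⟩)
  · have fin : ((B ^ 3 * ε ^ 3 * (t - s) ^ 2 + 3 * B * (4 * B ^ 3 * ε ^ 2 * min ε (t - s))) * W +
        3 * B ^ 2 * ρ) * (t - s) ≤
        (13 * B ^ 4 * ε ^ 2 * min ε (t - s) * W + 3 * B ^ 2 * ρ) * (t - s) := by
      have h2 : ε * (t - s) ^ 2 ≤ min ε (t - s) := by
        refine le_min (mul_le_of_le_one_right hε.le (pow_le_one₀ hh (by linarith))) ?_
        nlinarith
      have h3 : B ^ 3 ≤ B ^ 4 := pow_le_pow_right₀ hB (by norm_num)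
      gcongr
      calc B ^ 3 * ε ^ 3 * (t - s) ^ 2 + 3 * B * (4 * B ^ 3 * ε ^ 2 * min ε (t - s))
          = B ^ 3 * ε ^ 2 * (ε * (t - s) ^ 2) + 12 * B ^ 4 * ε ^ 2 * min ε (t - s) := by ring
        _ ≤ B ^ 4 * ε ^ 2 * min ε (t - s) + 12 * B ^ 4 * ε ^ 2 * min ε (t - s) := by gcongr
        _ = _ := by ring
    refine norm_fin_two_le (le_trans (le_of_eq ?_) (key.1.trans fin))
      (le_trans (le_of_eq ?_) (key.2.trans fin))
    · rw [Pi.sub_apply, one_add_mulVec_zero, matA1_01, (matA1_diag p b ε s t).1]; simp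
    · rw [Pi.sub_apply, one_add_mulVec_one, (matA1_diag p b ε s t).2]; simp
  · rw [sub_add_cancel_left, norm_neg]
    refine (H.coef_sub_deriv_matA1 hε hs hτ.1 (hτ.2.trans ht)).trans ?_
    have := mono τ hτ
    have h3 : B ^ 2 ≤ B ^ 3 := pow_le_pow_right₀ hB (by norm_num)
    have h4 : 0 ≤ min ε (τ - s) := le_min hε.le (sub_nonneg.2 hτ.1)
    gcongr
    norm_num
  · rw [sub_zero]
    refine (H.norm_conj_coef_mul_matA1_le hε hε1 hs hτ.1 (hτ.2.trans ht)).trans ?_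
    have := mono τ hτ
    gcongr

/-- The H₂ part of the diagonal is already of the size of the local error, so it can be kept out of
the primitive D and added at the end. -/
theorem StepData.norm_diag_rest_le {p b : ℝ → ℝ} {ε B s t : ℝ} (H : StepData p b B) (hε : 0 < ε)
    (hs : 0 ≤ s) (hst : s ≤ t) (ht : t ≤ 1) :
    ‖matA3 p b ε s t 0 0 - diagMain p b ε s t‖ ≤ 4 * B ^ 4 * ε ^ 3 * (t - s) ^ 3 := by
  have hB := H.one_le
  have hh : 0 ≤ t - s := sub_nonneg.2 hst
  rw [matA3_00, add_sub_cancel_left]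
  simp only [norm_mul, norm_pow, Complex.norm_real, Real.norm_eq_abs, abs_of_pos hε,
    Complex.norm_I, one_mul]
  have h2 : ‖H₂ (-(2 / ε) * (p t - p s))‖ ≤ (2 * B * (t - s) / ε) ^ 2 := by
    refine (norm_H₂_le _).trans ?_
    rw [neg_mul, neg_sq, ← sq_abs]
    gcongr
    exact H.abs_angle_le hε hs hst ht
  have h3 := H.β_bd 1 (by norm_num) t ⟨hs.trans hst, ht⟩
  have h4 := H.abs_betaK_sub_le (k := 0) (by norm_num) hs hst ht
  rw [abs_sub_comm] at h4
  calc ε ^ 5 * (|betaK p b 1 t| * |betaK p b 0 s - betaK p b 0 t|) * _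
      ≤ ε ^ 5 * (B * (B * (t - s))) * (2 * B * (t - s) / ε) ^ 2 := by gcongr
    _ = _ := by field_simp; ring

theorem NearSolution.step_second {p b : ℝ → ℝ} {ε ρ W B : ℝ} {w₁ w₂ r₁ r₂ : ℝ → ℂ} {s t : ℝ}
    (Hw : NearSolution p b ε ρ W w₁ w₂ r₁ r₂) (H : StepData p b B) (hε : 0 < ε) (hε1 : ε ≤ 1)
    (hs : 0 ≤ s) (hst : s ≤ t) (ht : t ≤ 1) :
    ‖![w₁ t, w₂ t] - (1 + (matA2 p b ε s t + matA3 p b ε s t)).mulVec ![w₁ s, w₂ s]‖ ≤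
      (38 * B ^ 5 * ε ^ 3 * (t - s) ^ 2 * W + 3 * B ^ 2 * ρ) * (t - s) := by
  have hB := H.one_le
  have hW := Hw.W_nonneg
  have hh : 0 ≤ t - s := sub_nonneg.2 hst
  have hh1 : t - s ≤ 1 := by linarith
  have key := Hw.step H hε hε1 hs hst ht (S := fun τ => matA2 p b ε s τ 1 0)
    (D := diagMain p b ε s) (η := 11 * B ^ 4 * ε ^ 3 * (t - s) ^ 2) (by positivity)
    StepData.matA2_self StepData.diagMain_self
    (fun τ hτ => ⟨_, H.hasDeriv_matA2 hε s ⟨hs.trans hτ.1, hτ.2.trans ht⟩, ?_⟩)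
    (fun τ hτ => ?_)
  · have rest := H.norm_diag_rest_le hε hs hst ht
    have h0 : (0 : ℝ) ≤ 4 * B ^ 4 * ε ^ 3 * (t - s) ^ 3 := by positivity
    have r1 := norm_mul_le_of_le rest (Hw.bound₁ s ⟨hs, hst.trans ht⟩)
    have r2 := norm_mul_le_of_le ((norm_conj_sub _ _).trans_le rest)
      (Hw.bound₂ s ⟨hs, hst.trans ht⟩)
    -- 38 = 1 + 33 + 4: Picard remainder, defects of the primitives, and remainder of the diagonal.
    -- The 11 in the defect is 6 + 5, from exchanging A² for A¹ and from the derivative of the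
    -- diagonal.
    have fin : ((B ^ 3 * ε ^ 3 * (t - s) ^ 2 + 3 * B * (11 * B ^ 4 * ε ^ 3 * (t - s) ^ 2)) * W +
        3 * B ^ 2 * ρ) * (t - s) + 4 * B ^ 4 * ε ^ 3 * (t - s) ^ 3 * W ≤
        (38 * B ^ 5 * ε ^ 3 * (t - s) ^ 2 * W + 3 * B ^ 2 * ρ) * (t - s) := by
      have h3 : B ^ 3 ≤ B ^ 5 := pow_le_pow_right₀ hB (by norm_num)
      have h4 : B ^ 4 ≤ B ^ 5 := pow_le_pow_right₀ hB (by norm_num)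
      have h5 : B ^ 3 + 33 * B ^ 5 + 4 * B ^ 4 ≤ 38 * B ^ 5 := by linarith
      calc _ = ((B ^ 3 + 33 * B ^ 5 + 4 * B ^ 4) * ε ^ 3 * (t - s) ^ 2 * W + 3 * B ^ 2 * ρ) *
            (t - s) := by ring
        _ ≤ _ := by gcongr
    refine norm_fin_two_le ((norm_sub_le_of_le key.1 r1).trans' (le_of_eq ?_) |>.trans fin)
      ((norm_sub_le_of_le key.2 r2).trans' (le_of_eq ?_) |>.trans fin)
    · rw [Pi.sub_apply, one_add_mulVec_zero]
      simp only [Matrix.add_apply, matA2_01, (matA2_diag p b ε s t).1, (matA3_offDiag p b ε s t).1]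
      congr 1
      simp
      ring
    · rw [Pi.sub_apply, one_add_mulVec_one]
      simp only [Matrix.add_apply, (matA2_diag p b ε s t).2, (matA3_offDiag p b ε s t).2, matA3_11]
      congr 1
      simp
      ring
  · rw [sub_sub_cancel]
    refine (H.coef_sub_deriv_matA2 hε hs hτ.1 (hτ.2.trans ht)).trans ?_
    have h3 : B ^ 3 ≤ B ^ 4 := pow_le_pow_right₀ hB (by norm_num)
    have h4 : 0 ≤ τ - s := sub_nonneg.2 hτ.1
    have h5 := hτ.2
    gcongr
    norm_num
  · have h4 : 0 ≤ τ - s := sub_nonneg.2 hτ.1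
    have h5 := hτ.2
    have hτ1 := hτ.2.trans ht
    obtain ⟨d, hd, hd'⟩ := H.exists_deriv_diagMain hε hs hτ.1 hτ1
    refine ⟨d, hd, ?_⟩
    have e : conj (coef p b ε τ) * matA2 p b ε s τ 1 0 - d =
        conj (coef p b ε τ) * (matA2 p b ε s τ 1 0 - matA1 p b ε s τ 1 0) +
        (conj (coef p b ε τ) * matA1 p b ε s τ 1 0 - d) := by ring
    rw [e]
    refine (norm_add_le_of_le (norm_mul_le_of_le ((RCLike.norm_conj _).trans_le
      (H.norm_coef_le hε ⟨hs.trans hτ.1, hτ1⟩)) (H.norm_matA2_sub_matA1_le hε hε1 hs hτ.1 hτ1))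
      hd').trans ?_
    have h6 : B ^ 3 ≤ B ^ 4 := pow_le_pow_right₀ hB (by norm_num)
    calc B * ε * (6 * B ^ 2 * ε ^ 2 * (τ - s) ^ 2) + 5 * B ^ 4 * ε ^ 3 * (τ - s) ^ 2
        = (6 * B ^ 3 + 5 * B ^ 4) * ε ^ 3 * (τ - s) ^ 2 := by ring
      _ ≤ (11 * B ^ 4) * ε ^ 3 * (t - s) ^ 2 := by gcongr; linarith

/-! ### Stability of both schemes and accumulation of errors over the grid -/

theorem StepData.norm_matA1_mulVec_le {p b : ℝ → ℝ} {ε B s t : ℝ} (H : StepData p b B)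
    (hε : 0 < ε) (hε1 : ε ≤ 1) (hs : 0 ≤ s) (hst : s ≤ t) (ht : t ≤ 1) (v : Fin 2 → ℂ) :
    ‖(matA1 p b ε s t).mulVec v‖ ≤ 23 * B ^ 4 * (t - s) * ‖v‖ := by
  have hB := H.one_le
  have hh : 0 ≤ t - s := sub_nonneg.2 hst
  have h1 : ‖matA1 p b ε s t 1 0‖ ≤ 23 * B ^ 4 * (t - s) := by
    refine (H.norm_matA1_le hε hε1 hs hst ht).trans ?_
    have h2 : B ^ 2 ≤ B ^ 4 := pow_le_pow_right₀ hB (by norm_num)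
    have h3 : ε * min ε (t - s) ≤ 1 * (t - s) :=
      mul_le_mul hε1 (min_le_right _ _) (le_min hε.le hh) zero_le_one
    calc 4 * B ^ 2 * ε * min ε (t - s) = 4 * B ^ 2 * (ε * min ε (t - s)) := by ring
      _ ≤ 23 * B ^ 4 * (1 * (t - s)) := by gcongr; norm_num
      _ = _ := by ring
  have := norm_mulVec_le (M := matA1 p b ε s t) (c := 0) (by simp [(matA1_diag p b ε s t).1])
    (by rw [matA1_01, RCLike.norm_conj]; exact h1) h1 (by simp [(matA1_diag p b ε s t).2]) v
  rwa [zero_add] at this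

theorem StepData.norm_matA2_add_matA3_mulVec_le {p b : ℝ → ℝ} {ε B s t : ℝ} (H : StepData p b B)
    (hε : 0 < ε) (hε1 : ε ≤ 1) (hs : 0 ≤ s) (hst : s ≤ t) (ht : t ≤ 1) (v : Fin 2 → ℂ) :
    ‖(matA2 p b ε s t + matA3 p b ε s t).mulVec v‖ ≤ 23 * B ^ 4 * (t - s) * ‖v‖ := by
  have hB := H.one_le
  have hh : 0 ≤ t - s := sub_nonneg.2 hst
  have hh1 : t - s ≤ 1 := by linarith
  have h2 : B ^ 2 ≤ B ^ 4 := pow_le_pow_right₀ hB (by norm_num)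
  have h3 : B ^ 3 ≤ B ^ 4 := pow_le_pow_right₀ hB (by norm_num)
  have n10 : ‖matA2 p b ε s t 1 0‖ ≤ 10 * B ^ 4 * (t - s) := by
    have e := norm_add_le_of_le (H.norm_matA2_sub_matA1_le hε hε1 hs hst ht)
      (H.norm_matA1_le hε hε1 hs hst ht)
    rw [sub_add_cancel] at e
    refine e.trans ?_
    have h5 : ε * min ε (t - s) ≤ 1 * (t - s) :=
      mul_le_mul hε1 (min_le_right _ _) (le_min hε.le hh) zero_le_one
    have h6 : ε ^ 2 * (t - s) ^ 2 ≤ 1 * (t - s) :=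
      mul_le_mul (pow_le_one₀ hε.le hε1) (by nlinarith) (by positivity) zero_le_one
    calc _ = 6 * B ^ 2 * (ε ^ 2 * (t - s) ^ 2) + 4 * B ^ 2 * (ε * min ε (t - s)) := by ring
      _ ≤ 6 * B ^ 4 * (1 * (t - s)) + 4 * B ^ 4 * (1 * (t - s)) := by gcongr
      _ = _ := by ring
  have n00 : ‖matA3 p b ε s t 0 0‖ ≤ 13 * B ^ 4 * (t - s) := by
    have hsub : Icc s t ⊆ Icc 0 1 := Icc_subset_Icc hs ht
    -- The diagonal is bounded through its derivative, which is c̄ A¹₁₀ up to its defect; this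
    -- yields the factor t - s at once.
    have := norm_sub_le_of_exists_deriv (f := diagMain p b ε s) (C := 9 * B ^ 4)
      (s := s) (t := t) (fun y hy => ?_) (τ := t) ⟨hst, le_rfl⟩
    · rw [StepData.diagMain_self, sub_zero] at this
      have e := norm_add_le_of_le (H.norm_diag_rest_le hε hs hst ht) this
      rw [sub_add_cancel] at e
      refine e.trans ?_
      have h6 : ε ^ 3 * (t - s) ^ 3 ≤ 1 * (t - s) :=
        mul_le_mul (pow_le_one₀ hε.le hε1) (pow_le_of_le_one hh hh1 (by norm_num))
          (by positivity) zero_le_one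
      calc _ = 4 * B ^ 4 * (ε ^ 3 * (t - s) ^ 3) + 9 * B ^ 4 * (t - s) := by ring
        _ ≤ 4 * B ^ 4 * (1 * (t - s)) + 9 * B ^ 4 * (t - s) := by gcongr
        _ = _ := by ring
    · obtain ⟨d, hd, hd'⟩ := H.exists_deriv_diagMain hε hs hy.1 (hy.2.trans ht)
      refine ⟨d, hd.mono hsub, ?_⟩
      have e := norm_sub_le_of_le
        (H.norm_conj_coef_mul_matA1_le hε hε1 hs hy.1 (hy.2.trans ht)) hd'
      rw [sub_sub_cancel] at e
      refine e.trans ?_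
      have hys : 0 ≤ y - s := sub_nonneg.2 hy.1
      have hy1 : y - s ≤ 1 := by linarith [hy.2]
      have h5 : ε ^ 2 * min ε (y - s) ≤ 1 * 1 :=
        mul_le_mul (pow_le_one₀ hε.le hε1) ((min_le_right _ _).trans hy1)
          (le_min hε.le hys) zero_le_one
      have h6 : ε ^ 3 * (y - s) ^ 2 ≤ 1 * 1 :=
        mul_le_mul (pow_le_one₀ hε.le hε1) (pow_le_one₀ hys hy1) (by positivity) zero_le_one
      calc _ = 4 * B ^ 3 * (ε ^ 2 * min ε (y - s)) + 5 * B ^ 4 * (ε ^ 3 * (y - s) ^ 2) := by ring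
        _ ≤ 4 * B ^ 4 * (1 * 1) + 5 * B ^ 4 * (1 * 1) := by gcongr
        _ = _ := by ring
  have := norm_mulVec_le (M := matA2 p b ε s t + matA3 p b ε s t)
    (c := 13 * B ^ 4 * (t - s)) (d := 10 * B ^ 4 * (t - s))
    (by rw [Matrix.add_apply, (matA2_diag p b ε s t).1, zero_add]; exact n00)
    (by rw [Matrix.add_apply, (matA3_offDiag p b ε s t).1, add_zero, matA2_01, RCLike.norm_conj]
        exact n10)
    (by rw [Matrix.add_apply, (matA3_offDiag p b ε s t).2, add_zero]; exact n10)
    (by rw [Matrix.add_apply, (matA2_diag p b ε s t).2, zero_add, matA3_11, RCLike.norm_conj]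
        exact n00) v
  refine this.trans (le_of_eq ?_)
  ring

namespace IsGrid

variable {N : ℕ} {x : ℕ → ℝ} {h : ℝ}

theorem le_of_le (H : IsGrid N x h) {m n : ℕ} (hm : 1 ≤ m) (hmn : m ≤ n) (hn : n ≤ N) :
    x m ≤ x n := by
  induction n, hmn using Nat.le_induction with
  | base => exact le_rfl
  | succ n hmn ih => exact (ih (by omega)).trans (H.step n ⟨by omega, by omega⟩).le

theorem mem (H : IsGrid N x h) {n : ℕ} (hn : n ∈ Icc 1 N) : x n ∈ Icc (0 : ℝ) 1 :=
  ⟨H.first ▸ H.le_of_le le_rfl hn.1 hn.2, H.last ▸ H.le_of_le hn.1 hn.2 le_rfl⟩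

theorem sub_le (H : IsGrid N x h) {n : ℕ} (hn : n ∈ Ico 1 N) : x (n + 1) - x n ≤ h :=
  (le_abs_self _).trans (H.width.2 ⟨n, hn, rfl⟩)

theorem nonneg (H : IsGrid N x h) : 0 ≤ h := by
  obtain ⟨n, -, rfl⟩ := H.width.1
  exact abs_nonneg _

end IsGrid

theorem IsGrid.norm_sub_march_le {L h κ e₀ : ℝ} {w₁ w₂ : ℝ → ℂ}
    {N : ℕ} {x : ℕ → ℝ} {A : ℝ → ℝ → Matrix (Fin 2) (Fin 2) ℂ} {ZI : Fin 2 → ℂ}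
    (hx : IsGrid N x h) (hL : 0 ≤ L) (hκ : 0 ≤ κ)
    (hA : ∀ s t, 0 ≤ s → s ≤ t → t ≤ 1 → ∀ v, ‖(A s t).mulVec v‖ ≤ L * (t - s) * ‖v‖)
    (hw : ∀ s t, 0 ≤ s → s ≤ t → t ≤ 1 → t - s ≤ h →
      ‖![w₁ t, w₂ t] - (1 + A s t).mulVec ![w₁ s, w₂ s]‖ ≤ κ * (t - s))
    (h0 : ‖![w₁ 0, w₂ 0] - ZI‖ ≤ e₀) {n : ℕ} (hn : n ∈ Icc 1 N) :
    ‖![w₁ (x n), w₂ (x n)] - march (fun n => A (x n) (x (n + 1))) ZI n‖ ≤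
      Real.exp L * (e₀ + κ) := by
  have he₀ : 0 ≤ e₀ := (norm_nonneg _).trans h0
  have hmem : ∀ n ∈ Ico 1 N, 0 ≤ x n ∧ x n ≤ x (n + 1) ∧ x (n + 1) ≤ 1 := fun n hn =>
    ⟨(hx.mem ⟨hn.1, hn.2.le⟩).1, (hx.step n hn).le, (hx.mem ⟨by omega, hn.2⟩).2⟩
  have key := WKB.norm_sub_march_le (A := fun n => A (x n) (x (n + 1))) (ZI := ZI)
    (w := fun n => ![w₁ (x n), w₂ (x n)]) (x := x) (N := N) (L := L) (κ := κ) (e₀ := e₀) hL hκ (fun n hn => (hmem n hn).2.1)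
    (fun n hn => hA _ _ (hmem n hn).1 (hmem n hn).2.1 (hmem n hn).2.2)
    (fun n hn => hw _ _ (hmem n hn).1 (hmem n hn).2.1 (hmem n hn).2.2 (hx.sub_le hn))
    (by rw [hx.first]; exact h0) n hn
  refine key.trans ?_
  rw [hx.first, sub_zero]
  have h2 : L * x n ≤ L := mul_le_of_le_one_right hL (hx.mem hn).2
  have h3 : κ * x n ≤ κ := mul_le_of_le_one_right hκ (hx.mem hn).2
  have h4 : 0 ≤ κ * x n := mul_nonneg hκ (hx.mem hn).1
  exact mul_le_mul (Real.exp_le_exp.2 h2) (by linarith) (by positivity) (Real.exp_nonneg _)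

theorem NearSolution.norm_sub_first_le {p b : ℝ → ℝ} {ε ρ W B h e₀ : ℝ} {w₁ w₂ r₁ r₂ : ℝ → ℂ}
    {N : ℕ} {x : ℕ → ℝ} {ZI : Fin 2 → ℂ}
    (Hw : NearSolution p b ε ρ W w₁ w₂ r₁ r₂) (H : StepData p b B) (hε : 0 < ε) (hε1 : ε ≤ 1)
    (hx : IsGrid N x h) (h0 : ‖![w₁ 0, w₂ 0] - ZI‖ ≤ e₀) {n : ℕ} (hn : n ∈ Icc 1 N) :
    ‖![w₁ (x n), w₂ (x n)] - march (fun n => matA1 p b ε (x n) (x (n + 1))) ZI n‖ ≤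
      Real.exp (23 * B ^ 4) * (e₀ + (13 * B ^ 4 * ε ^ 2 * min ε h * W + 3 * B ^ 2 * ρ)) := by
  have hB := H.one_le
  have hW := Hw.W_nonneg
  have hρ := Hw.ρ_nonneg
  have hm : 0 ≤ min ε h := le_min hε.le hx.nonneg
  refine hx.norm_sub_march_le (A := matA1 p b ε) (by positivity) (by positivity)
    (fun s t hs hst ht => H.norm_matA1_mulVec_le hε hε1 hs hst ht)
    (fun s t hs hst ht hh => (Hw.step_first H hε hε1 hs hst ht).trans ?_) h0 hn
  have := sub_nonneg.2 hst
  gcongr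

theorem NearSolution.norm_sub_second_le {p b : ℝ → ℝ} {ε ρ W B h e₀ : ℝ} {w₁ w₂ r₁ r₂ : ℝ → ℂ}
    {N : ℕ} {x : ℕ → ℝ} {ZI : Fin 2 → ℂ}
    (Hw : NearSolution p b ε ρ W w₁ w₂ r₁ r₂) (H : StepData p b B) (hε : 0 < ε) (hε1 : ε ≤ 1)
    (hx : IsGrid N x h) (h0 : ‖![w₁ 0, w₂ 0] - ZI‖ ≤ e₀) {n : ℕ} (hn : n ∈ Icc 1 N) :
    ‖![w₁ (x n), w₂ (x n)] - march (fun n => matA2 p b ε (x n) (x (n + 1)) +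
        matA3 p b ε (x n) (x (n + 1))) ZI n‖ ≤
      Real.exp (23 * B ^ 4) * (e₀ + (38 * B ^ 5 * ε ^ 3 * h ^ 2 * W + 3 * B ^ 2 * ρ)) := by
  have hB := H.one_le
  have hW := Hw.W_nonneg
  have hρ := Hw.ρ_nonneg
  have hh0 := hx.nonneg
  refine hx.norm_sub_march_le (A := fun s t => matA2 p b ε s t + matA3 p b ε s t) (by positivity) (by positivity)
    (fun s t hs hst ht => H.norm_matA2_add_matA3_mulVec_le hε hε1 hs hst ht)
    (fun s t hs hst ht hh => (Hw.step_second H hε hε1 hs hst ht).trans ?_) h0 hn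
  have := sub_nonneg.2 hst
  gcongr

/-! ### The exact phase and powers of a -/

namespace HypothesisA

variable {a : ℝ → ℝ} {a₀ ε₀ ε x : ℝ}

theorem pos (hA : HypothesisA a a₀ ε₀) (hx : x ∈ Icc (0 : ℝ) 1) : 0 < a x :=
  hA.a₀_pos.trans_le (hA.lower x hx)

theorem rpow_smooth (hA : HypothesisA a a₀ ε₀) (r : ℝ) :
    ContDiffOn ℝ (⊤ : ℕ∞) (fun y => a y ^ r) (Icc 0 1) :=
  hA.smooth.rpow_const_of_ne fun _ hx => (hA.pos hx).ne'

theorem sqrt_smooth (hA : HypothesisA a a₀ ε₀) :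
    ContDiffOn ℝ (⊤ : ℕ∞) (fun y => √(a y)) (Icc 0 1) :=
  hA.smooth.sqrt fun _ hx => (hA.pos hx).ne'

theorem beta_smooth (hA : HypothesisA a a₀ ε₀) : ContDiffOn ℝ (⊤ : ℕ∞) (beta a) (Icc 0 1) := by
  refine ContDiffOn.mul (ContDiffOn.neg (contDiffOn_const.div
    (contDiffOn_const.mul (hA.rpow_smooth _)) fun x hx => ?_)) (hA.rpow_smooth _).dx.dx
  have := Real.rpow_pos_of_pos (hA.pos hx) (1 / 4)
  positivity

theorem hasDeriv_phase (hA : HypothesisA a a₀ ε₀) (ε : ℝ) (hx : x ∈ Icc (0 : ℝ) 1) :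
    HasDerivWithinAt (phase a ε) (√(a x) - ε ^ 2 * beta a x) (Icc 0 1) x := by
  have hc : ContinuousOn (fun τ => √(a τ) - ε ^ 2 * beta a τ) (Icc 0 1) :=
    hA.sqrt_smooth.continuousOn.sub (continuousOn_const.mul hA.beta_smooth.continuousOn)
  set f := fun τ => √(a τ) - ε ^ 2 * beta a τ with hf
  -- Extending the integrand continuously to the whole line makes the two-sided fundamental theorem
  -- of calculus available at the end points.
  have hg : Continuous (IccExtend zero_le_one ((Icc (0 : ℝ) 1).domRestrict f)) :=
    (continuousOn_iff_continuous_domRestrict.1 hc).Icc_extend'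
  have hgf : EqOn f (IccExtend zero_le_one ((Icc (0 : ℝ) 1).domRestrict f)) (Icc 0 1) := fun y hy => by
    rw [IccExtend_of_mem _ _ hy]; rfl
  have hd := (hg.integral_hasStrictDerivAt 0 x).hasDerivAt.hasDerivWithinAt (s := Icc 0 1)
  rw [← hgf hx] at hd
  refine hd.congr_of_mem (fun y hy => ?_) hx
  refine intervalIntegral.integral_congr fun τ hτ => ?_
  rw [uIcc_of_le hy.1] at hτ
  exact hgf ⟨hτ.1, hτ.2.trans hy.2⟩

theorem dx_phase (hA : HypothesisA a a₀ ε₀) (ε : ℝ) :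
    EqOn (dx (phase a ε)) (fun x => √(a x) - ε ^ 2 * beta a x) (Icc 0 1) :=
  fun _ hx => dx_eq hx (hA.hasDeriv_phase ε hx)

theorem hasDeriv_dx_phase (hA : HypothesisA a a₀ ε₀) (ε : ℝ) (hx : x ∈ Icc (0 : ℝ) 1) :
    HasDerivWithinAt (fun x => √(a x) - ε ^ 2 * beta a x)
      (dx (fun y => √(a y)) x - ε ^ 2 * dx (beta a) x) (Icc 0 1) x :=
  (smooth_hasDeriv hA.sqrt_smooth hx).sub ((smooth_hasDeriv hA.beta_smooth hx).const_mul _)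

theorem dx_dx_phase (hA : HypothesisA a a₀ ε₀) (ε : ℝ) : EqOn (dx (dx (phase a ε)))
    (fun x => dx (fun y => √(a y)) x - ε ^ 2 * dx (beta a) x) (Icc 0 1) := fun x hx => by
  rw [dx_congr (hA.dx_phase ε) hx]
  exact dx_eq hx (hA.hasDeriv_dx_phase ε hx)

/-- Where β > 0, squaring the condition on ε₀ gives ε₀² < √a/β; elsewhere the correction has the
right sign. -/
theorem sqrt_sub_pos (hA : HypothesisA a a₀ ε₀) (hx : x ∈ Icc (0 : ℝ) 1) :
    0 < √(a x) - ε₀ ^ 2 * beta a x := by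
  have ha := hA.pos hx
  have hs := Real.sqrt_pos.2 ha
  have h0 := hA.ε₀_pos
  rcases le_or_gt (beta a x) 0 with hb | hb
  · nlinarith [sq_nonneg ε₀]
  · have h := hA.ε₀_lt x hx hb
    have h2 : ε₀ ^ 2 < (a x ^ (1 / 4 : ℝ) * beta a x ^ (-(1 / 2) : ℝ)) ^ 2 := by gcongr
    have e1 : (a x ^ (1 / 4 : ℝ)) ^ 2 = √(a x) := by
      rw [← Real.rpow_natCast, ← Real.rpow_mul ha.le, Real.sqrt_eq_rpow]; norm_num
    have e2 : (beta a x ^ (-(1 / 2) : ℝ)) ^ 2 = (beta a x)⁻¹ := by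
      rw [← Real.rpow_natCast, ← Real.rpow_mul hb.le, ← Real.rpow_neg_one]; norm_num
    rw [mul_pow, e1, e2, ← div_eq_mul_inv, lt_div_iff₀ hb] at h2
    linarith

theorem exists_lower (hA : HypothesisA a a₀ ε₀) : ∃ c > 0, ∀ ε ∈ Ioc 0 ε₀, ∀ x ∈ Icc (0 : ℝ) 1,
    c ≤ √(a x) - ε ^ 2 * beta a x := by
  have hc : ContinuousOn (fun τ => √(a τ) - ε₀ ^ 2 * beta a τ) (Icc 0 1) :=
    hA.sqrt_smooth.continuousOn.sub (continuousOn_const.mul hA.beta_smooth.continuousOn)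
  obtain ⟨y, hy, hmin⟩ := isCompact_Icc.exists_isMinOn (nonempty_Icc.2 zero_le_one) hc
  -- The worst ε is ε₀ where β > 0; where β ≤ 0 the correction is nonnegative and √a₀ suffices. The
  -- minimum over [0,1] makes the bound uniform.
  refine ⟨min √a₀ (√(a y) - ε₀ ^ 2 * beta a y),
    lt_min (Real.sqrt_pos.2 hA.a₀_pos) (hA.sqrt_sub_pos hy), fun ε hε x hx => ?_⟩
  rcases le_or_gt (beta a x) 0 with hb | hb
  · refine (min_le_left _ _).trans ((Real.sqrt_le_sqrt (hA.lower x hx)).trans ?_)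
    nlinarith [sq_nonneg ε]
  · refine (min_le_right _ _).trans ((hmin hx).trans ?_)
    have : ε ^ 2 ≤ ε₀ ^ 2 := pow_le_pow_left₀ hε.1.le hε.2 2
    simp only
    nlinarith

theorem _root_.WKB.exists_abs_le {f : ℝ → ℝ} (hf : ContDiffOn ℝ (⊤ : ℕ∞) f (Icc 0 1)) :
    ∃ C, ∀ x ∈ Icc (0 : ℝ) 1, |f x| ≤ C :=
  isCompact_Icc.exists_bound_of_continuousOn hf.continuousOn

theorem exists_upper (hA : HypothesisA a a₀ ε₀) : ∃ B, 1 ≤ B ∧ ∀ x ∈ Icc (0 : ℝ) 1,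
    |beta a x| ≤ B ∧ |dx (beta a) x| ≤ B ∧ |dx (fun y => √(a y)) x| ≤ B := by
  obtain ⟨C₁, h₁⟩ := exists_abs_le hA.beta_smooth
  obtain ⟨C₂, h₂⟩ := exists_abs_le hA.beta_smooth.dx
  obtain ⟨C₃, h₃⟩ := exists_abs_le hA.sqrt_smooth.dx
  refine ⟨max 1 (max C₁ (max C₂ C₃)), le_max_left _ _, fun x hx =>
    ⟨(h₁ x hx).trans ?_, (h₂ x hx).trans ?_, (h₃ x hx).trans ?_⟩⟩ <;> simp

theorem quarter_mul (hA : HypothesisA a a₀ ε₀) (hx : x ∈ Icc (0 : ℝ) 1) :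
    a x ^ (1 / 4 : ℝ) * a x ^ (-(1 / 4) : ℝ) = 1 := by
  rw [← Real.rpow_add (hA.pos hx)]; norm_num

theorem quarter_sq (hA : HypothesisA a a₀ ε₀) (hx : x ∈ Icc (0 : ℝ) 1) :
    (a x ^ (1 / 4 : ℝ)) ^ 2 = √(a x) := by
  rw [← Real.rpow_natCast, ← Real.rpow_mul (hA.pos hx).le, Real.sqrt_eq_rpow]; norm_num

theorem quarter_pow_four (hA : HypothesisA a a₀ ε₀) (hx : x ∈ Icc (0 : ℝ) 1) :
    (a x ^ (1 / 4 : ℝ)) ^ 4 = a x := by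
  rw [← Real.rpow_natCast, ← Real.rpow_mul (hA.pos hx).le]; norm_num

theorem dx_quarter (hA : HypothesisA a a₀ ε₀) (hx : x ∈ Icc (0 : ℝ) 1) :
    dx (fun y => a y ^ (1 / 4 : ℝ)) x =
      -(a x ^ (1 / 4 : ℝ)) ^ 2 * dx (fun y => a y ^ (-(1 / 4) : ℝ)) x := by
  have h1 := smooth_hasDeriv (hA.rpow_smooth (1 / 4)) hx
  have h2 := smooth_hasDeriv (hA.rpow_smooth (-(1 / 4))) hx
  have h3 := dx_eq hx (h1.mul h2)
  have h4 : dx ((fun y => a y ^ (1 / 4 : ℝ)) * fun y => a y ^ (-(1 / 4) : ℝ)) x = 0 :=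
    dx_eq hx ((hasDerivWithinAt_const x _ (1 : ℝ)).congr_of_mem
      (fun y hy => hA.quarter_mul hy) hx)
  rw [h4] at h3
  have h5 := hA.quarter_mul hx
  linear_combination (-a x ^ (1 / 4 : ℝ)) * h3 - dx (fun y => a y ^ (1 / 4 : ℝ)) x * h5

end HypothesisA

/-! ### The first order system for U -/

namespace IsSolution

variable {a : ℝ → ℝ} {a₀ ε₀ ε x : ℝ} {ψ₀ ψ₁ : ℂ} {ψ : ℝ → ℂ}

theorem hasDeriv (hψ : IsSolution a ε ψ₀ ψ₁ ψ) (hx : x ∈ Icc (0 : ℝ) 1) :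
    HasDerivWithinAt ψ (dx ψ x) (Icc 0 1) x :=
  hψ.smooth.hasDerivWithinAt_dx (by norm_num) hx

theorem dx_smooth (hψ : IsSolution a ε ψ₀ ψ₁ ψ) : ContDiffOn ℝ 1 (dx ψ) (Icc 0 1) :=
  hψ.smooth.derivWithin (uniqueDiffOn_Icc zero_lt_one) (by norm_num)

theorem hasDeriv_dx (hψ : IsSolution a ε ψ₀ ψ₁ ψ) (hx : x ∈ Icc (0 : ℝ) 1) :
    HasDerivWithinAt (dx ψ) (dx (dx ψ) x) (Icc 0 1) x :=
  hψ.dx_smooth.hasDerivWithinAt_dx (by norm_num) hx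

/-- Both sides are continuous on [0,1], so the equation passes from the open interval to its
closure. -/
theorem ode_Icc (hψ : IsSolution a ε ψ₀ ψ₁ ψ) (hA : HypothesisA a a₀ ε₀)
    (hx : x ∈ Icc (0 : ℝ) 1) : (ε : ℂ) ^ 2 * dx (dx ψ) x + (a x : ℂ) * ψ x = 0 := by
  have h2 : ContinuousOn (dx (dx ψ)) (Icc 0 1) :=
    (hψ.dx_smooth.derivWithin (m := 0) (uniqueDiffOn_Icc zero_lt_one) (by norm_num)).continuousOn
  have hc : ContinuousOn (fun x => (ε : ℂ) ^ 2 * dx (dx ψ) x + (a x : ℂ) * ψ x) (Icc 0 1) :=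
    (continuousOn_const.mul h2).add
      ((Complex.continuous_ofReal.comp_continuousOn hA.smooth.continuousOn).mul
        hψ.smooth.continuousOn)
  have : EqOn (fun x => (ε : ℂ) ^ 2 * dx (dx ψ) x + (a x : ℂ) * ψ x) (fun _ => 0) (Ioo 0 1) :=
    fun y hy => hψ.ode y hy
  exact this.of_subset_closure hc continuousOn_const Ioo_subset_Icc_self
    (by rw [closure_Ioo zero_ne_one]) hx

theorem dx_scaled (hψ : IsSolution a ε ψ₀ ψ₁ ψ) (hA : HypothesisA a a₀ ε₀)
    (hx : x ∈ Icc (0 : ℝ) 1) : HasDerivWithinAt (fun y => ((a y ^ (1 / 4 : ℝ) : ℝ) : ℂ) * ψ y)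
      (((dx (fun y => a y ^ (1 / 4 : ℝ)) x : ℝ) : ℂ) * ψ x +
        ((a x ^ (1 / 4 : ℝ) : ℝ) : ℂ) * dx ψ x) (Icc 0 1) x :=
  (smooth_hasDeriv (hA.rpow_smooth (1 / 4)) hx).ofReal_comp.mul (hψ.hasDeriv hx)

/-- A Wronskian form: on differentiation the products of first derivatives cancel and only ψ'' and
(a^{-1/4})'' remain, that is, a ψ and β. -/
theorem vecU_one (hψ : IsSolution a ε ψ₀ ψ₁ ψ) (hA : HypothesisA a a₀ ε₀)
    (hx : x ∈ Icc (0 : ℝ) 1) : vecU a ε ψ x 1 =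
      (ε : ℂ) * (((a x ^ (-(1 / 4) : ℝ) : ℝ) : ℂ) * dx ψ x -
        ((dx (fun y => a y ^ (-(1 / 4) : ℝ)) x : ℝ) : ℂ) * ψ x) := by
  have h := dx_eq hx (hψ.dx_scaled hA hx)
  simp only [vecU, Matrix.cons_val_one, Matrix.cons_val_fin_one]
  rw [h, hA.dx_quarter hx, ← hA.quarter_sq hx]
  have h1 : ((a x ^ (1 / 4 : ℝ) : ℝ) : ℂ) * ((a x ^ (-(1 / 4) : ℝ) : ℝ) : ℂ) = 1 := by
    exact_mod_cast hA.quarter_mul hx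
  have h2 : ((a x ^ (1 / 4 : ℝ) : ℝ) : ℂ) ≠ 0 := left_ne_zero_of_mul_eq_one h1
  push_cast
  rw [div_eq_iff (pow_ne_zero 2 h2)]
  linear_combination (-(ε : ℂ) * ((a x ^ (1 / 4 : ℝ) : ℝ) : ℂ) * dx ψ x) * h1

theorem hasDeriv_vecU_zero (hψ : IsSolution a ε ψ₀ ψ₁ ψ) (hA : HypothesisA a a₀ ε₀) (hε : 0 < ε)
    (hx : x ∈ Icc (0 : ℝ) 1) : HasDerivWithinAt (fun y => vecU a ε ψ y 0)
      (((√(a x) / ε : ℝ) : ℂ) * vecU a ε ψ x 1) (Icc 0 1) x := by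
  have h := hψ.dx_scaled hA hx
  refine h.congr_deriv ?_
  rw [← dx_eq hx h]
  simp only [vecU, Matrix.cons_val_one, Matrix.cons_val_fin_one]
  have h1 : (ε : ℂ) ≠ 0 := by exact_mod_cast hε.ne'
  have h2 : ((√(a x) : ℝ) : ℂ) ≠ 0 := by exact_mod_cast (Real.sqrt_pos.2 (hA.pos hx)).ne'
  push_cast
  field_simp

theorem hasDeriv_vecU_one (hψ : IsSolution a ε ψ₀ ψ₁ ψ) (hA : HypothesisA a a₀ ε₀) (hε : 0 < ε)
    (hx : x ∈ Icc (0 : ℝ) 1) : HasDerivWithinAt (fun y => vecU a ε ψ y 1)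
      (((-√(a x) / ε + 2 * ε * beta a x : ℝ) : ℂ) * vecU a ε ψ x 0) (Icc 0 1) x := by
  have hq := hA.rpow_smooth (-(1 / 4))
  have h := ((((smooth_hasDeriv hq hx).ofReal_comp.mul (hψ.hasDeriv_dx hx)).sub
    ((smooth_hasDeriv hq.dx hx).ofReal_comp.mul (hψ.hasDeriv hx))).const_mul (ε : ℂ))
  refine (h.congr_of_mem (fun y hy => hψ.vecU_one hA hy) hx).congr_deriv ?_
  have ho := hψ.ode_Icc hA hx
  have h1 : ((a x ^ (1 / 4 : ℝ) : ℝ) : ℂ) * ((a x ^ (-(1 / 4) : ℝ) : ℝ) : ℂ) = 1 := by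
    exact_mod_cast hA.quarter_mul hx
  have h2 : ((a x ^ (1 / 4 : ℝ) : ℝ) : ℂ) ≠ 0 := left_ne_zero_of_mul_eq_one h1
  have h3 : ((a x ^ (-(1 / 4) : ℝ) : ℝ) : ℂ) = ((a x ^ (1 / 4 : ℝ) : ℝ) : ℂ)⁻¹ :=
    eq_inv_of_mul_eq_one_right h1
  have h4 : (ε : ℂ) ≠ 0 := by exact_mod_cast hε.ne'
  have h5 : dx (dx ψ) x = -(a x : ℂ) * ψ x / (ε : ℂ) ^ 2 := by
    rw [eq_div_iff (pow_ne_zero 2 h4)]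
    linear_combination ho
  simp only [vecU, Matrix.cons_val_zero, beta]
  rw [h5, h3, ← hA.quarter_sq hx]
  nth_rewrite 2 [← hA.quarter_pow_four hx]
  push_cast
  field_simp
  ring

end IsSolution

/-! ### The slowly varying amplitude and the back-transformation -/

/-- The slowly varying amplitude `Z = e^{-(i/ε)Φ} P U` of a solution. -/
noncomputable def amplitude (a : ℝ → ℝ) (ε : ℝ) (ψ : ℝ → ℂ) (x : ℝ) : Fin 2 → ℂ :=
  (expPhase ε (-phase a ε x)).mulVec (matP.mulVec (vecU a ε ψ x))

theorem amplitude_zero (a : ℝ → ℝ) (ε : ℝ) (ψ : ℝ → ℂ) (x : ℝ) : amplitude a ε ψ x 0 =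
    Complex.exp (Complex.I * (-phase a ε x / ε : ℝ)) *
      (((1 / √2 : ℝ) : ℂ) * (Complex.I * vecU a ε ψ x 0 + vecU a ε ψ x 1)) := by
  simp [amplitude, expPhase, matP, Matrix.mulVec, dotProduct, Fin.sum_univ_two]
  ring

theorem amplitude_one (a : ℝ → ℝ) (ε : ℝ) (ψ : ℝ → ℂ) (x : ℝ) : amplitude a ε ψ x 1 =
    Complex.exp (-(Complex.I * (-phase a ε x / ε : ℝ))) *
      (((1 / √2 : ℝ) : ℂ) * (vecU a ε ψ x 0 + Complex.I * vecU a ε ψ x 1)) := by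
  simp [amplitude, expPhase, matP, Matrix.mulVec, dotProduct, Fin.sum_univ_two]
  ring

theorem matPinv_mul_matP : matPinv * matP = 1 :=
  mul_eq_one_comm.1 matP_mul_matPinv

theorem expPhase_mul_neg (ε s : ℝ) : expPhase ε s * expPhase ε (-s) = 1 := by
  ext i j
  fin_cases i <;> fin_cases j <;>
    simp [expPhase, Matrix.mul_apply, Fin.sum_univ_two, ← Complex.exp_add, neg_div]

theorem vecU_eq_amplitude (a : ℝ → ℝ) (ε : ℝ) (ψ : ℝ → ℂ) (x : ℝ) : vecU a ε ψ x =
    matPinv.mulVec ((expPhase ε (phase a ε x)).mulVec (amplitude a ε ψ x)) := by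
  rw [amplitude, Matrix.mulVec_mulVec _ (expPhase ε (phase a ε x)), expPhase_mul_neg,
    Matrix.one_mulVec, Matrix.mulVec_mulVec, matPinv_mul_matP, Matrix.one_mulVec]

theorem amplitude_init (a : ℝ → ℝ) (ε : ℝ) (ψ : ℝ → ℂ) :
    amplitude a ε ψ 0 = matP.mulVec (vecU a ε ψ 0) := by
  have : expPhase ε 0 = 1 := by
    ext i j
    fin_cases i <;> fin_cases j <;> simp [expPhase]
  simp [amplitude, phase, this]

theorem norm_inv_sqrt_two_le : ‖((1 / √2 : ℝ) : ℂ)‖ ≤ 1 := by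
  rw [Complex.norm_real, Real.norm_of_nonneg (by positivity), div_le_one (by positivity)]
  exact Real.one_le_sqrt.2 (by norm_num)

theorem norm_matP_mulVec_le (v : Fin 2 → ℂ) : ‖matP.mulVec v‖ ≤ 2 * ‖v‖ := by
  have := norm_inv_sqrt_two_le
  rw [show (2 : ℝ) = 1 + 1 by norm_num]
  refine norm_mulVec_le ?_ ?_ ?_ ?_ v <;> simpa [matP] using this

theorem norm_matPinv_mulVec_le (v : Fin 2 → ℂ) : ‖matPinv.mulVec v‖ ≤ 2 * ‖v‖ := by
  have := norm_inv_sqrt_two_le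
  rw [show (2 : ℝ) = 1 + 1 by norm_num]
  refine norm_mulVec_le ?_ ?_ ?_ ?_ v <;> simpa [matPinv] using this

/-- The phase error multiplies only z. In the application z is the exact amplitude, for which a
uniform bound is known. -/
theorem norm_expPhase_sub_le {ε s t : ℝ} (hε : 0 < ε) (z y : Fin 2 → ℂ) :
    ‖(expPhase ε s).mulVec z - (expPhase ε t).mulVec y‖ ≤ |s - t| / ε * ‖z‖ + ‖z - y‖ := by
  have aux : ∀ s t : ℝ, ∀ u v : ℂ, ‖Complex.exp (Complex.I * (s : ℝ)) * u -
      Complex.exp (Complex.I * (t : ℝ)) * v‖ ≤ |s - t| * ‖u‖ + ‖u - v‖ := fun s t u v => by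
    have e : Complex.exp (Complex.I * (s : ℝ)) * u - Complex.exp (Complex.I * (t : ℝ)) * v =
        Complex.exp (Complex.I * (t : ℝ)) * (H₁ (s - t) * u + (u - v)) := by
      rw [H₁]
      have : Complex.exp (Complex.I * (s : ℝ)) = Complex.exp (Complex.I * (t : ℝ)) *
          Complex.exp (Complex.I * (s - t : ℝ)) := by
        rw [← Complex.exp_add]; congr 1; push_cast; ring
      rw [this]; ring
    rw [e, norm_mul, norm_exp_I_mul, one_mul]
    exact norm_add_le_of_le (norm_mul_le_of_le (norm_H₁_le _) le_rfl) le_rfl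
  have hz := norm_le_pi_norm z
  have hy := norm_le_pi_norm (z - y)
  refine norm_fin_two_le ?_ ?_
  · have := aux (s / ε) (t / ε) (z 0) (y 0)
    rw [← sub_div, abs_div, abs_of_pos hε] at this
    refine le_trans (le_of_eq ?_) (this.trans ?_)
    · simp [expPhase, dotProduct, Fin.sum_univ_two]
    · gcongr
      · exact hz 0
      · exact hy 0
  · have := aux (-(s / ε)) (-(t / ε)) (z 1) (y 1)
    rw [neg_sub_neg, ← sub_div, abs_div, abs_of_pos hε, abs_sub_comm] at this
    refine le_trans (le_of_eq ?_) (this.trans ?_)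
    · simp [expPhase, dotProduct, Fin.sum_univ_two]
    · gcongr
      · exact hz 1
      · exact hy 1

namespace IsSolution

variable {a : ℝ → ℝ} {a₀ ε₀ ε x : ℝ} {ψ₀ ψ₁ : ℂ} {ψ : ℝ → ℂ}

/-- P turns the system for U into the diagonal ±i(√a/ε - εβ) plus an off-diagonal part of size εβ.
The diagonal is ±iφ'/ε and is removed by the exponential factor; this is the reason for the ε²β in
the phase. -/
theorem hasDeriv_amplitude (hψ : IsSolution a ε ψ₀ ψ₁ ψ) (hA : HypothesisA a a₀ ε₀) (hε : 0 < ε)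
    (hx : x ∈ Icc (0 : ℝ) 1) :
    HasDerivWithinAt (fun y => amplitude a ε ψ y 0)
      (conj (coef (phase a ε) (beta a) ε x) * amplitude a ε ψ x 1) (Icc 0 1) x ∧
    HasDerivWithinAt (fun y => amplitude a ε ψ y 1)
      (coef (phase a ε) (beta a) ε x * amplitude a ε ψ x 0) (Icc 0 1) x := by
  have h0 := hψ.hasDeriv_vecU_zero hA hε hx
  have h1 := hψ.hasDeriv_vecU_one hA hε hx
  have hφ := (((hA.hasDeriv_phase ε hx).neg.div_const ε).congr_deriv
    (show _ = -(√(a x) / ε - ε * beta a x) by field_simp)).ofReal_comp.const_mul Complex.I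
  rw [neg_div] at h1
  have he := hφ.cexp
  have he' := hφ.neg.cexp
  have hI := Complex.I_sq
  have hε' : (ε : ℂ) ≠ 0 := by exact_mod_cast hε.ne'
  have k1 : Complex.exp (Complex.I * (-phase a ε x / ε : ℝ)) *
      Complex.exp (-(Complex.I * (-phase a ε x / ε : ℝ))) = 1 := by
    rw [← Complex.exp_add, add_neg_cancel, Complex.exp_zero]
  have k2 : osc ε (phase a ε x) = Complex.exp (-(Complex.I * (-phase a ε x / ε : ℝ))) ^ 2 := by
    rw [osc, sq, ← Complex.exp_add]; congr 1; push_cast; field_simp; ring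
  have k3 : conj (osc ε (phase a ε x)) = Complex.exp (Complex.I * (-phase a ε x / ε : ℝ)) ^ 2 := by
    rw [conj_osc, osc, sq, ← Complex.exp_add]; congr 1; push_cast; field_simp; ring
  simp_rw [amplitude_zero, amplitude_one]
  constructor
  · refine (he.mul (((h0.const_mul Complex.I).add h1).const_mul _)).congr_deriv ?_
    rw [coef, map_mul, Complex.conj_ofReal, k3]
    simp only [Pi.neg_apply, Pi.add_apply] at k1 ⊢
    generalize Complex.exp (Complex.I * (-phase a ε x / ε : ℝ)) = e at *
    generalize Complex.exp (-(Complex.I * (-phase a ε x / ε : ℝ))) = e' at *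
    generalize √(a x) / ε = s
    generalize (1 / √2 : ℝ) = κ
    push_cast
    linear_combination (-e * κ * (s - ε * beta a x) * vecU a ε ψ x 0) * hI -
      (ε * beta a x * κ * e * (vecU a ε ψ x 0 + Complex.I * vecU a ε ψ x 1)) * k1
  · refine (he'.mul ((h0.add (h1.const_mul Complex.I)).const_mul _)).congr_deriv ?_
    rw [coef, k2]
    simp only [Pi.neg_apply, Pi.add_apply] at k1 ⊢
    generalize Complex.exp (Complex.I * (-phase a ε x / ε : ℝ)) = e at *
    generalize Complex.exp (-(Complex.I * (-phase a ε x / ε : ℝ))) = e' at *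
    generalize √(a x) / ε = s
    generalize (1 / √2 : ℝ) = κ
    push_cast
    linear_combination (e' * κ * (s - ε * beta a x) * vecU a ε ψ x 1) * hI -
      (ε * beta a x * κ * e' * (Complex.I * vecU a ε ψ x 0 + vecU a ε ψ x 1)) * k1

theorem norm_amplitude_le (hψ : IsSolution a ε ψ₀ ψ₁ ψ) (hA : HypothesisA a a₀ ε₀) (hε : 0 < ε)
    (hε1 : ε ≤ 1) {B : ℝ} (hB : ∀ x ∈ Icc (0 : ℝ) 1, |beta a x| ≤ B) (hx : x ∈ Icc (0 : ℝ) 1) :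
    ‖amplitude a ε ψ x‖ ≤ 2 * ‖vecU a ε ψ 0‖ * Real.exp B := by
  have hd := fun y hy => hψ.hasDeriv_amplitude hA hε (x := y) hy
  have hB0 : 0 ≤ B := (abs_nonneg _).trans (hB 0 (by simp))
  have hd' : ∀ y ∈ Icc (0 : ℝ) 1, HasDerivWithinAt (amplitude a ε ψ)
      ![conj (coef (phase a ε) (beta a) ε y) * amplitude a ε ψ y 1,
        coef (phase a ε) (beta a) ε y * amplitude a ε ψ y 0] (Icc 0 1) y := fun y hy =>
    hasDerivWithinAt_pi.2 (Fin.forall_fin_two.2 (hd y hy))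
  have hc : ∀ y ∈ Icc (0 : ℝ) 1, ‖coef (phase a ε) (beta a) ε y‖ ≤ B := fun y hy => by
    rw [norm_coef _ _ hε]
    exact (mul_le_of_le_one_left (abs_nonneg _) hε1).trans (hB y hy)
  have := norm_le_gronwallBound_of_norm_deriv_right_le (f := amplitude a ε ψ) (a := 0) (b := 1)
    (δ := 2 * ‖vecU a ε ψ 0‖) (K := B) (ε := 0) (fun y hy => (hd' y hy).continuousWithinAt)
    (fun y hy => (hd' y (Ico_subset_Icc_self hy)).mono_of_mem_nhdsWithin
      (Icc_mem_nhdsGE_of_mem hy))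
    (by rw [amplitude_init]; exact norm_matP_mulVec_le _)
    (fun y hy => by
      have hy' := Ico_subset_Icc_self hy
      rw [add_zero]
      refine norm_fin_two_le ?_ ?_
      · exact norm_mul_le_of_le ((RCLike.norm_conj _).trans_le (hc y hy')) (norm_le_pi_norm _ 1)
      · exact norm_mul_le_of_le (hc y hy') (norm_le_pi_norm _ 0)) x hx
  rw [gronwallBound_ε0, sub_zero] at this
  refine this.trans ?_
  gcongr
  exact mul_le_of_le_one_right hB0 hx.2

end IsSolution

theorem HypothesisA.exists_vecU_init_le {a : ℝ → ℝ} {a₀ ε₀ : ℝ} (hA : HypothesisA a a₀ ε₀)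
    (R : ℝ) : ∃ M, ∀ ε ∈ Ioc (0 : ℝ) 1, ∀ (ψ₀ ψ₁ : ℂ) (ψ : ℝ → ℂ), ‖ψ₀‖ ≤ R → ‖ψ₁‖ ≤ R →
      IsSolution a ε ψ₀ ψ₁ ψ → ‖vecU a ε ψ 0‖ ≤ M := by
  have h0 : (0 : ℝ) ∈ Icc (0 : ℝ) 1 := by simp
  refine ⟨max (|a 0 ^ (1 / 4 : ℝ)| * R) (|a 0 ^ (-(1 / 4) : ℝ)| * R +
    |dx (fun y => a y ^ (-(1 / 4) : ℝ)) 0| * R), fun ε hε ψ₀ ψ₁ ψ h₀ h₁ hψ => norm_fin_two_le ?_ ?_⟩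
  · refine le_trans ?_ (le_max_left _ _)
    simp only [vecU, Matrix.cons_val_zero, hψ.init₀]
    exact norm_mul_le_of_le (Complex.norm_real _).le h₀
  · refine le_trans ?_ (le_max_right _ _)
    rw [hψ.vecU_one hA h0, mul_sub, mul_left_comm, hψ.init₁, hψ.init₀, mul_left_comm]
    refine norm_sub_le_of_le (norm_mul_le_of_le (Complex.norm_real _).le h₁)
      (norm_mul_le_of_le (Complex.norm_real _).le ?_)
    rw [norm_mul, Complex.norm_real, Real.norm_of_nonneg hε.1.le]
    exact (mul_le_of_le_one_left (norm_nonneg _) hε.2).trans h₀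

theorem StepData.mono {p b : ℝ → ℝ} {B B' : ℝ} (H : StepData p b B) (h : B ≤ B') :
    StepData p b B' :=
  { one_le := H.one_le.trans h
    hp := H.hp
    p_ne := H.p_ne
    p_bd := fun x hx => (H.p_bd x hx).trans h
    b_bd := fun x hx => (H.b_bd x hx).trans h
    hβ := H.hβ
    β_bd := fun k hk x hx => (H.β_bd k hk x hx).trans h
    dβ_bd := fun k hk x hx => (H.dβ_bd k hk x hx).trans h
    hF := H.hF
    hF' := H.hF'
    F_bd := fun x hx => (H.F_bd x hx).trans h }

/-! ### Replacing the exact phase and coefficient by approximations -/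

theorem norm_osc_sub_osc_le {ε : ℝ} (hε : 0 < ε) (s t : ℝ) :
    ‖osc ε s - osc ε t‖ ≤ 2 / ε * |s - t| := by
  rw [← osc_mul_H₁, norm_mul, norm_osc, one_mul]
  refine (norm_H₁_le _).trans (le_of_eq ?_)
  rw [abs_mul, abs_of_pos (by positivity)]

/-- An oscillatory antiderivative `q` of the difference of two coefficients turns an exact solution
for one phase into a near solution for the other one. -/
theorem nearSolution_of_antideriv {φ β p b : ℝ → ℝ} {ε G δ δ₀ Z : ℝ} {z₁ z₂ q q' : ℝ → ℂ}
    (hz₁ : ∀ x ∈ Icc (0 : ℝ) 1,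
      HasDerivWithinAt z₁ (conj (coef φ β ε x) * z₂ x) (Icc 0 1) x)
    (hz₂ : ∀ x ∈ Icc (0 : ℝ) 1, HasDerivWithinAt z₂ (coef φ β ε x * z₁ x) (Icc 0 1) x)
    (hq : ∀ x ∈ Icc (0 : ℝ) 1, HasDerivWithinAt q (q' x) (Icc 0 1) x)
    (bz₁ : ∀ x ∈ Icc (0 : ℝ) 1, ‖z₁ x‖ ≤ Z) (bz₂ : ∀ x ∈ Icc (0 : ℝ) 1, ‖z₂ x‖ ≤ Z)
    (bq : ∀ x ∈ Icc (0 : ℝ) 1, ‖q x‖ ≤ δ)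
    (br : ∀ x ∈ Icc (0 : ℝ) 1, ‖coef φ β ε x - q' x - coef p b ε x‖ ≤ δ₀)
    (bφ : ∀ x ∈ Icc (0 : ℝ) 1, ‖coef φ β ε x‖ ≤ G) (bp : ∀ x ∈ Icc (0 : ℝ) 1, ‖coef p b ε x‖ ≤ G) :
    NearSolution p b ε ((δ₀ + 2 * G * δ) * Z) ((1 + δ) * Z) (fun x => z₁ x - conj (q x) * z₂ x)
      (fun x => z₂ x - q x * z₁ x)
      (fun x => conj (coef φ β ε x - q' x - coef p b ε x) * z₂ x +
        (conj (coef p b ε x) * q x - conj (q x) * coef φ β ε x) * z₁ x)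
      (fun x => (coef φ β ε x - q' x - coef p b ε x) * z₁ x +
        (coef p b ε x * conj (q x) - q x * conj (coef φ β ε x)) * z₂ x) := by
  have m0 : (0 : ℝ) ∈ Icc (0 : ℝ) 1 := by simp
  have hδ := (norm_nonneg _).trans (bq 0 m0)
  have hδ₀ := (norm_nonneg _).trans (br 0 m0)
  have hG := (norm_nonneg _).trans (bφ 0 m0)
  have hZ := (norm_nonneg _).trans (bz₁ 0 m0)
  have nc : ∀ {u : ℂ} {C : ℝ}, ‖u‖ ≤ C → ‖conj u‖ ≤ C := fun h => (RCLike.norm_conj _).trans_le h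
  have e1 : (δ₀ + 2 * G * δ) * Z = δ₀ * Z + (G * δ + δ * G) * Z := by ring
  have e2 : (1 + δ) * Z = Z + δ * Z := by ring
  refine ⟨by positivity, fun x hx => ?_, fun x hx => ?_, fun x hx => ?_, fun x hx => ?_,
    fun x hx => ?_, fun x hx => ?_⟩
  · refine ((hz₁ x hx).sub ((hasDerivWithinAt_conj (hq x hx)).mul (hz₂ x hx))).congr_deriv ?_
    simp only [map_sub]
    ring
  · refine ((hz₂ x hx).sub ((hq x hx).mul (hz₁ x hx))).congr_deriv ?_
    ring
  · rw [e1]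
    exact norm_add_le_of_le (norm_mul_le_of_le (nc (br x hx)) (bz₂ x hx))
      (norm_mul_le_of_le (norm_sub_le_of_le (norm_mul_le_of_le (nc (bp x hx)) (bq x hx))
        (norm_mul_le_of_le (nc (bq x hx)) (bφ x hx))) (bz₁ x hx))
  · rw [e1]
    exact norm_add_le_of_le (norm_mul_le_of_le (br x hx) (bz₁ x hx))
      (norm_mul_le_of_le (norm_sub_le_of_le (norm_mul_le_of_le (bp x hx) (nc (bq x hx)))
        (norm_mul_le_of_le (bq x hx) (nc (bφ x hx)))) (bz₂ x hx))
  · rw [e2]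
    exact norm_sub_le_of_le (bz₁ x hx) (norm_mul_le_of_le (nc (bq x hx)) (bz₂ x hx))
  · rw [e2]
    exact norm_sub_le_of_le (bz₂ x hx) (norm_mul_le_of_le (bq x hx) (bz₁ x hx))

/-- Replacing the phase `φ` and the coefficient `β` by approximations `p` and `b`. -/
theorem exists_nearSolution {φ φ₁ φ₂ β v₁ p b : ℝ → ℝ} {ε G E E' E'' : ℝ} {z₁ z₂ : ℝ → ℂ}
    (H : StepData p b G) (hε : 0 < ε) (hε1 : ε ≤ 1)
    (hφ : ∀ x ∈ Icc (0 : ℝ) 1, HasDerivWithinAt φ (φ₁ x) (Icc 0 1) x)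
    (hφ₁ : ∀ x ∈ Icc (0 : ℝ) 1, HasDerivWithinAt φ₁ (φ₂ x) (Icc 0 1) x)
    (hv : ∀ x ∈ Icc (0 : ℝ) 1, HasDerivWithinAt (fun y => β y - b y) (v₁ x) (Icc 0 1) x)
    (hl : ∀ x ∈ Icc (0 : ℝ) 1, G⁻¹ ≤ φ₁ x) (bφ₂ : ∀ x ∈ Icc (0 : ℝ) 1, |φ₂ x| ≤ 2 * G)
    (bβ : ∀ x ∈ Icc (0 : ℝ) 1, |β x| ≤ G)
    (hE : ∀ x ∈ Icc (0 : ℝ) 1, |φ x - p x| ≤ E)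
    (hE' : ∀ x ∈ Icc (0 : ℝ) 1, |β x - b x| ≤ G * E')
    (hE'' : ∀ x ∈ Icc (0 : ℝ) 1, |v₁ x| ≤ G * E'')
    (hz₁ : ∀ x ∈ Icc (0 : ℝ) 1,
      HasDerivWithinAt z₁ (conj (coef φ β ε x) * z₂ x) (Icc 0 1) x)
    (hz₂ : ∀ x ∈ Icc (0 : ℝ) 1, HasDerivWithinAt z₂ (coef φ β ε x * z₁ x) (Icc 0 1) x)
    (bz₁ : ∀ x ∈ Icc (0 : ℝ) 1, ‖z₁ x‖ ≤ G) (bz₂ : ∀ x ∈ Icc (0 : ℝ) 1, ‖z₂ x‖ ≤ G) :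
    ∃ w₁ w₂ r₁ r₂, NearSolution p b ε (4 * G ^ 5 * (E / ε + ε ^ 2 * (E' + E''))) (3 * G ^ 3)
      w₁ w₂ r₁ r₂ ∧ ∀ x ∈ Icc (0 : ℝ) 1,
        ‖![w₁ x, w₂ x] - ![z₁ x, z₂ x]‖ ≤ G ^ 3 * (E / ε + ε ^ 2 * (E' + E'')) := by
  have hG := H.one_le
  have m0 : (0 : ℝ) ∈ Icc (0 : ℝ) 1 := by simp
  have hG0 : 0 < G := by linarith
  have E0 : 0 ≤ E := (abs_nonneg _).trans (hE 0 m0)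
  have E0' : 0 ≤ E' := nonneg_of_mul_nonneg_right ((abs_nonneg _).trans (hE' 0 m0)) hG0
  have E0'' : 0 ≤ E'' := nonneg_of_mul_nonneg_right ((abs_nonneg _).trans (hE'' 0 m0)) hG0
  set T := E / ε + ε ^ 2 * (E' + E'') with hT
  have T0 : 0 ≤ T := by positivity
  have φ₁pos : ∀ x ∈ Icc (0 : ℝ) 1, 0 < φ₁ x := fun x hx => (inv_pos.2 hG0).trans_le (hl x hx)
  have φ₁inv : ∀ x ∈ Icc (0 : ℝ) 1, (φ₁ x)⁻¹ ≤ G := fun x hx =>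
    inv_le_of_inv_le₀ hG0 (hl x hx)
  let m : ℝ → ℝ := fun x => (β x - b x) / (2 * φ₁ x)
  let m' : ℝ → ℝ := fun x => (v₁ x * (2 * φ₁ x) - (β x - b x) * (2 * φ₂ x)) / (2 * φ₁ x) ^ 2
  have hm : ∀ x ∈ Icc (0 : ℝ) 1, HasDerivWithinAt m (m' x) (Icc 0 1) x := fun x hx =>
    (hv x hx).div ((hφ₁ x hx).const_mul 2) (by have := φ₁pos x hx; positivity)
  have bm : ∀ x ∈ Icc (0 : ℝ) 1, ∀ V, |β x - b x| ≤ V → |m x| ≤ G * V := fun x hx V hV => by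
    have := φ₁pos x hx
    have V0 := (abs_nonneg _).trans hV
    simp only [m]
    rw [abs_div, abs_of_pos (by positivity : 0 < 2 * φ₁ x), div_eq_mul_inv, mul_inv]
    calc |β x - b x| * (2⁻¹ * (φ₁ x)⁻¹) ≤ V * (1 * G) := by
          have := φ₁inv x hx
          gcongr
          norm_num
      _ = _ := by ring
  have bm' : ∀ x ∈ Icc (0 : ℝ) 1, |m' x| ≤ 2 * G ^ 4 * (E' + E'') := fun x hx => by
    have h0 := φ₁pos x hx
    have e : m' x = v₁ x * (2⁻¹ * (φ₁ x)⁻¹) - (β x - b x) * (φ₂ x * (2⁻¹ * (φ₁ x)⁻¹ ^ 2)) := by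
      simp only [m']
      field_simp
    have hi := φ₁inv x hx
    have hi0 : 0 < (φ₁ x)⁻¹ := inv_pos.2 h0
    have h1 := hE' x hx
    have h2 := hE'' x hx
    have h3 := bφ₂ x hx
    rw [e]
    refine (abs_sub _ _).trans ?_
    rw [abs_mul (v₁ x), abs_mul (β x - b x), abs_mul (φ₂ x), abs_of_pos (by positivity : 0 < 2⁻¹ * (φ₁ x)⁻¹),
      abs_of_pos (by positivity : 0 < 2⁻¹ * (φ₁ x)⁻¹ ^ 2)]
    calc |v₁ x| * (2⁻¹ * (φ₁ x)⁻¹) + |β x - b x| * (|φ₂ x| * (2⁻¹ * (φ₁ x)⁻¹ ^ 2))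
        ≤ G * E'' * (1 * G) + G * E' * (2 * G * (1 * G ^ 2)) := by
          gcongr <;> norm_num
      _ = G ^ 2 * E'' + 2 * G ^ 4 * E' := by ring
      _ ≤ 2 * G ^ 4 * E'' + 2 * G ^ 4 * E' := by
          have : G ^ 2 ≤ G ^ 4 := pow_le_pow_right₀ hG (by norm_num)
          gcongr
          linarith [pow_pos hG0 4]
      _ = _ := by ring
  have hc : (ε : ℂ) ≠ 0 := by exact_mod_cast hε.ne'
  -- One integration by parts of ε(β - b)e^{2iφ/ε}, with m = (β - b)/(2φ'); it gains a factor ε and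
  -- leaves only a term with m', controlled by E' and E''.
  let q : ℝ → ℂ := fun x => -(Complex.I * (ε : ℂ) ^ 2) * ((m x : ℂ) * osc ε (φ x))
  let q' : ℝ → ℂ := fun x => ((ε * (β x - b x) : ℝ) : ℂ) * osc ε (φ x) -
    Complex.I * (ε : ℂ) ^ 2 * m' x * osc ε (φ x)
  have hq : ∀ x ∈ Icc (0 : ℝ) 1, HasDerivWithinAt q (q' x) (Icc 0 1) x := fun x hx => by
    refine (((hm x hx).ofReal_comp.mul (hasDerivWithinAt_osc (ε := ε) (hφ x hx))).const_mul
      (-(Complex.I * (ε : ℂ) ^ 2))).congr_deriv ?_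
    have h0 := φ₁pos x hx
    have e : β x - b x = 2 * φ₁ x * m x := by simp only [m]; field_simp
    have hk : (ε : ℂ) * (2 * Complex.I * (φ₁ x : ℝ) / ε) = 2 * Complex.I * (φ₁ x : ℝ) := by
      field_simp
    simp only [q', e]
    push_cast
    generalize 2 * Complex.I * ((φ₁ x : ℝ) : ℂ) / ε = c at *
    linear_combination (-Complex.I * ε * m x * osc ε (φ x)) * hk -
      2 * ε * φ₁ x * m x * osc ε (φ x) * Complex.I_sq
  have nq : ∀ x, ‖q x‖ = ε ^ 2 * |m x| := fun x => by
    simp only [q, norm_mul, norm_neg, norm_pow, Complex.norm_I, Complex.norm_real, norm_osc,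
      Real.norm_eq_abs, abs_of_pos hε, one_mul, mul_one]
  have bq : ∀ x ∈ Icc (0 : ℝ) 1, ‖q x‖ ≤ G ^ 2 * T := fun x hx => by
    rw [nq]
    calc ε ^ 2 * |m x| ≤ ε ^ 2 * (G * (G * E')) := by
          gcongr; exact bm x hx _ (hE' x hx)
      _ = G ^ 2 * (ε ^ 2 * E') := by ring
      _ ≤ G ^ 2 * T := by
          gcongr
          rw [hT, mul_add]
          have : 0 ≤ E / ε := by positivity
          have : 0 ≤ ε ^ 2 * E'' := by positivity
          linarith
  -- A second bound without E', as E' may be arbitrarily large: the size W of the near solution must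
  -- depend on G alone. The residual is taken from `bq` and the size from `bq2`.
  have bq2 : ∀ x ∈ Icc (0 : ℝ) 1, ‖q x‖ ≤ 2 * G ^ 2 := fun x hx => by
    rw [nq]
    have h1 : |β x - b x| ≤ 2 * G := by
      refine (abs_sub _ _).trans ?_
      linarith [bβ x hx, H.b_bd x hx]
    calc ε ^ 2 * |m x| ≤ 1 * (G * (2 * G)) := by
          gcongr
          · exact pow_le_one₀ hε.le hε1
          · exact bm x hx _ h1
      _ = _ := by ring
  have br : ∀ x ∈ Icc (0 : ℝ) 1, ‖coef φ β ε x - q' x - coef p b ε x‖ ≤ 2 * G ^ 4 * T :=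
    fun x hx => by
    have e : coef φ β ε x - q' x - coef p b ε x = ((ε * b x : ℝ) : ℂ) *
        (osc ε (φ x) - osc ε (p x)) + Complex.I * (ε : ℂ) ^ 2 * m' x * osc ε (φ x) := by
      simp only [coef, q']
      push_cast
      ring
    rw [e]
    refine (norm_add_le _ _).trans ?_
    simp only [norm_mul, norm_pow, Complex.norm_I, Complex.norm_real, norm_osc,
      Real.norm_eq_abs, abs_of_pos hε, one_mul, mul_one]
    calc ε * |b x| * ‖osc ε (φ x) - osc ε (p x)‖ + ε ^ 2 * |m' x|
        ≤ ε * G * (2 / ε * E) + ε ^ 2 * (2 * G ^ 4 * (E' + E'')) := by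
          gcongr
          · exact H.b_bd x hx
          · refine (norm_osc_sub_osc_le hε _ _).trans ?_
            gcongr
            exact hE x hx
          · exact bm' x hx
      _ = 2 * G * E + 2 * G ^ 4 * (ε ^ 2 * (E' + E'')) := by field_simp
      _ ≤ 2 * G ^ 4 * (E / ε) + 2 * G ^ 4 * (ε ^ 2 * (E' + E'')) := by
          have h1 : G ≤ G ^ 4 := le_self_pow₀ hG (by norm_num)
          have h2 : E ≤ E / ε := (le_div_iff₀ hε).2 (mul_le_of_le_one_right E0 hε1)
          gcongr
      _ = _ := by rw [hT]; ring
  have bc : ∀ x ∈ Icc (0 : ℝ) 1, ‖coef φ β ε x‖ ≤ G := fun x hx => by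
    rw [norm_coef _ _ hε]
    exact (mul_le_of_le_one_left (abs_nonneg _) hε1).trans (bβ x hx)
  have bc' : ∀ x ∈ Icc (0 : ℝ) 1, ‖coef p b ε x‖ ≤ G := fun x hx => by
    rw [norm_coef _ _ hε]
    exact (mul_le_of_le_one_left (abs_nonneg _) hε1).trans (H.b_bd x hx)
  have N := nearSolution_of_antideriv hz₁ hz₂ hq bz₁ bz₂ bq br bc bc'
  have N' := nearSolution_of_antideriv hz₁ hz₂ hq bz₁ bz₂ bq2 br bc bc'
  have hρ : (2 * G ^ 4 * T + 2 * G * (G ^ 2 * T)) * G ≤ 4 * G ^ 5 * T := by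
    have h1 : G ^ 4 ≤ G ^ 5 := pow_le_pow_right₀ hG (by norm_num)
    have := mul_le_mul_of_nonneg_right h1 T0
    linarith
  have hW : (1 + 2 * G ^ 2) * G ≤ 3 * G ^ 3 := by
    have h1 : G ≤ G ^ 3 := le_self_pow₀ hG (by norm_num)
    linarith
  refine ⟨_, _, _, _, ⟨by positivity, N.deriv₁, N.deriv₂, fun x hx => (N.res₁ x hx).trans hρ,
    fun x hx => (N.res₂ x hx).trans hρ, fun x hx => (N'.bound₁ x hx).trans hW,
    fun x hx => (N'.bound₂ x hx).trans hW⟩, fun x hx => ?_⟩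
  rw [show G ^ 3 * T = G ^ 2 * T * G by ring]
  refine norm_fin_two_le ?_ ?_
  · have := norm_mul_le_of_le ((RCLike.norm_conj _).trans_le (bq x hx)) (bz₂ x hx)
    simpa using this
  · have := norm_mul_le_of_le (bq x hx) (bz₁ x hx)
    simpa using this

/-! ### Coefficient errors from phase errors, and assembly of the estimate -/

theorem exists_seminorm_le (ν : Seminorm ℂ (Fin 2 → ℂ)) : ∃ C, 0 ≤ C ∧ ∀ v, ν v ≤ C * ‖v‖ := by
  refine ⟨ν (Pi.single 0 1) + ν (Pi.single 1 1), add_nonneg (apply_nonneg _ _) (apply_nonneg _ _),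
    fun v => ?_⟩
  have e : v = v 0 • Pi.single 0 1 + v 1 • Pi.single 1 1 := by
    ext i; fin_cases i <;> simp
  calc ν v = ν (v 0 • Pi.single 0 1 + v 1 • Pi.single 1 1) := by rw [← e]
    _ ≤ ‖v 0‖ * ν (Pi.single 0 1) + ‖v 1‖ * ν (Pi.single 1 1) := by
        refine (map_add_le_add ν _ _).trans ?_
        rw [map_smul_eq_mul, map_smul_eq_mul]
    _ ≤ ‖v‖ * ν (Pi.single 0 1) + ‖v‖ * ν (Pi.single 1 1) := by
        gcongr
        · exact norm_le_pi_norm v 0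
        · exact norm_le_pi_norm v 1
    _ = _ := by ring

theorem abs_le_of_two_scales {u v e M : ℝ} (he : 0 < e) (h₁ : |u - e ^ 2 * v| ≤ M)
    (h₂ : |u - (e / 2) ^ 2 * v| ≤ M) : |v| ≤ 8 / (3 * e ^ 2) * M := by
  have h : |3 / 4 * e ^ 2 * v| ≤ M + M := by
    rw [show 3 / 4 * e ^ 2 * v = (u - (e / 2) ^ 2 * v) - (u - e ^ 2 * v) by ring]
    exact (abs_sub _ _).trans (add_le_add h₂ h₁)
  rw [abs_mul, abs_of_pos (by positivity)] at h
  rw [div_mul_eq_mul_div, le_div_iff₀ (by positivity)]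
  linarith

/-- φ' - φ̃' = (√a - φ̃₁') - ε²(β - φ̃₂') is affine in ε² and at most E' in absolute value for every
admissible ε. Its values at ε' and ε'/2 determine the slope; the same holds one derivative higher.
-/
theorem PhaseErrors.coef_bounds {a p₁ p₂ : ℝ → ℝ} {a₀ ε₀ C₂ ε' E E' E'' : ℝ}
    (h : PhaseErrors a p₁ p₂ ε' E E' E'') (hA : HypothesisA a a₀ ε₀)
    (hB : HypothesisB p₁ p₂ C₂) (hε' : 0 < ε') {x : ℝ} (hx : x ∈ Icc (0 : ℝ) 1) :
    |beta a x - dx p₂ x| ≤ 8 / (3 * ε' ^ 2) * E' ∧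
      |dx (beta a) x - dx (dx p₂) x| ≤ 8 / (3 * ε' ^ 2) * E'' := by
  have key : ∀ ε ∈ Ioc 0 ε',
      |(√(a x) - dx p₁ x) - ε ^ 2 * (beta a x - dx p₂ x)| ≤ E' ∧
      |(dx (fun y => √(a y)) x - dx (dx p₁) x) - ε ^ 2 * (dx (beta a) x - dx (dx p₂) x)| ≤ E'' :=
    fun ε hε => by
      obtain ⟨-, h1, h2⟩ := h ε hε x hx
      rw [hA.dx_phase ε hx, hB.dx_approxPhase ε hx] at h1
      rw [hA.dx_dx_phase ε hx, hB.dx_dx_approxPhase ε hx] at h2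
      refine ⟨le_trans (le_of_eq ?_) h1, le_trans (le_of_eq ?_) h2⟩ <;>
      · congr 1
        ring
  have k1 := key ε' ⟨hε', le_rfl⟩
  have k2 := key (ε' / 2) ⟨by positivity, by linarith⟩
  exact ⟨abs_le_of_two_scales hε' k1.1 k2.1, abs_le_of_two_scales hε' k1.2 k2.2⟩

/-- The exact amplitude z and the numerical one Z are compared through the near solution w. The
constants come from its size 3G³ and residual 4G⁵T: 114 = 38 · 3 and 12 = 3 · 4. -/
theorem norm_sub_backTransform_le {ε φ p E T σ G : ℝ} {z w Z : Fin 2 → ℂ} (hε : 0 < ε)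
    (hG : 1 ≤ G) (hE : |φ - p| ≤ E) (hET : E / ε ≤ T) (hσ : 0 ≤ σ) (hz : ‖z‖ ≤ G)
    (hwz : ‖w - z‖ ≤ G ^ 3 * T)
    (hwZ : ‖w - Z‖ ≤ Real.exp (23 * G ^ 4) *
      (G ^ 3 * T + (114 * G ^ 8 * σ + 12 * G ^ 7 * T))) :
    ‖matPinv.mulVec ((expPhase ε φ).mulVec z) - matPinv.mulVec ((expPhase ε p).mulVec Z)‖ ≤
      300 * G ^ 8 * Real.exp (23 * G ^ 4) * (T + σ) := by
  have hE0 : 0 ≤ E := (abs_nonneg _).trans hE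
  have hT : 0 ≤ T := le_trans (by positivity) hET
  set X := Real.exp (23 * G ^ 4)
  have hX : 1 ≤ X := Real.one_le_exp (by positivity)
  have p1 : G ≤ G ^ 8 := le_self_pow₀ hG (by norm_num)
  have p3 : G ^ 3 ≤ G ^ 8 := pow_le_pow_right₀ hG (by norm_num)
  have p7 : G ^ 7 ≤ G ^ 8 := pow_le_pow_right₀ hG (by norm_num)
  have hX8 : G ^ 8 ≤ X * G ^ 8 := le_mul_of_one_le_left (by positivity) hX
  have h1 : ‖z - Z‖ ≤ G ^ 3 * T + X * (G ^ 3 * T + (114 * G ^ 8 * σ + 12 * G ^ 7 * T)) := by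
    rw [← sub_add_sub_cancel z w Z]
    exact norm_add_le_of_le (by rwa [norm_sub_rev]) hwZ
  have h2 : |φ - p| / ε * ‖z‖ ≤ T * G := by
    gcongr
    exact (div_le_div_of_nonneg_right hE hε.le).trans hET
  rw [← Matrix.mulVec_sub]
  refine (norm_matPinv_mulVec_le _).trans ?_
  calc 2 * ‖(expPhase ε φ).mulVec z - (expPhase ε p).mulVec Z‖
      ≤ 2 * (T * G + (G ^ 3 * T + X * (G ^ 3 * T + (114 * G ^ 8 * σ + 12 * G ^ 7 * T)))) := by
        gcongr
        exact (norm_expPhase_sub_le hε z Z).trans (add_le_add h2 h1)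
    _ ≤ 2 * (T * (X * G ^ 8) + ((X * G ^ 8) * T +
          X * (G ^ 8 * T + (114 * G ^ 8 * σ + 12 * G ^ 8 * T)))) := by
        gcongr
        · exact p1.trans hX8
        · exact p3.trans hX8
    _ = G ^ 8 * X * (30 * T + 228 * σ) := by ring
    _ ≤ G ^ 8 * X * (300 * T + 300 * σ) := by gcongr <;> norm_num
    _ = _ := by ring

theorem exists_global_error_bound {a : ℝ → ℝ} {a₀ ε₀ : ℝ} (hA : HypothesisA a a₀ ε₀)
    (C₂ K R : ℝ) {ε' C₃ : ℝ} (hε' : ε' ∈ Ioc 0 ε₀) (hC₃ : 0 < C₃) :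
    ∃ C > 0, ∀ p₁ p₂ : ℝ → ℝ,
      HypothesisB p₁ p₂ C₂ → DerivBound p₁ p₂ K → PhaseDerivLower p₁ p₂ ε' C₃ →
      ∀ E E' E'' : ℝ, PhaseErrors a p₁ p₂ ε' E E' E'' →
      ∀ ε ∈ Ioc 0 ε', ∀ (ψ₀ ψ₁ : ℂ) (ψ : ℝ → ℂ), ‖ψ₀‖ ≤ R → ‖ψ₁‖ ≤ R →
        IsSolution a ε ψ₀ ψ₁ ψ →
      ∀ (N : ℕ) (x : ℕ → ℝ) (h : ℝ), IsGrid N x h → ∀ n ∈ Icc 1 N,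
        ‖vecU a ε ψ (x n) - backU p₁ p₂ ε x (firstZ p₁ p₂ ε x (vecU a ε ψ 0)) n‖
          ≤ C * (E / ε + ε ^ 2 * (E' + E'') + ε ^ 2 * min ε h) ∧
        ‖vecU a ε ψ (x n) - backU p₁ p₂ ε x (secondZ p₁ p₂ ε x (vecU a ε ψ 0)) n‖
          ≤ C * (E / ε + ε ^ 2 * (E' + E'') + ε ^ 3 * h ^ 2) := by
  have hε'1 : ε' ≤ 1 := hε'.2.trans hA.ε₀_lt_one.le
  obtain ⟨B, hB⟩ := exists_uniform_stepData C₂ K C₃ ε' hε'1 hC₃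
  obtain ⟨c, hc, hcl⟩ := hA.exists_lower
  obtain ⟨A, hA1, hAu⟩ := hA.exists_upper
  obtain ⟨M, hM⟩ := hA.exists_vecU_init_le R
  -- One constant dominating, in this order, the scheme data, β and the derivatives of β and √a, the
  -- reciprocal of the lower bound of φ', the factor from the two-scale argument, and the amplitude.
  obtain ⟨G, hGdef⟩ : ∃ G, G = |B| + A + c⁻¹ + 8 / (3 * ε' ^ 2) + 2 * |M| * Real.exp A := ⟨_, rfl⟩
  have q1 := abs_nonneg B
  have q2 : 0 < c⁻¹ := inv_pos.2 hc
  have q3 : 0 < 8 / (3 * ε' ^ 2) := by have := hε'.1; positivity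
  have q4 : 0 ≤ 2 * |M| * Real.exp A := by positivity
  have hG : 1 ≤ G := by linarith
  have gB : B ≤ G := by linarith [le_abs_self B]
  have gA : A ≤ G := by linarith
  have gc : G⁻¹ ≤ c := inv_le_of_inv_le₀ hc (by linarith)
  have ge : 8 / (3 * ε' ^ 2) ≤ G := by linarith
  have gM : 2 * |M| * Real.exp A ≤ G := by linarith
  refine ⟨300 * G ^ 8 * Real.exp (23 * G ^ 4), by positivity, ?_⟩
  intro p₁ p₂ hp hK hl E E' E'' hE ε hε ψ₀ ψ₁ ψ h₀ h₁ hψ N x h hx n hn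
  have hε0 := hε.1
  have hε1 : ε ≤ 1 := hε.2.trans hε'1
  have hεε₀ : ε ∈ Ioc 0 ε₀ := ⟨hε.1, hε.2.trans hε'.2⟩
  have m0 : (0 : ℝ) ∈ Icc (0 : ℝ) 1 := by simp
  have H := (hB p₁ p₂ hp hK hl ε hε).mono gB
  have hd := fun y hy => hψ.hasDeriv_amplitude hA hε0 (x := y) hy
  have E0 := (abs_nonneg _).trans (hE ε hε 0 m0).1
  have E0' := (abs_nonneg _).trans (hE ε hε 0 m0).2.1
  have E0'' := (abs_nonneg _).trans (hE ε hε 0 m0).2.2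
  have hz : ∀ y ∈ Icc (0 : ℝ) 1, ‖amplitude a ε ψ y‖ ≤ G := fun y hy => by
    refine (hψ.norm_amplitude_le hA hε0 hε1 (fun y hy => (hAu y hy).1) hy).trans (le_trans ?_ gM)
    gcongr
    exact (hM ε ⟨hε0, hε1⟩ ψ₀ ψ₁ ψ h₀ h₁ hψ).trans (le_abs_self M)
  obtain ⟨w₁, w₂, r₁, r₂, hw, hwz⟩ := exists_nearSolution
    (φ := phase a ε) (φ₁ := fun x => √(a x) - ε ^ 2 * beta a x)
    (φ₂ := fun x => dx (fun y => √(a y)) x - ε ^ 2 * dx (beta a) x) (β := beta a)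
    (v₁ := fun x => dx (beta a) x - dx (dx p₂) x)
    (z₁ := fun y => amplitude a ε ψ y 0) (z₂ := fun y => amplitude a ε ψ y 1)
    (E := E) (E' := E') (E'' := E'') H hε0 hε1
    (fun y hy => hA.hasDeriv_phase ε hy) (fun y hy => hA.hasDeriv_dx_phase ε hy)
    (fun y hy => (smooth_hasDeriv hA.beta_smooth hy).sub (smooth_hasDeriv hp.smooth₂.dx hy))
    (fun y hy => gc.trans (hcl ε hεε₀ y hy))
    (fun y hy => by
      obtain ⟨-, h2, h3⟩ := hAu y hy
      refine (abs_sub _ _).trans ?_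
      rw [abs_mul, abs_of_pos (by positivity : 0 < ε ^ 2)]
      have : ε ^ 2 * |dx (beta a) y| ≤ |dx (beta a) y| :=
        mul_le_of_le_one_left (abs_nonneg _) (pow_le_one₀ hε0.le hε1)
      linarith)
    (fun y hy => (hAu y hy).1.trans gA)
    (fun y hy => (hE ε hε y hy).1)
    (fun y hy => ((hE.coef_bounds hA hp hε'.1 hy).1).trans (by gcongr))
    (fun y hy => ((hE.coef_bounds hA hp hε'.1 hy).2).trans (by gcongr))
    (fun y hy => (hd y hy).1) (fun y hy => (hd y hy).2)
    (fun y hy => (norm_le_pi_norm _ 0).trans (hz y hy))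
    (fun y hy => (norm_le_pi_norm _ 1).trans (hz y hy))
  set T := E / ε + ε ^ 2 * (E' + E'') with hT
  have hET : E / ε ≤ T := le_add_of_nonneg_right (by positivity)
  have eta : ∀ y, ![amplitude a ε ψ y 0, amplitude a ε ψ y 1] = amplitude a ε ψ y := fun y => by
    ext i; fin_cases i <;> rfl
  simp only [eta] at hwz
  have hxn := hx.mem hn
  have hh := hx.nonneg
  have w0 := hwz 0 m0
  rw [amplitude_init] at w0
  have pt := (hE ε hε _ hxn).1
  have hmin : 0 ≤ min ε h := le_min hε0.le hh
  have p78 : G ^ 7 ≤ G ^ 8 := pow_le_pow_right₀ hG (by norm_num)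
  rw [vecU_eq_amplitude a ε ψ (x n)]
  constructor
  · refine norm_sub_backTransform_le hε0 hG pt hET (by positivity) (hz _ hxn) (hwz _ hxn)
      ((hw.norm_sub_first_le H hε0 hε1 hx w0 hn).trans ?_)
    refine mul_le_mul_of_nonneg_left (add_le_add le_rfl ?_) (Real.exp_nonneg _)
    calc 13 * G ^ 4 * ε ^ 2 * min ε h * (3 * G ^ 3) + 3 * G ^ 2 * (4 * G ^ 5 * T)
        = 39 * G ^ 7 * (ε ^ 2 * min ε h) + 12 * G ^ 7 * T := by ring
      _ ≤ 114 * G ^ 8 * (ε ^ 2 * min ε h) + 12 * G ^ 7 * T := by gcongr; norm_num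
  · refine norm_sub_backTransform_le hε0 hG pt hET (by positivity) (hz _ hxn) (hwz _ hxn)
      ((hw.norm_sub_second_le H hε0 hε1 hx w0 hn).trans (le_of_eq ?_))
    ring

end WKB

theorem theorem3p2 (a : ℝ → ℝ) (a₀ ε₀ : ℝ) (hA : WKB.HypothesisA a a₀ ε₀)
    (C₂ K R : ℝ) (hC₂ : 0 < C₂) (ν : Seminorm ℂ (Fin 2 → ℂ)) :
    (∃ ε' ∈ Set.Ioc 0 ε₀, ∃ C₃ > 0, ∀ p₁ p₂ : ℝ → ℝ,
      WKB.HypothesisB p₁ p₂ C₂ → WKB.DerivBound p₁ p₂ K → WKB.PhaseDerivLower p₁ p₂ ε' C₃) ∧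
    (∀ ε' ∈ Set.Ioc 0 ε₀, ∀ C₃ > 0, ∃ C > 0, ∀ p₁ p₂ : ℝ → ℝ,
      WKB.HypothesisB p₁ p₂ C₂ → WKB.DerivBound p₁ p₂ K → WKB.PhaseDerivLower p₁ p₂ ε' C₃ →
      ∀ E E' E'' : ℝ, WKB.PhaseErrors a p₁ p₂ ε' E E' E'' →
      ∀ ε ∈ Set.Ioc 0 ε', ∀ (ψ₀ ψ₁ : ℂ) (ψ : ℝ → ℂ), ‖ψ₀‖ ≤ R → ‖ψ₁‖ ≤ R →
        WKB.IsSolution a ε ψ₀ ψ₁ ψ →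
      ∀ (N : ℕ) (x : ℕ → ℝ) (h : ℝ), WKB.IsGrid N x h →
      ∀ n ∈ Set.Icc 1 N,
        ν (WKB.vecU a ε ψ (x n) -
            WKB.backU p₁ p₂ ε x (WKB.firstZ p₁ p₂ ε x (WKB.vecU a ε ψ 0)) n)
          ≤ C * (E / ε) + C * ε ^ 2 * min ε h + C * ε * (min ε E + ε * (E' + E'')) ∧
        ν (WKB.vecU a ε ψ (x n) -
            WKB.backU p₁ p₂ ε x (WKB.secondZ p₁ p₂ ε x (WKB.vecU a ε ψ 0)) n)
          ≤ C * (E / ε) + C * ε ^ 3 * h ^ 2 + C * ε * (min ε E + ε * (E' + E''))) := by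
  refine ⟨WKB.exists_phaseDerivLower C₂ K ε₀ hC₂ hA.ε₀_pos hA.ε₀_lt_one, fun ε' hε' C₃ hC₃ => ?_⟩
  obtain ⟨C, hC, hbound⟩ := WKB.exists_global_error_bound hA C₂ K R hε' hC₃
  obtain ⟨D, hD, hν⟩ := WKB.exists_seminorm_le ν
  -- D + 1 keeps the constant positive even for a seminorm with D = 0.
  refine ⟨(D + 1) * C, by positivity, ?_⟩
  intro p₁ p₂ hp hK hl E E' E'' hE ε hε ψ₀ ψ₁ ψ h₀ h₁ hψ N x h hx n hn
  obtain ⟨b₁, b₂⟩ := hbound p₁ p₂ hp hK hl E E' E'' hE ε hε ψ₀ ψ₁ ψ h₀ h₁ hψ N x h hx n hn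
  have hε0 := hε.1
  have E0 : 0 ≤ E := (abs_nonneg _).trans (hE ε hε 0 (by simp)).1
  have hmin : 0 ≤ (D + 1) * C * ε * min ε E := by
    have : 0 ≤ min ε E := le_min hε0.le E0
    positivity
  have key : ∀ v : Fin 2 → ℂ, ∀ σ : ℝ, ‖v‖ ≤ C * σ → ν v ≤ (D + 1) * C * σ := fun v σ hv => by
    calc ν v ≤ D * ‖v‖ := hν v
      _ ≤ (D + 1) * ‖v‖ := by gcongr; linarith
      _ ≤ (D + 1) * (C * σ) := by gcongr
      _ = _ := by ring
  exact ⟨(key _ _ b₁).trans (by linarith), (key _ _ b₂).trans (by linarith)⟩
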